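/- **Setting.** Let $\mathcal Q$ be a finite set of models and let $\ast$ be the true model, which may or may not belong to $\mathcal Q$. Each model $q\in\mathcal Q\cup\{\ast\}$ is a time-invariant system with states in $\mathbb R^n$ and outputs in $\mathbb R^l$, $$x_{k+1}=A^qx_k+B^qu^q_k+G^qd_k+w_k,\qquad y_k=C^qx_k+D^qu^q_k+H^qd_k+v_k ,$$ with known input $u^q_k\in\mathbb R^m$, unknown input $d_k\in\mathbb R^{p_q}$ and noise covariances $Q^q\succeq0$, $R^q\succ0$. The data $x_k,y_k$ are generated by model $\ast$. The initial state $x_0$ is Gaussian, $w_k\sim N(0,Q^\ast)$, $v_k\sim N(0,R^\ast)$, and $x_0,w_0,v_0,w_1,v_1,\dots$ are independent. The known inputs of all models and the unknown input of the true model are arbitrary, possibly random, signals with finite second moments that vanish for all $k\ge T$, for some finite $T$. **Decomposition.** For each model (superscript $q$ omitted) fix a singular value decomposition $H=U_1\Sigma V_1^\top$, with $\Sigma$ positive diagonal of size $\operatorname{rank}H$ and $[U_1\,U_2]$, $[V_1\,V_2]$ orthogonal. Put $T_1=U_1^\top-U_1^\top RU_2(U_2^\top RU_2)^{-1}U_2^\top$,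 $T_2=U_2^\top$, $C_i=T_iC$, $D_i=T_iD$, $G_i=GV_i$, $R_i=T_iRT_i^\top$, $z_{i,k}=T_iy_k$, $M_1=\Sigma^{-1}$, $\hat A=A-G_1M_1C_1$ and $\hat Q=G_1M_1R_1M_1^\top G_1^\top+Q$. **Filter.** The filter of a model starts from an arbitrary vector $\hat x_{0|0}$ and an arbitrary $P_0\succeq0$. For $k\ge1$, with $P=P_{k-1}$, let $$\tilde P_k=\hat AP\hat A^\top+\hat Q,\quad \tilde R_{2,k}=C_2\tilde P_kC_2^\top+R_2,\quad M_{2,k}=(G_2^\top C_2^\top\tilde R_{2,k}^{-1}C_2G_2)^{-1}G_2^\top C_2^\top\tilde R_{2,k}^{-1},$$ $$P^\star_k=G_2M_{2,k}R_2M_{2,k}^\top G_2^\top+(I-G_2M_{2,k}C_2)\tilde P_k(I-G_2M_{2,k}C_2)^\top,$$ $$\tilde R^\star_{2,k}=C_2P^\star_kC_2^\top+R_2-C_2G_2M_{2,k}R_2-R_2M_{2,k}^\top G_2^\top C_2^\top,\qquad \tilde L_k=(P^\star_kC_2^\top-G_2M_{2,k}R_2)(\tilde R^\star_{2,k})^\dagger,$$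 $$P_k=(I-\tilde L_kC_2)G_2M_{2,k}R_2\tilde L_k^\top+\tilde L_kR_2M_{2,k}^\top G_2^\top(I-\tilde L_kC_2)^\top+(I-\tilde L_kC_2)P^\star_k(I-\tilde L_kC_2)^\top+\tilde L_kR_2\tilde L_k^\top ,$$ where $\dagger$ is the Moore–Penrose inverse. The estimates are $$\hat x_{k|k-1}=A\hat x_{k-1|k-1}+Bu_{k-1}+G_1M_1(z_{1,k-1}-C_1\hat x_{k-1|k-1}-D_1u_{k-1}),$$ $$\hat x^\star_{k|k}=\hat x_{k|k-1}+G_2M_{2,k}(z_{2,k}-C_2\hat x_{k|k-1}-D_2u_k),\quad \bar\nu_k=z_{2,k}-C_2\hat x^\star_{k|k}-D_2u_k,\quad \hat x_{k|k}=\hat x^\star_{k|k}+\tilde L_k\bar\nu_k .$$ The likelihood of model $q$ at time $k\ge1$ is $$f^q_k=\frac{\exp\!\big(-\tfrac12\bar\nu_k^{q\top}(\tilde R^{q,\star}_{2,k})^\dagger\bar\nu^q_k\big)}{(2\pi)^{\rho/2}\,|\tilde R^{q,\star}_{2,k}|_+^{1/2}},\qquad \rho=\operatorname{rank}\tilde R^{q,\star}_{2,k},$$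 where $|\cdot|_+$ is the product of the nonzero eigenvalues. **Assumptions.** Every $q\in\mathcal Q\cup\{\ast\}$ is strongly detectable (with zero known input and no noise, $y\equiv0$ implies $x_k\to0$ for every initial state and every unknown input), and $C_2^qG_2^q$ has full column rank. Every $q\in\mathcal Q$, $q\ne\ast$, is stabilizable, in the sense that the pair $(A^q,[\,G^q\ \ (Q^q)^{1/2}])$ is stabilizable. **Theorem.** For every $q\in\mathcal Q$, $q\neq\ast$, the gains converge: $\tilde L^q_k\to\tilde L^q$ and $M^q_{2,k}\to M^q_2$. Put $$\Gamma^q=\hat A^q\big(\tilde L^q(I-C_2^qG_2^qM_2^q)+G_2^qM_2^q\big)T_2^q+G_1^qM_1^qT_1^q,$$ $$A^{\ast,q}=\begin{bmatrix}A^\ast&0\\ \Gamma^qC^\ast&\hat A^q(I-\tilde L^qC_2^q)(I-G_2^qM_2^qC_2^q)\end{bmatrix},\qquad W^{\ast,q}=\begin{bmatrix}I&0\\0&\Gamma^q\end{bmatrix},\qquad C^{\ast,q}=[\,T_2^qC^\ast\ \ -C_2^q\,].$$ Assume that for every $q\in\mathcal Q$, $q\ne\ast$, all eigenvalues of $A^{\ast,q}$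 lie inside the unit circle. Then: 1. *(Ergodicity.)* For all $i,j\in\mathcal Q$ the log-likelihood-ratio sequence is ergodic. That is, all expectations below (under the true law) exist, the limits $D(f^\ast\|f^q):=\lim_k\mathbb E[\ln(f^\ast_k/f^q_k)]$ for $q=i,j$ exist and are finite, and almost surely $$\lim_{K\to\infty}\frac1K\sum_{k=1}^K\ln\frac{f^j_k}{f^i_k}=\lim_{k\to\infty}\mathbb E\Big[\ln\frac{f^j_k}{f^i_k}\Big]=D(f^\ast\|f^i)-D(f^\ast\|f^j).$$ 2. *(Mismatched residual covariance.)* For every $q\in\mathcal Q$, $q\ne\ast$, the Lyapunov recursion $$\Psi_{k+1}=A^{\ast,q}\Psi_kA^{\ast,q\top}+W^{\ast,q}\begin{bmatrix}Q^\ast&0\\0&R^\ast\end{bmatrix}W^{\ast,q\top}$$ converges, from every initial matrix, to one and the same finite limit $\Psi^q$. This $\Psi^q$ is also the limit of $\mathbb E\big[\xi_k\xi_k^\top\big]$, where $\xi_k=(x_k,\hat x^q_{k|k-1})$, and $$\lim_{k\to\infty}\mathbb E[\bar\nu^q_k\bar\nu^{q\top}_k]=(I-C_2^qG_2^qM_2^q)\big(C^{\ast,q}\Psi^qC^{\ast,q\top}+T_2^qR^\ast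 T_2^{q\top}\big)(I-C_2^qG_2^qM_2^q)^\top .$$ -/

import Mathlib

open MeasureTheory ProbabilityTheory Filter Topology Matrix

noncomputable section

namespace MultiModel

/-! ### Linear algebra -/

/-- `X` is the Moore–Penrose inverse of the real matrix `M`. -/
def IsMoorePenrose {a b : Type*} [Fintype a] [Fintype b]
    (M : Matrix a b ℝ) (X : Matrix b a ℝ) : Prop :=
  M * X * M = M ∧ X * M * X = X ∧ (M * X)ᵀ = M * X ∧ (X * M)ᵀ = X * M

theorem IsMoorePenrose.unique {a b : Type*} [Fintype a] [Fintype b]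
    {M : Matrix a b ℝ} {X Y : Matrix b a ℝ}
    (hX : IsMoorePenrose M X) (hY : IsMoorePenrose M Y) : X = Y := by
  obtain ⟨x1, x2, x3, x4⟩ := hX
  obtain ⟨y1, y2, y3, y4⟩ := hY
  have e1 : M * X = M * Y := by
    calc M * X = (M * X)ᵀ := x3.symm
      _ = (M * Y * M * X)ᵀ := by rw [y1]
      _ = (M * X)ᵀ * (M * Y)ᵀ := by rw [← Matrix.transpose_mul, Matrix.mul_assoc (M * Y)]
      _ = M * X * M * Y := by rw [x3, y3, Matrix.mul_assoc (M * X)]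
      _ = M * Y := by rw [x1]
  have e2 : X * M = Y * M := by
    calc X * M = (X * M)ᵀ := x4.symm
      _ = (X * (M * Y * M))ᵀ := by rw [y1]
      _ = (Y * M)ᵀ * (X * M)ᵀ := by
          rw [← Matrix.transpose_mul]; congr 1; simp only [Matrix.mul_assoc]
      _ = Y * (M * X * M) := by rw [x4, y4]; simp only [Matrix.mul_assoc]
      _ = Y * M := by rw [x1]
  calc X = X * M * X := x2.symm
    _ = Y * (M * X) := by rw [e2, Matrix.mul_assoc]
    _ = Y * M * Y := by rw [e1, Matrix.mul_assoc]
    _ = Y := y2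

theorem exists_isMoorePenrose {a b : Type*} [Fintype a] [Fintype b]
    (M : Matrix a b ℝ) : ∃ X, IsMoorePenrose M X := by
  classical
  have hN : (Mᵀ * M).IsHermitian := by
    simpa [Matrix.conjTranspose_eq_transpose_of_trivial] using
      Matrix.isHermitian_conjTranspose_mul_self M
  obtain ⟨Z, hZ, hZN, h1, h2⟩ : ∃ Z : Matrix b b ℝ, Zᵀ = Z ∧ Z * (Mᵀ * M) = (Mᵀ * M) * Z ∧
      (Mᵀ * M) * Z * (Mᵀ * M) = Mᵀ * M ∧ Z * (Mᵀ * M) * Z = Z := by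
    obtain ⟨U, lam, hUU, hNN⟩ : ∃ (U : Matrix b b ℝ) (lam : b → ℝ), star U * U = 1 ∧
        Mᵀ * M = U * diagonal lam * star U :=
      ⟨(hN.eigenvectorUnitary : Matrix b b ℝ), hN.eigenvalues,
        Unitary.coe_star_mul_self hN.eigenvectorUnitary, by
          have := hN.spectral_theorem
          simpa [Unitary.conjStarAlgAut_apply] using this⟩
    have key : ∀ e g : b → ℝ, U * diagonal e * star U * (U * diagonal g * star U)
        = U * diagonal (fun i => e i * g i) * star U := by
      intro e g
      calc _ = U * diagonal e * (star U * U) * diagonal g * star U := by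
            simp only [Matrix.mul_assoc]
        _ = _ := by rw [hUU, Matrix.mul_one, Matrix.mul_assoc U, diagonal_mul_diagonal]
    refine ⟨U * diagonal (fun i => (lam i)⁻¹) * star U, ?_, ?_, ?_, ?_⟩
    · simp [Matrix.star_eq_conjTranspose, Matrix.conjTranspose_eq_transpose_of_trivial,
        Matrix.transpose_mul, Matrix.mul_assoc]
    · rw [hNN, key, key]; simp only [mul_comm]
    · rw [hNN, key, key]; simp only [mul_inv_mul_cancel]
    · rw [hNN, key, key]
      congr 3; funext i
      by_cases h : lam i = 0 <;> simp [h]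
  refine ⟨Z * Mᵀ, ?_, ?_, ?_, ?_⟩
  · have h0 : M * (Z * (Mᵀ * M) - 1) = 0 := by
      refine (Matrix.conjTranspose_mul_self_mul_eq_zero M _).mp ?_
      rw [Matrix.conjTranspose_eq_transpose_of_trivial, Matrix.mul_sub, ← Matrix.mul_assoc,
        h1, Matrix.mul_one, sub_self]
    rw [Matrix.mul_sub, Matrix.mul_one, sub_eq_zero] at h0
    simpa only [Matrix.mul_assoc] using h0
  · calc Z * Mᵀ * M * (Z * Mᵀ) = Z * (Mᵀ * M) * Z * Mᵀ := by simp only [Matrix.mul_assoc]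
      _ = Z * Mᵀ := by rw [h2]
  · rw [Matrix.transpose_mul, Matrix.transpose_mul, Matrix.transpose_transpose, hZ,
      Matrix.mul_assoc]
  · rw [Matrix.mul_assoc, Matrix.transpose_mul, hZ, Matrix.transpose_mul,
      Matrix.transpose_transpose, hZN]

/-- The Moore–Penrose inverse `M†` of a real matrix. -/
def pinv {a b : Type*} [Fintype a] [Fintype b] (M : Matrix a b ℝ) : Matrix b a ℝ :=
  (exists_isMoorePenrose M).choose

theorem pinv_spec {a b : Type*} [Fintype a] [Fintype b] (M : Matrix a b ℝ) :
    IsMoorePenrose M (pinv M) :=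
  (exists_isMoorePenrose M).choose_spec

/-- The pseudodeterminant `|M|₊` of a real symmetric matrix: the product of its nonzero
eigenvalues, counted with multiplicity (`1` if there are none). -/
def pdet {a : Type*} [Fintype a] [DecidableEq a] (M : Matrix a a ℝ) : ℝ :=
  (M.charpoly.roots.filter (fun r => r ≠ 0)).prod

/-- A real square matrix is (Schur) stable if all its complex eigenvalues lie inside the
unit circle. -/
def IsStable {a : Type*} [Fintype a] [DecidableEq a] (M : Matrix a a ℝ) : Prop :=
  ∀ z ∈ spectrum ℂ (M.map (fun r : ℝ => (r : ℂ))), ‖z‖ < 1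

/-! ### Models -/

/-- A time-invariant linear stochastic model
`x_{k+1} = A x_k + B u_k + G d_k + w_k`, `y_k = C x_k + D u_k + H d_k + v_k`
with known input `u`, unknown input `d` (of a dimension `p` of its own), process noise
covariance `Q ⪰ 0` and measurement noise covariance `R ≻ 0`. -/
structure Model (n m l : ℕ) where
  p : ℕ
  A : Matrix (Fin n) (Fin n) ℝ
  B : Matrix (Fin n) (Fin m) ℝ
  G : Matrix (Fin n) (Fin p) ℝ
  C : Matrix (Fin l) (Fin n) ℝ
  D : Matrix (Fin l) (Fin m) ℝ
  H : Matrix (Fin l) (Fin p) ℝ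
  Q : Matrix (Fin n) (Fin n) ℝ
  R : Matrix (Fin l) (Fin l) ℝ
  posSemidef_Q : Q.PosSemidef
  posDef_R : R.PosDef

namespace Model

variable {n m l : ℕ} (S : Model n m l)

/-- Strong detectability: whatever the initial state and the unknown input, if the noise-free
output (with zero known input) vanishes identically then the state tends to zero. -/
def StronglyDetectable : Prop :=
  ∀ (x : ℕ → Fin n → ℝ) (d : ℕ → Fin S.p → ℝ),
    (∀ k, x (k + 1) = S.A *ᵥ x k + S.G *ᵥ d k) →
    (∀ k, S.C *ᵥ x k + S.H *ᵥ d k = 0) →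
    Tendsto x atTop (𝓝 0)

/-- Stabilizability through the two exogenous channels of the state equation, the unknown input
and the process noise: some feedback makes `A + G K₁ + Q K₂` stable.  As `Q` and its square root
have the same range, this is stabilizability of the pair `(A, [G  Q^{1/2}])`. -/
def Stabilizable : Prop :=
  ∃ (K₁ : Matrix (Fin S.p) (Fin n) ℝ) (K₂ : Matrix (Fin n) (Fin n) ℝ),
    IsStable (S.A + S.G * K₁ + S.Q * K₂)

/-- A singular value decomposition `H = U₁ Σ V₁ᵀ`, `Σ = diag σ`, of the feedthrough matrix of the
unknown input, with `[U₁ U₂]` and `[V₁ V₂]` orthogonal; `r` is the rank of `H`, `r + s` is the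
dimension of the unknown input, `r + t` that of the output. -/
structure SVD where
  r : ℕ
  s : ℕ
  t : ℕ
  U₁ : Matrix (Fin l) (Fin r) ℝ
  U₂ : Matrix (Fin l) (Fin t) ℝ
  V₁ : Matrix (Fin S.p) (Fin r) ℝ
  V₂ : Matrix (Fin S.p) (Fin s) ℝ
  σ : Fin r → ℝ
  σ_pos : ∀ i, 0 < σ i
  U₁_orth : U₁ᵀ * U₁ = 1
  U₂_orth : U₂ᵀ * U₂ = 1
  U₁₂_orth : U₁ᵀ * U₂ = 0
  U_complete : U₁ * U₁ᵀ + U₂ * U₂ᵀ = 1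
  V₁_orth : V₁ᵀ * V₁ = 1
  V₂_orth : V₂ᵀ * V₂ = 1
  V₁₂_orth : V₁ᵀ * V₂ = 0
  V_complete : V₁ * V₁ᵀ + V₂ * V₂ᵀ = 1
  H_eq : S.H = U₁ * diagonal σ * V₁ᵀ

end Model

/-! ### The optimal input and state filter of a model -/

namespace Model.SVD

variable {n m l : ℕ} {S : Model n m l} (τ : S.SVD)

/-- `z₁ = T₁ y` is the part of the output that sees the unknown input `d₁ = V₁ᵀ d`; its noise is
uncorrelated with that of `z₂`. -/
def T₁ : Matrix (Fin τ.r) (Fin l) ℝ :=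
  τ.U₁ᵀ - τ.U₁ᵀ * S.R * τ.U₂ * (τ.U₂ᵀ * S.R * τ.U₂)⁻¹ * τ.U₂ᵀ

/-- `z₂ = T₂ y` is the part of the output that does not see the unknown input. -/
def T₂ : Matrix (Fin τ.t) (Fin l) ℝ := τ.U₂ᵀ

def C₁ : Matrix (Fin τ.r) (Fin n) ℝ := τ.T₁ * S.C
def C₂ : Matrix (Fin τ.t) (Fin n) ℝ := τ.T₂ * S.C
def D₁ : Matrix (Fin τ.r) (Fin m) ℝ := τ.T₁ * S.D
def D₂ : Matrix (Fin τ.t) (Fin m) ℝ := τ.T₂ * S.D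
def G₁ : Matrix (Fin n) (Fin τ.r) ℝ := S.G * τ.V₁
def G₂ : Matrix (Fin n) (Fin τ.s) ℝ := S.G * τ.V₂
def R₁ : Matrix (Fin τ.r) (Fin τ.r) ℝ := τ.T₁ * S.R * τ.T₁ᵀ
def R₂ : Matrix (Fin τ.t) (Fin τ.t) ℝ := τ.T₂ * S.R * τ.T₂ᵀ
def M₁ : Matrix (Fin τ.r) (Fin τ.r) ℝ := (diagonal τ.σ)⁻¹
def Ahat : Matrix (Fin n) (Fin n) ℝ := S.A - τ.G₁ * τ.M₁ * τ.C₁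
def Qhat : Matrix (Fin n) (Fin n) ℝ := τ.G₁ * τ.M₁ * τ.R₁ * τ.M₁ᵀ * τ.G₁ᵀ + S.Q

/-- State and input estimation are possible without delay: `C₂ G₂` has full column rank. -/
def DelayFree : Prop := (τ.C₂ * τ.G₂).rank = τ.s

/-! One step of the filter from time `k - 1` to time `k`; `P` is the error covariance
`P_{k-1|k-1}` of the previous state estimate. -/

/-- `P̃_k` -/
def Ptilde (P : Matrix (Fin n) (Fin n) ℝ) : Matrix (Fin n) (Fin n) ℝ :=
  τ.Ahat * P * τ.Ahatᵀ + τ.Qhat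

/-- `R̃_{2,k}` -/
def Rtilde (P : Matrix (Fin n) (Fin n) ℝ) : Matrix (Fin τ.t) (Fin τ.t) ℝ :=
  τ.C₂ * τ.Ptilde P * τ.C₂ᵀ + τ.R₂

/-- the gain `M_{2,k}` of the estimator of the unknown input `d₂ = V₂ᵀ d` -/
def M₂ (P : Matrix (Fin n) (Fin n) ℝ) : Matrix (Fin τ.s) (Fin τ.t) ℝ :=
  (τ.G₂ᵀ * τ.C₂ᵀ * (τ.Rtilde P)⁻¹ * τ.C₂ * τ.G₂)⁻¹ * τ.G₂ᵀ * τ.C₂ᵀ * (τ.Rtilde P)⁻¹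

/-- `P^{⋆x}_{k|k}`, the error covariance of `x̂^⋆_{k|k}` -/
def Pstar (P : Matrix (Fin n) (Fin n) ℝ) : Matrix (Fin n) (Fin n) ℝ :=
  τ.G₂ * τ.M₂ P * τ.R₂ * (τ.M₂ P)ᵀ * τ.G₂ᵀ
    + (1 - τ.G₂ * τ.M₂ P * τ.C₂) * τ.Ptilde P * (1 - τ.G₂ * τ.M₂ P * τ.C₂)ᵀ

/-- `R̃^⋆_{2,k}`, the covariance of the residual `ν̄_k` that the model predicts -/
def Rstar (P : Matrix (Fin n) (Fin n) ℝ) : Matrix (Fin τ.t) (Fin τ.t) ℝ :=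
  τ.C₂ * τ.Pstar P * τ.C₂ᵀ + τ.R₂ - τ.C₂ * τ.G₂ * τ.M₂ P * τ.R₂
    - τ.R₂ * (τ.M₂ P)ᵀ * τ.G₂ᵀ * τ.C₂ᵀ

/-- the gain `L̃_k` of the measurement update -/
def Ltilde (P : Matrix (Fin n) (Fin n) ℝ) : Matrix (Fin n) (Fin τ.t) ℝ :=
  (τ.Pstar P * τ.C₂ᵀ - τ.G₂ * τ.M₂ P * τ.R₂) * pinv (τ.Rstar P)

/-- the error covariance `P_{k|k}` of the updated state estimate -/
def covStep (P : Matrix (Fin n) (Fin n) ℝ) : Matrix (Fin n) (Fin n) ℝ :=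
  (1 - τ.Ltilde P * τ.C₂) * τ.G₂ * τ.M₂ P * τ.R₂ * (τ.Ltilde P)ᵀ
    + τ.Ltilde P * τ.R₂ * (τ.M₂ P)ᵀ * τ.G₂ᵀ * (1 - τ.Ltilde P * τ.C₂)ᵀ
    + (1 - τ.Ltilde P * τ.C₂) * τ.Pstar P * (1 - τ.Ltilde P * τ.C₂)ᵀ
    + τ.Ltilde P * τ.R₂ * (τ.Ltilde P)ᵀ

/-- `P_{k|k}`, from the initial covariance `P_{0|0} = P₀` -/
def cov (P₀ : Matrix (Fin n) (Fin n) ℝ) : ℕ → Matrix (Fin n) (Fin n) ℝ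
  | 0 => P₀
  | k + 1 => τ.covStep (cov P₀ k)

/-- `d̂_{1,k}` from `x̂_{k|k}`, `u_k`, `y_k` -/
def dhat₁ (xhat : Fin n → ℝ) (u : Fin m → ℝ) (y : Fin l → ℝ) : Fin τ.r → ℝ :=
  τ.M₁ *ᵥ (τ.T₁ *ᵥ y - τ.C₁ *ᵥ xhat - τ.D₁ *ᵥ u)

/-- time update: `x̂_{k+1|k}` from `x̂_{k|k}`, `u_k`, `y_k` -/
def predict (xhat : Fin n → ℝ) (u : Fin m → ℝ) (y : Fin l → ℝ) : Fin n → ℝ :=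
  S.A *ᵥ xhat + S.B *ᵥ u + τ.G₁ *ᵥ τ.dhat₁ xhat u y

/-- `d̂_{2,k-1}` from `x̂_{k|k-1}`, `u_k`, `y_k` -/
def dhat₂ (P : Matrix (Fin n) (Fin n) ℝ) (xpred : Fin n → ℝ) (u : Fin m → ℝ) (y : Fin l → ℝ) :
    Fin τ.s → ℝ :=
  τ.M₂ P *ᵥ (τ.T₂ *ᵥ y - τ.C₂ *ᵥ xpred - τ.D₂ *ᵥ u)

/-- `x̂^⋆_{k|k}` from `x̂_{k|k-1}`, `u_k`, `y_k` -/
def xstar (P : Matrix (Fin n) (Fin n) ℝ) (xpred : Fin n → ℝ) (u : Fin m → ℝ) (y : Fin l → ℝ) :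
    Fin n → ℝ :=
  xpred + τ.G₂ *ᵥ τ.dhat₂ P xpred u y

/-- the residual `ν̄_k = z_{2,k} - C₂ x̂^⋆_{k|k} - D₂ u_k` from `x̂_{k|k-1}`, `u_k`, `y_k` -/
def residual (P : Matrix (Fin n) (Fin n) ℝ) (xpred : Fin n → ℝ) (u : Fin m → ℝ)
    (y : Fin l → ℝ) : Fin τ.t → ℝ :=
  τ.T₂ *ᵥ y - τ.C₂ *ᵥ τ.xstar P xpred u y - τ.D₂ *ᵥ u

/-- measurement update: `x̂_{k|k}` from `x̂_{k|k-1}`, `u_k`, `y_k` -/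
def correct (P : Matrix (Fin n) (Fin n) ℝ) (xpred : Fin n → ℝ) (u : Fin m → ℝ)
    (y : Fin l → ℝ) : Fin n → ℝ :=
  τ.xstar P xpred u y + τ.Ltilde P *ᵥ τ.residual P xpred u y

/-- `x̂_{k|k}`: the filter of the model with initial estimate `x̂_{0|0} = xhat₀`, run on the input
sequence `u` and the output sequence `y` -/
def est (P₀ : Matrix (Fin n) (Fin n) ℝ) (xhat₀ : Fin n → ℝ) (u : ℕ → Fin m → ℝ)
    (y : ℕ → Fin l → ℝ) : ℕ → Fin n → ℝ
  | 0 => xhat₀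
  | k + 1 => τ.correct (τ.cov P₀ k) (τ.predict (est P₀ xhat₀ u y k) (u k) (y k))
      (u (k + 1)) (y (k + 1))

/-- the predicted state `x̂_{k+1|k}` -/
def pred (P₀ : Matrix (Fin n) (Fin n) ℝ) (xhat₀ : Fin n → ℝ) (u : ℕ → Fin m → ℝ)
    (y : ℕ → Fin l → ℝ) (k : ℕ) : Fin n → ℝ :=
  τ.predict (τ.est P₀ xhat₀ u y k) (u k) (y k)

/-- the residual `ν̄_{k+1}` -/
def nuBar (P₀ : Matrix (Fin n) (Fin n) ℝ) (xhat₀ : Fin n → ℝ) (u : ℕ → Fin m → ℝ)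
    (y : ℕ → Fin l → ℝ) (k : ℕ) : Fin τ.t → ℝ :=
  τ.residual (τ.cov P₀ k) (τ.pred P₀ xhat₀ u y k) (u (k + 1)) (y (k + 1))

/-- the likelihood `f_{k+1}` of the model at time `k + 1`: the (possibly degenerate) centred
Gaussian density with covariance `R̃^⋆_{2,k+1}`, evaluated at the residual `ν̄_{k+1}` -/
def likelihood (P₀ : Matrix (Fin n) (Fin n) ℝ) (xhat₀ : Fin n → ℝ) (u : ℕ → Fin m → ℝ)
    (y : ℕ → Fin l → ℝ) (k : ℕ) : ℝ :=
  Real.exp (-(τ.nuBar P₀ xhat₀ u y k ⬝ᵥ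
      (pinv (τ.Rstar (τ.cov P₀ k)) *ᵥ τ.nuBar P₀ xhat₀ u y k)) / 2)
    / ((2 * Real.pi) ^ (((τ.Rstar (τ.cov P₀ k)).rank : ℝ) / 2)
        * Real.sqrt (pdet (τ.Rstar (τ.cov P₀ k))))

/-! ### The filter of a model on data of another model -/

/-- The steady-state input matrix through which the output enters the prediction `x̂_{k+1|k}`, for
gains `L`, `M`: `Â (L (I - C₂ G₂ M) + G₂ M) T₂ + G₁ M₁ T₁`. -/
def dataGain (L : Matrix (Fin n) (Fin τ.t) ℝ) (M : Matrix (Fin τ.s) (Fin τ.t) ℝ) :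
    Matrix (Fin n) (Fin l) ℝ :=
  τ.Ahat * (L * (1 - τ.C₂ * τ.G₂ * M) + τ.G₂ * M) * τ.T₂ + τ.G₁ * τ.M₁ * τ.T₁

/-- `A^{∗,q}`, for the true model `Strue` and gains `L`, `M` of the filter -/
def jointA (Strue : Model n m l) (L : Matrix (Fin n) (Fin τ.t) ℝ)
    (M : Matrix (Fin τ.s) (Fin τ.t) ℝ) : Matrix (Fin n ⊕ Fin n) (Fin n ⊕ Fin n) ℝ :=
  fromBlocks Strue.A 0 (τ.dataGain L M * Strue.C)
    (τ.Ahat * (1 - L * τ.C₂) * (1 - τ.G₂ * M * τ.C₂))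

/-- `W^{∗,q}` -/
def jointW (L : Matrix (Fin n) (Fin τ.t) ℝ) (M : Matrix (Fin τ.s) (Fin τ.t) ℝ) :
    Matrix (Fin n ⊕ Fin n) (Fin n ⊕ Fin l) ℝ :=
  fromBlocks 1 0 0 (τ.dataGain L M)

/-- `C^{∗,q} = [T₂ C^∗  -C₂]` -/
def jointC (Strue : Model n m l) : Matrix (Fin τ.t) (Fin n ⊕ Fin n) ℝ :=
  fromCols (τ.T₂ * Strue.C) (-τ.C₂)

/-- One step of the Lyapunov recursion
`Ψ ↦ A^{∗,q} Ψ A^{∗,q}ᵀ + W^{∗,q} diag(Q^∗, R^∗) W^{∗,q}ᵀ`. -/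
def lyapunovStep (Strue : Model n m l) (L : Matrix (Fin n) (Fin τ.t) ℝ)
    (M : Matrix (Fin τ.s) (Fin τ.t) ℝ) (Ψ : Matrix (Fin n ⊕ Fin n) (Fin n ⊕ Fin n) ℝ) :
    Matrix (Fin n ⊕ Fin n) (Fin n ⊕ Fin n) ℝ :=
  τ.jointA Strue L M * Ψ * (τ.jointA Strue L M)ᵀ
    + τ.jointW L M * fromBlocks Strue.Q 0 0 Strue.R * (τ.jointW L M)ᵀ

/-- `(I - C₂ G₂ M) (C^{∗,q} Ψ C^{∗,q}ᵀ + T₂ R^∗ T₂ᵀ) (I - C₂ G₂ M)ᵀ` -/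
def mismatchedCov (Strue : Model n m l) (M : Matrix (Fin τ.s) (Fin τ.t) ℝ)
    (Ψ : Matrix (Fin n ⊕ Fin n) (Fin n ⊕ Fin n) ℝ) : Matrix (Fin τ.t) (Fin τ.t) ℝ :=
  (1 - τ.C₂ * τ.G₂ * M)
    * (τ.jointC Strue * Ψ * (τ.jointC Strue)ᵀ + τ.T₂ * Strue.R * τ.T₂ᵀ)
    * (1 - τ.C₂ * τ.G₂ * M)ᵀ

end Model.SVD

/-! ### Probability -/

variable {Ω : Type*} [MeasurableSpace Ω]

/-- The matrix `𝔼[X Yᵀ]` of second moments. -/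
def secondMoment {a b : Type*} (μ : Measure Ω) (X : Ω → a → ℝ) (Y : Ω → b → ℝ) :
    Matrix a b ℝ :=
  Matrix.of fun i j => ∫ ω, X ω i * Y ω j ∂μ

/-- The initial state is Gaussian, the process and measurement noises are zero-mean Gaussian with
covariances `Q` and `R`, and `x₀, w₀, v₀, w₁, v₁, …` are mutually independent. -/
structure IsGaussianNoise {n m l : ℕ} (μ : Measure Ω) (S : Model n m l) (x₀ : Ω → Fin n → ℝ)
    (w : ℕ → Ω → Fin n → ℝ) (v : ℕ → Ω → Fin l → ℝ) : Prop where
  gaussian_x₀ : HasGaussianLaw x₀ μ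
  gaussian_w : ∀ k, HasGaussianLaw (w k) μ
  gaussian_v : ∀ k, HasGaussianLaw (v k) μ
  mean_w : ∀ k i, ∫ ω, w k ω i ∂μ = 0
  mean_v : ∀ k i, ∫ ω, v k ω i ∂μ = 0
  cov_w : ∀ k, secondMoment μ (w k) (w k) = S.Q
  cov_v : ∀ k, secondMoment μ (v k) (v k) = S.R
  indep_time : iIndepFun (fun k ω => (w k ω, v k ω)) μ
  indep_w_v : ∀ k, IndepFun (w k) (v k) μ
  indep_x₀ : IndepFun x₀ (fun ω k => (w k ω, v k ω)) μ

/-- `x` and `y` are the state and the output of the model with the given inputs and noises. -/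
def IsTrajectory {n m l : ℕ} (S : Model n m l) (u : ℕ → Ω → Fin m → ℝ) (d : ℕ → Ω → Fin S.p → ℝ)
    (w : ℕ → Ω → Fin n → ℝ) (v : ℕ → Ω → Fin l → ℝ) (x : ℕ → Ω → Fin n → ℝ)
    (y : ℕ → Ω → Fin l → ℝ) : Prop :=
  (∀ k ω, x (k + 1) ω = S.A *ᵥ x k ω + S.B *ᵥ u k ω + S.G *ᵥ d k ω + w k ω) ∧
  (∀ k ω, y k ω = S.C *ᵥ x k ω + S.D *ᵥ u k ω + S.H *ᵥ d k ω + v k ω)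

/-- The random likelihood `f_{k+1}`. -/
def lik {n m l : ℕ} {S : Model n m l} (τ : S.SVD) (P₀ : Matrix (Fin n) (Fin n) ℝ)
    (xhat₀ : Fin n → ℝ) (u : ℕ → Ω → Fin m → ℝ) (y : ℕ → Ω → Fin l → ℝ) (k : ℕ) (ω : Ω) : ℝ :=
  τ.likelihood P₀ xhat₀ (fun j => u j ω) (fun j => y j ω) k

/-- The random residual `ν̄_{k+1}`. -/
def res {n m l : ℕ} {S : Model n m l} (τ : S.SVD) (P₀ : Matrix (Fin n) (Fin n) ℝ)
    (xhat₀ : Fin n → ℝ) (u : ℕ → Ω → Fin m → ℝ) (y : ℕ → Ω → Fin l → ℝ) (k : ℕ) (ω : Ω) :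
    Fin τ.t → ℝ :=
  τ.nuBar P₀ xhat₀ (fun j => u j ω) (fun j => y j ω) k

/-- The pair `(x_{k+1}, x̂_{k+1|k})` of the true state and its prediction. -/
def joint {n m l : ℕ} {S : Model n m l} (τ : S.SVD) (P₀ : Matrix (Fin n) (Fin n) ℝ)
    (xhat₀ : Fin n → ℝ) (u : ℕ → Ω → Fin m → ℝ) (x : ℕ → Ω → Fin n → ℝ) (y : ℕ → Ω → Fin l → ℝ)
    (k : ℕ) (ω : Ω) : Fin n ⊕ Fin n → ℝ :=
  Sum.elim (x (k + 1) ω) (τ.pred P₀ xhat₀ (fun j => u j ω) (fun j => y j ω) k)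

/-- Ergodicity of the log-likelihood ratios `ln (f^j_k / f^i_k)`, `k ≥ 1`, of two models, where
`fstar` is the likelihood of the true model (`f k` stands for time `k + 1`): the expectations under
the true law exist and converge, and almost surely
`(1/K) ∑_{k ≤ K} ln (f^j_k / f^i_k)` tends to the stationary value
`𝔼[ln (f^j / f^i)] = D(f^∗ ‖ f^i) - D(f^∗ ‖ f^j)`, where `D(f^∗ ‖ f^q)` is the limit of
`𝔼[ln (f^∗_k / f^q_k)]`. -/
def LogRatioErgodic (μ : Measure Ω) (fstar fj fi : ℕ → Ω → ℝ) : Prop :=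
  (∀ k, Integrable (fun ω => Real.log (fstar k ω / fi k ω)) μ) ∧
  (∀ k, Integrable (fun ω => Real.log (fstar k ω / fj k ω)) μ) ∧
  (∀ k, Integrable (fun ω => Real.log (fj k ω / fi k ω)) μ) ∧
  ∃ Di Dj : ℝ,
    Tendsto (fun k => ∫ ω, Real.log (fstar k ω / fi k ω) ∂μ) atTop (𝓝 Di) ∧
    Tendsto (fun k => ∫ ω, Real.log (fstar k ω / fj k ω) ∂μ) atTop (𝓝 Dj) ∧
    Tendsto (fun k => ∫ ω, Real.log (fj k ω / fi k ω) ∂μ) atTop (𝓝 (Di - Dj)) ∧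
    ∀ᵐ ω ∂μ, Tendsto
      (fun K : ℕ => (∑ k ∈ Finset.range K, Real.log (fj k ω / fi k ω)) / (K : ℝ))
      atTop (𝓝 (Di - Dj))

end MultiModel

end

/-!
The proof treats the true model and the mismatched models alike, by a linear system with convergent
matrices that is driven by white noise.

*Gains.* With the total gain `K = G₂ M₂ + L̃ (I - C₂ G₂ M₂)`, the covariance recursion is
`P ↦ F P Fᵀ + N` with `F = (I - K C₂) Â`, and `K` minimizes every quadratic form of the right-hand side
among the gains that are unbiased with respect to the unknown input (`quad_covStep_le`). Hence the
recursion is monotone. Started from `0` it increases; the directions in which it stays bounded form a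
subspace, and strong detectability makes that subspace everything (`boundedDirections_eq_top`).
Stabilizability makes `F` stable at the limit (`isStable_errorMap`), and the recursion from any `P₀` is
squeezed between the one from `0` and the affine one with the limiting gain (`exists_tendsto_cov`).
`R̃⋆₂` is singular but has constant rank, and its kernel is known explicitly, so that its pseudoinverse,
its rank and its pseudodeterminant converge too (`tendsto_pinv_Rstar`, `tendsto_rank_Rstar`,
`tendsto_pdet_Rstar`).

*Joint process.* The pair `(x_{k+1}, x̂_{k+1|k})` obeys a linear recursion whose matrices converge to the
stable matrix `A^{∗,q}` (`joint_succ`). Two notions describe its asymptotics: a process has a limit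
covariance if second moments converge in mean and, almost surely, in time average (`HasLimitCov`), and
it is negligible if that limit is `0` (`Negligible`). The response of a fixed stable system to Gaussian
white noise has a limit covariance (`IsWhiteNoise.hasLimitCov_response`). For the time averages, the
products of the noise with the earlier response are orthogonal and obey a strong law
(`ae_tendsto_avg_of_orthogonal`), the averaged squares of the noise converge by the strong law of large
numbers, and the averaged squares of the response then solve the Lyapunov equation asymptotically, which
has a unique solution. The initial state, the inputs and the deviation of the gains from their limits
contribute a negligible process (`negligible_of_recursion`). Neither ergodic theory nor stationarity is
needed.

*Likelihoods.* The log-likelihood is a quadratic form of the residual with a convergent weight plus a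
convergent sequence, so its expectations and time averages have a common limit
(`meanErgodic_log_lik`), and log-likelihood ratios are differences.

*The true model.* It is not assumed stabilizable. But as soon as there is a mismatched model `q`, the
stability of the block triangular matrix `A^{∗,q}` includes that of `A^∗`, so the true model is
stabilizable, and its own joint matrix is stable (`isStable_jointA_self`). If there is no mismatched
model, all the log-likelihood ratios in question are `0`.
-/

namespace MultiModel

/-! ### Scalar recursions -/

theorem tendsto_zero_of_contraction {a g : ℕ → ℝ} {ρ : ℝ} (hρ0 : 0 ≤ ρ) (hρ : ρ < 1)
    (ha : ∀ k, 0 ≤ a k) (hg : Tendsto g atTop (𝓝 0))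
    (h : ∀ᶠ k in atTop, a (k + 1) ≤ ρ * a k + g k) : Tendsto a atTop (𝓝 0) := by
  rw [Metric.tendsto_atTop]
  intro ε hε
  have hδ : 0 < (1 - ρ) * (ε / 2) := by have := sub_pos.2 hρ; positivity
  obtain ⟨k₀, hk₀⟩ := eventually_atTop.1 (h.and (hg.eventually (gt_mem_nhds hδ)))
  have key : ∀ j, a (k₀ + j) - ε / 2 ≤ ρ ^ j * a k₀ := by
    intro j
    induction j with
    | zero => simp; positivity
    | succ j ih =>
      obtain ⟨h1, h2⟩ := hk₀ (k₀ + j) (by omega)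
      have := mul_le_mul_of_nonneg_left ih hρ0
      rw [← add_assoc, pow_succ]
      nlinarith
  have hlim : Tendsto (fun j => ρ ^ j * a k₀) atTop (𝓝 0) := by
    simpa using (tendsto_pow_atTop_nhds_zero_of_lt_one hρ0 hρ).mul_const (a k₀)
  obtain ⟨j₀, hj₀⟩ := eventually_atTop.1 (hlim.eventually (gt_mem_nhds (half_pos hε)))
  refine ⟨k₀ + j₀, fun k hk => ?_⟩
  have h1 := key (k - k₀)
  have h2 := hj₀ (k - k₀) (by omega)
  rw [Nat.add_sub_cancel' (by omega)] at h1
  rw [Real.dist_eq, sub_zero, abs_of_nonneg (ha k)]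
  linarith

/-- The Cesàro mean `(1 / K) ∑_{k < K} g k` (which is `0` for `K = 0`). -/
noncomputable def avg (g : ℕ → ℝ) (K : ℕ) : ℝ := (K : ℝ)⁻¹ * ∑ k ∈ Finset.range K, g k

theorem avg_add (f g : ℕ → ℝ) (K : ℕ) : avg (fun k => f k + g k) K = avg f K + avg g K := by
  simp [avg, Finset.sum_add_distrib, mul_add]

theorem avg_const_mul (c : ℝ) (f : ℕ → ℝ) (K : ℕ) : avg (fun k => c * f k) K = c * avg f K := by
  simp only [avg, ← Finset.mul_sum]; ring

theorem avg_mono {f g : ℕ → ℝ} (h : ∀ k, f k ≤ g k) (K : ℕ) : avg f K ≤ avg g K :=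
  mul_le_mul_of_nonneg_left (Finset.sum_le_sum fun k _ => h k) (by positivity)

theorem avg_nonneg {f : ℕ → ℝ} (h : ∀ k, 0 ≤ f k) (K : ℕ) : 0 ≤ avg f K :=
  mul_nonneg (by positivity) (Finset.sum_nonneg fun k _ => h k)

theorem tendsto_avg_zero_of_le {f g : ℕ → ℝ} (hf : ∀ k, 0 ≤ f k) (h : ∀ k, f k ≤ g k)
    (hg : Tendsto (avg g) atTop (𝓝 0)) : Tendsto (avg f) atTop (𝓝 0) :=
  squeeze_zero (avg_nonneg hf) (avg_mono h) hg

theorem avg_succ_sub (f : ℕ → ℝ) (K : ℕ) :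
    avg (fun k => f (k + 1)) K = avg f K + (K : ℝ)⁻¹ * (f K - f 0) := by
  simp only [avg]
  have := Finset.sum_range_succ f K
  rw [Finset.sum_range_succ'] at this
  have h2 : ∑ k ∈ Finset.range K, f (k + 1) = ∑ k ∈ Finset.range K, f k + (f K - f 0) := by
    linarith
  rw [h2]; ring

theorem tendsto_avg_of_tendsto {f : ℕ → ℝ} {c : ℝ} (h : Tendsto f atTop (𝓝 c)) :
    Tendsto (avg f) atTop (𝓝 c) := h.cesaro

/-- Convergent time averages force single terms to be `o(k)`, since `f k` is the difference of two
consecutive partial sums. -/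
theorem tendsto_div_of_tendsto_avg {f : ℕ → ℝ} {c : ℝ} (h : Tendsto (avg f) atTop (𝓝 c)) :
    Tendsto (fun k : ℕ => f k / ((k : ℝ) + 1)) atTop (𝓝 0) := by
  have h1 : Tendsto (fun k => avg f (k + 1)) atTop (𝓝 c) := h.comp (tendsto_add_atTop_nat 1)
  have h2 : Tendsto (fun k : ℕ => (k : ℝ) / ((k : ℝ) + 1)) atTop (𝓝 1) :=
    tendsto_natCast_div_add_atTop 1
  have h3 := h1.sub (h2.mul h)
  simp only [one_mul, sub_self] at h3
  refine h3.congr fun k => ?_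
  simp only [avg, Finset.sum_range_succ]
  rcases Nat.eq_zero_or_pos k with rfl | hk
  · simp
  · have : (k : ℝ) ≠ 0 := by positivity
    push_cast
    field_simp
    ring

/-- The analogue of `tendsto_zero_of_contraction` for time averages: a contraction whose forcing term
vanishes on average vanishes on average. -/
theorem tendsto_avg_zero_of_contraction {a g : ℕ → ℝ} {ρ : ℝ} (hρ : ρ < 1) (ha : ∀ k, 0 ≤ a k)
    (hg0 : ∀ k, 0 ≤ g k) (hg : Tendsto (avg g) atTop (𝓝 0))
    (h : ∀ᶠ k in atTop, a (k + 1) ≤ ρ * a k + g k) : Tendsto (avg a) atTop (𝓝 0) := by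
  obtain ⟨k₀, hk₀⟩ := eventually_atTop.1 h
  -- the finitely many exceptions are absorbed in the forcing term
  set e : ℕ → ℝ := fun k => if k < k₀ then a (k + 1) + |ρ * a k| else 0 with he
  have he0 : Tendsto (avg e) atTop (𝓝 0) := by
    refine tendsto_avg_of_tendsto (tendsto_const_nhds.congr' ?_)
    filter_upwards [eventually_ge_atTop k₀] with k hk
    simp [he, not_lt.2 hk]
  have hall : ∀ k, a (k + 1) ≤ ρ * a k + (g k + e k) := by
    intro k
    by_cases hk : k < k₀
    · have := neg_abs_le (ρ * a k)
      have := hg0 k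
      simp only [he, hk, if_true]; linarith
    · have := hk₀ k (not_lt.1 hk)
      simp only [he, hk, if_false]; linarith
  have hinv : Tendsto (fun K : ℕ => (K : ℝ)⁻¹ * a 0) atTop (𝓝 0) := by
    simpa using tendsto_inv_atTop_nhds_zero_nat.mul_const (a 0)
  have hbound : ∀ K, avg a K ≤ (1 - ρ)⁻¹ * (avg g K + avg e K + (K : ℝ)⁻¹ * a 0) := by
    intro K
    have h1 := avg_mono hall K
    rw [avg_add, avg_const_mul, avg_add, avg_succ_sub] at h1
    have h2 : 0 ≤ (K : ℝ)⁻¹ * a K := mul_nonneg (by positivity) (ha K)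
    rw [inv_mul_eq_div, le_div_iff₀ (by linarith)]
    linarith
  refine squeeze_zero (avg_nonneg ha) hbound ?_
  simpa using ((hg.add he0).add hinv).const_mul (1 - ρ)⁻¹

/-! ### Stable matrices -/

theorem tendsto_matrix_iff {α a b : Type*} {l : Filter α} {f : α → Matrix a b ℝ}
    {L : Matrix a b ℝ} :
    Tendsto f l (𝓝 L) ↔ ∀ i j, Tendsto (fun k => f k i j) l (𝓝 (L i j)) :=
  tendsto_pi_nhds.trans (forall_congr' fun _ => tendsto_pi_nhds)

theorem norm_mulVec_le {a b : Type*} [Fintype a] [Fintype b] (M : Matrix b a ℝ) (x : a → ℝ) :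
    ‖M *ᵥ x‖ ≤ (∑ i, ∑ j, |M i j|) * ‖x‖ := by
  refine (pi_norm_le_iff_of_nonneg (by positivity)).2 fun i => ?_
  calc ‖(M *ᵥ x) i‖ ≤ ∑ j, ‖M i j * x j‖ := norm_sum_le _ _
    _ ≤ ∑ j, |M i j| * ‖x‖ := by
        refine Finset.sum_le_sum fun j _ => ?_
        rw [norm_mul, Real.norm_eq_abs]
        exact mul_le_mul_of_nonneg_left (norm_le_pi_norm x j) (abs_nonneg _)
    _ = (∑ j, |M i j|) * ‖x‖ := (Finset.sum_mul ..).symm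
    _ ≤ _ := by
        refine mul_le_mul_of_nonneg_right ?_ (norm_nonneg _)
        exact Finset.single_le_sum (f := fun i => ∑ j, |M i j|)
          (fun i _ => Finset.sum_nonneg fun j _ => abs_nonneg _) (Finset.mem_univ i)

theorem tendsto_sum_abs {a b : Type*} [Fintype a] [Fintype b] {M : ℕ → Matrix b a ℝ}
    (h : Tendsto M atTop (𝓝 0)) :
    Tendsto (fun k => ∑ i, ∑ j, |M k i j|) atTop (𝓝 0) := by
  have : Continuous fun N : Matrix b a ℝ => ∑ i, ∑ j, |N i j| := by fun_prop
  simpa [Function.comp_def] using (this.tendsto 0).comp h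

theorem map_ofReal_mul {a b c : Type*} [Fintype a] (M : Matrix b a ℝ) (N : Matrix a c ℝ) :
    (M * N).map (fun r : ℝ => (r : ℂ))
      = M.map (fun r : ℝ => (r : ℂ)) * N.map (fun r : ℝ => (r : ℂ)) :=
  Matrix.map_mul (f := Complex.ofRealHom)

section Stable

variable {a b : Type*} [Fintype a] [Fintype b] [DecidableEq a] [DecidableEq b]

/-- A real square matrix is power stable if its powers tend to zero. -/
def PowerStable (M : Matrix a a ℝ) : Prop := Tendsto (fun k => M ^ k) atTop (𝓝 0)

theorem IsStable.iff_charpoly {M : Matrix a a ℝ} :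
    IsStable M ↔ ∀ z : ℂ, (M.map (fun r : ℝ => (r : ℂ))).charpoly.IsRoot z → ‖z‖ < 1 := by
  simp only [IsStable, Matrix.mem_spectrum_iff_isRoot_charpoly]

/-- `M N` and `N M` have the same characteristic polynomial. -/
theorem IsStable.mul_comm {M N : Matrix a a ℝ} (h : IsStable (M * N)) : IsStable (N * M) := by
  rw [IsStable.iff_charpoly, map_ofReal_mul] at h ⊢
  rwa [Matrix.charpoly_mul_comm]

theorem isStable_fromBlocks_iff {M : Matrix a a ℝ} {B : Matrix b a ℝ} {N : Matrix b b ℝ} :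
    IsStable (fromBlocks M 0 B N) ↔ IsStable M ∧ IsStable N := by
  have h0 : (0 : Matrix a b ℝ).map (fun r : ℝ => (r : ℂ)) = 0 := by ext; simp
  simp only [IsStable.iff_charpoly, fromBlocks_map, h0, charpoly_fromBlocks_zero₁₂,
    Polynomial.root_mul, or_imp, forall_and]

/-- Gelfand's formula: a spectral radius below one makes the powers tend to zero. -/
theorem IsStable.powerStable {M : Matrix a a ℝ} (h : IsStable M) : PowerStable M := by
  let _ : NormedRing (Matrix a a ℂ) := Matrix.linftyOpNormedRing
  let _ : NormedAlgebra ℂ (Matrix a a ℂ) := Matrix.linftyOpNormedAlgebra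
  rcases isEmpty_or_nonempty a with he | he
  · have : (fun k => M ^ k) = fun _ => (0 : Matrix a a ℝ) := by
      funext k; exact Subsingleton.elim _ _
    rw [PowerStable, this]; exact tendsto_const_nhds
  set Mc : Matrix a a ℂ := M.map (fun r : ℝ => (r : ℂ)) with hMc
  have hpow : ∀ k, Mc ^ k = (M ^ k).map (fun r : ℝ => (r : ℂ)) := by
    intro k
    induction k with
    | zero => simp [Matrix.map_one]
    | succ k ih => rw [pow_succ, pow_succ, ih, map_ofReal_mul]
  have hr : spectralRadius ℂ Mc < ((1 : NNReal) : ENNReal) := by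
    refine spectrum.spectralRadius_lt_of_forall_lt Mc fun z hz => ?_
    have := h z hz
    exact_mod_cast this
  obtain ⟨r, hr1, hr2⟩ := ENNReal.lt_iff_exists_nnreal_btwn.1 hr
  have hlim := spectrum.pow_nnnorm_pow_one_div_tendsto_nhds_spectralRadius Mc
  have hr2' : r < 1 := by exact_mod_cast hr2
  have hev : ∀ᶠ k : ℕ in atTop, ‖Mc ^ k‖ ≤ (r : ℝ) ^ k := by
    filter_upwards [hlim.eventually (gt_mem_nhds hr1), eventually_gt_atTop 0] with k hk hk0
    have h1 : (‖Mc ^ k‖₊ : ENNReal) ≤ (r : ENNReal) ^ (k : ℝ) := by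
      have := ENNReal.rpow_le_rpow hk.le (Nat.cast_nonneg (α := ℝ) k)
      rwa [← ENNReal.rpow_mul, one_div, inv_mul_cancel₀ (by positivity), ENNReal.rpow_one] at this
    rw [ENNReal.rpow_natCast, ← ENNReal.coe_pow, ENNReal.coe_le_coe] at h1
    exact_mod_cast h1
  have hz : Tendsto (fun k => Mc ^ k) atTop (𝓝 0) :=
    squeeze_zero_norm' hev (tendsto_pow_atTop_nhds_zero_of_lt_one r.coe_nonneg
      (by exact_mod_cast hr2'))
  refine tendsto_matrix_iff.2 fun i j => ?_
  have h3 := (Complex.continuous_re.tendsto _).comp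
    ((continuous_apply_apply i j).tendsto (0 : Matrix a a ℂ) |>.comp hz)
  refine h3.congr fun k => ?_
  change ((Mc ^ k) i j).re = (M ^ k) i j
  rw [hpow, map_apply, Complex.ofReal_re]

theorem PowerStable.transpose {M : Matrix a a ℝ} (h : PowerStable M) : PowerStable Mᵀ := by
  have : Tendsto (fun k => (M ^ k)ᵀ) atTop (𝓝 (0 : Matrix a a ℝ)ᵀ) :=
    (continuous_id.matrix_transpose.tendsto _).comp h
  simpa only [PowerStable, transpose_pow, transpose_zero] using this

theorem PowerStable.tendsto_conj {M : Matrix a a ℝ} (h : PowerStable M) (X : Matrix a a ℝ) :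
    Tendsto (fun k => M ^ k * X * (M ^ k)ᵀ) atTop (𝓝 0) := by
  have h1 : Tendsto (fun k => (M ^ k)ᵀ) atTop (𝓝 (0 : Matrix a a ℝ)ᵀ) :=
    (continuous_id.matrix_transpose.tendsto _).comp h
  have h2 := (h.mul (tendsto_const_nhds (x := X))).mul h1
  simpa using h2

/-- `Ψ ↦ Ψ - M Ψ Mᵀ`. -/
def steinMap (M : Matrix a a ℝ) : Matrix a a ℝ →ₗ[ℝ] Matrix a a ℝ where
  toFun Ψ := Ψ - M * Ψ * Mᵀ
  map_add' X Y := by simp only [Matrix.mul_add, Matrix.add_mul]; abel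
  map_smul' c X := by simp [smul_sub]

/-- The Lyapunov iteration, as an affine map centred at its fixed point `Ψ`. -/
theorem iterate_lyapunov_sub {M W Ψ : Matrix a a ℝ} (hΨ : M * Ψ * Mᵀ + W = Ψ)
    (X : Matrix a a ℝ) (k : ℕ) :
    (fun Y => M * Y * Mᵀ + W)^[k] X = Ψ + M ^ k * (X - Ψ) * (M ^ k)ᵀ := by
  induction k with
  | zero => simp
  | succ k ih =>
    rw [Function.iterate_succ_apply', ih]
    simp only [Matrix.mul_add, Matrix.add_mul, pow_succ', transpose_mul, Matrix.mul_assoc]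
    nth_rewrite 3 [← hΨ]
    simp only [Matrix.mul_assoc]
    abel

theorem PowerStable.steinMap_injective {M : Matrix a a ℝ} (h : PowerStable M) :
    Function.Injective (steinMap M) := by
  rw [← LinearMap.ker_eq_bot, LinearMap.ker_eq_bot']
  intro X hX
  have hX' : M * X * Mᵀ + 0 = X := by
    have : X - M * X * Mᵀ = 0 := hX
    rw [add_zero]; exact (sub_eq_zero.1 this).symm
  have hk : ∀ k, M ^ k * X * (M ^ k)ᵀ = X := by
    intro k
    induction k with
    | zero => simp
    | succ k ih =>
      nth_rewrite 2 [← ih]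
      nth_rewrite 2 [← hX']
      simp only [pow_succ, transpose_mul, Matrix.mul_assoc, add_zero]
  have := h.tendsto_conj X
  simp only [hk] at this
  exact tendsto_nhds_unique tendsto_const_nhds this

theorem PowerStable.exists_lyapunov {M : Matrix a a ℝ} (h : PowerStable M) (W : Matrix a a ℝ) :
    ∃ Ψ, M * Ψ * Mᵀ + W = Ψ := by
  obtain ⟨Ψ, hΨ⟩ := (LinearMap.injective_iff_surjective.1 h.steinMap_injective) W
  refine ⟨Ψ, ?_⟩
  rw [← hΨ]; change M * Ψ * Mᵀ + (Ψ - M * Ψ * Mᵀ) = Ψ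
  abel

theorem PowerStable.tendsto_lyapunov {M W Ψ : Matrix a a ℝ} (h : PowerStable M)
    (hΨ : M * Ψ * Mᵀ + W = Ψ) (X : Matrix a a ℝ) :
    Tendsto (fun k => (fun Y => M * Y * Mᵀ + W)^[k] X) atTop (𝓝 Ψ) := by
  simp only [iterate_lyapunov_sub hΨ]
  simpa using (h.tendsto_conj (X - Ψ)).const_add Ψ

/-- A sequence that solves the Lyapunov equation asymptotically converges to its solution: the
map `Ψ ↦ Ψ - M Ψ Mᵀ` has a continuous inverse. -/
theorem PowerStable.tendsto_of_asymptotic_lyapunov {M W Ψ : Matrix a a ℝ} (h : PowerStable M)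
    (hΨ : M * Ψ * Mᵀ + W = Ψ) {X : ℕ → Matrix a a ℝ}
    (hX : Tendsto (fun k => X k - M * X k * Mᵀ) atTop (𝓝 W)) : Tendsto X atTop (𝓝 Ψ) := by
  let e := LinearEquiv.ofInjectiveEndo (steinMap M) h.steinMap_injective
  have hc : Continuous e.symm := LinearMap.continuous_of_finiteDimensional e.symm.toLinearMap
  have h1 := (hc.tendsto W).comp hX
  have h2 : e.symm W = Ψ := by
    rw [LinearEquiv.symm_apply_eq]
    change W = Ψ - M * Ψ * Mᵀ
    nth_rewrite 1 [← hΨ]; abel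
  rw [h2] at h1
  refine h1.congr fun k => ?_
  rw [Function.comp_apply, LinearEquiv.symm_apply_eq]
  rfl

/-- A power stable matrix is a strict contraction for some norm `N`, equivalent to the given one:
the sum of `‖M ^ j x‖` over `j < n`, where `n` is so large that `M ^ n` halves every norm. -/
theorem PowerStable.exists_norm {M : Matrix a a ℝ} (h : PowerStable M) :
    ∃ (N : (a → ℝ) → ℝ) (c ρ : ℝ), 0 < c ∧ 0 ≤ ρ ∧ ρ < 1 ∧ Continuous N ∧
      (∀ x, ‖x‖ ≤ N x) ∧ (∀ x, N x ≤ c * ‖x‖) ∧ (∀ x y, N (x + y) ≤ N x + N y) ∧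
      (∀ x, N (M *ᵥ x) ≤ ρ * N x) := by
  obtain ⟨n, hn⟩ := eventually_atTop.1
    ((tendsto_sum_abs h).eventually (gt_mem_nhds (show (0 : ℝ) < 1 / 2 by norm_num)))
  have hn' : ∀ x, ‖(M ^ (n + 1)) *ᵥ x‖ ≤ 1 / 2 * ‖x‖ := fun x =>
    (norm_mulVec_le _ x).trans (mul_le_mul_of_nonneg_right (hn (n + 1) (by omega)).le
      (norm_nonneg _))
  set c : ℝ := 1 + ∑ k ∈ Finset.range (n + 1), ∑ i, ∑ j, |(M ^ k) i j| with hc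
  have hc1 : 1 ≤ c := by
    have : 0 ≤ ∑ k ∈ Finset.range (n + 1), ∑ i, ∑ j, |(M ^ k) i j| :=
      Finset.sum_nonneg fun k _ => Finset.sum_nonneg fun i _ => Finset.sum_nonneg fun j _ =>
        abs_nonneg _
    linarith
  let N : (a → ℝ) → ℝ := fun x => ∑ k ∈ Finset.range (n + 1), ‖(M ^ k) *ᵥ x‖
  have hNle : ∀ x, N x ≤ c * ‖x‖ := by
    intro x
    calc N x ≤ ∑ k ∈ Finset.range (n + 1), (∑ i, ∑ j, |(M ^ k) i j|) * ‖x‖ :=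
          Finset.sum_le_sum fun k _ => norm_mulVec_le _ x
      _ = (∑ k ∈ Finset.range (n + 1), ∑ i, ∑ j, |(M ^ k) i j|) * ‖x‖ := (Finset.sum_mul ..).symm
      _ ≤ c * ‖x‖ := mul_le_mul_of_nonneg_right (by linarith) (norm_nonneg _)
  refine ⟨N, c, 1 - (2 * c)⁻¹, by linarith, ?_, ?_, ?_, ?_, hNle, ?_, ?_⟩
  · have : (2 * c)⁻¹ ≤ 1 := inv_le_one_of_one_le₀ (by linarith)
    linarith
  · have : 0 < (2 * c)⁻¹ := by positivity
    linarith
  · exact continuous_finsetSum _ fun k _ =>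
      (Continuous.matrix_mulVec continuous_const continuous_id).norm
  · intro x
    have h0 := Finset.single_le_sum (f := fun k => ‖(M ^ k) *ᵥ x‖) (fun k _ => norm_nonneg _)
      (Finset.mem_range.2 (Nat.succ_pos n))
    simpa using h0
  · intro x y
    rw [← Finset.sum_add_distrib]
    refine Finset.sum_le_sum fun k _ => ?_
    rw [mulVec_add]; exact norm_add_le _ _
  · intro x
    have h1 : N (M *ᵥ x) = ∑ k ∈ Finset.range (n + 1), ‖(M ^ (k + 1)) *ᵥ x‖ := by
      refine Finset.sum_congr rfl fun k _ => ?_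
      rw [mulVec_mulVec, pow_succ]
    have h2 : N (M *ᵥ x) + ‖x‖ = N x + ‖(M ^ (n + 1)) *ᵥ x‖ := by
      rw [h1]
      have e1 := Finset.sum_range_succ (fun k => ‖(M ^ k) *ᵥ x‖) (n + 1)
      rw [Finset.sum_range_succ'] at e1
      simpa using e1
    have h3 := hn' x
    have h4 : (2 * c)⁻¹ * N x ≤ 1 / 2 * ‖x‖ := by
      calc (2 * c)⁻¹ * N x ≤ (2 * c)⁻¹ * (c * ‖x‖) :=
            mul_le_mul_of_nonneg_left (hNle x) (by positivity)
        _ = 1 / 2 * ‖x‖ := by field_simp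
    linarith

end Stable

/-! ### Quadratic forms -/

section Quad

variable {a : Type*} [Fintype a]

theorem quad_add (P : Matrix a a ℝ) (hP : Pᵀ = P) (x y : a → ℝ) :
    (x + y) ⬝ᵥ P *ᵥ (x + y) = x ⬝ᵥ P *ᵥ x + 2 * (x ⬝ᵥ P *ᵥ y) + y ⬝ᵥ P *ᵥ y := by
  have : y ⬝ᵥ P *ᵥ x = x ⬝ᵥ P *ᵥ y := by
    rw [dotProduct_mulVec, ← mulVec_transpose, hP, dotProduct_comm]
  rw [mulVec_add, add_dotProduct, dotProduct_add, dotProduct_add, this]; ring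

theorem quad_conj {b : Type*} [Fintype b] (F : Matrix b a ℝ) (P : Matrix a a ℝ) (x : b → ℝ) :
    x ⬝ᵥ (F * P * Fᵀ) *ᵥ x = (Fᵀ *ᵥ x) ⬝ᵥ P *ᵥ (Fᵀ *ᵥ x) := by
  rw [← mulVec_mulVec, ← mulVec_mulVec, dotProduct_mulVec x F, ← mulVec_transpose]

theorem _root_.Matrix.PosSemidef.transpose_eq {a : Type*} {P : Matrix a a ℝ} (h : P.PosSemidef) :
    Pᵀ = P := by
  simpa [IsHermitian, conjTranspose_eq_transpose_of_trivial] using h.1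

theorem _root_.Matrix.PosSemidef.quad_nonneg {P : Matrix a a ℝ} (h : P.PosSemidef) (x : a → ℝ) :
    0 ≤ x ⬝ᵥ P *ᵥ x := by
  simpa using h.dotProduct_mulVec_nonneg x

theorem posSemidef_of_quad {P : Matrix a a ℝ} (h : Pᵀ = P) (h' : ∀ x : a → ℝ, 0 ≤ x ⬝ᵥ P *ᵥ x) :
    P.PosSemidef :=
  PosSemidef.of_dotProduct_mulVec_nonneg
    (by rwa [IsHermitian, conjTranspose_eq_transpose_of_trivial]) (by simpa using h')

theorem quad_single [DecidableEq a] (P : Matrix a a ℝ) (i j : a) :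
    (Pi.single i (1 : ℝ)) ⬝ᵥ P *ᵥ (Pi.single j 1) = P i j := by
  simp

/-- Polarization: symmetric matrices converge as soon as their quadratic forms do. -/
theorem exists_tendsto_of_quad {P : ℕ → Matrix a a ℝ} (hP : ∀ k, (P k)ᵀ = P k)
    (h : ∀ x : a → ℝ, ∃ q, Tendsto (fun k => x ⬝ᵥ P k *ᵥ x) atTop (𝓝 q)) :
    ∃ L, Tendsto P atTop (𝓝 L) := by
  classical
  choose q hq using h
  refine ⟨of fun i j => (q (Pi.single i 1 + Pi.single j 1) - q (Pi.single i 1)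
    - q (Pi.single j 1)) / 2, ?_⟩
  refine tendsto_matrix_iff.2 fun i j => ?_
  refine ((((hq (Pi.single i 1 + Pi.single j 1)).sub (hq (Pi.single i 1))).sub
    (hq (Pi.single j 1))).div_const 2).congr fun k => ?_
  rw [quad_add _ (hP k), quad_single, quad_single, quad_single]
  ring

theorem tendsto_quad {P : ℕ → Matrix a a ℝ} {L : Matrix a a ℝ} (h : Tendsto P atTop (𝓝 L))
    (x : a → ℝ) : Tendsto (fun k => x ⬝ᵥ P k *ᵥ x) atTop (𝓝 (x ⬝ᵥ L *ᵥ x)) := by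
  have : Continuous fun N : Matrix a a ℝ => x ⬝ᵥ N *ᵥ x :=
    continuous_const.dotProduct (continuous_id.matrix_mulVec continuous_const)
  exact (this.tendsto L).comp h

theorem eq_of_quad_eq {P L : Matrix a a ℝ} (hP : Pᵀ = P) (hL : Lᵀ = L)
    (h : ∀ x : a → ℝ, x ⬝ᵥ P *ᵥ x = x ⬝ᵥ L *ᵥ x) : P = L := by
  classical
  ext i j
  have h1 := h (Pi.single i 1 + Pi.single j 1)
  rw [quad_add _ hP, quad_add _ hL, h, h (Pi.single j 1)] at h1
  simp only [quad_single] at h1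
  linarith

theorem tendsto_of_quad {P : ℕ → Matrix a a ℝ} {L : Matrix a a ℝ} (hP : ∀ k, (P k)ᵀ = P k)
    (hL : Lᵀ = L) (h : ∀ x : a → ℝ, Tendsto (fun k => x ⬝ᵥ P k *ᵥ x) atTop (𝓝 (x ⬝ᵥ L *ᵥ x))) :
    Tendsto P atTop (𝓝 L) := by
  obtain ⟨L', hL'⟩ := exists_tendsto_of_quad hP fun x => ⟨_, h x⟩
  have hs : L'ᵀ = L' := by
    have h1 := (continuous_id.matrix_transpose.tendsto L').comp hL'
    refine tendsto_nhds_unique (h1.congr fun k => hP k) hL'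
  rwa [eq_of_quad_eq hL hs fun x => tendsto_nhds_unique (h x) (tendsto_quad hL' x)]

theorem posSemidef_of_tendsto {P : ℕ → Matrix a a ℝ} {L : Matrix a a ℝ}
    (h : Tendsto P atTop (𝓝 L)) (hP : ∀ k, (P k).PosSemidef) : L.PosSemidef := by
  refine posSemidef_of_quad ?_ fun x =>
    ge_of_tendsto' (tendsto_quad h x) fun k => (hP k).quad_nonneg x
  have h1 := (continuous_id.matrix_transpose.tendsto L).comp h
  exact tendsto_nhds_unique (h1.congr fun k => (hP k).transpose_eq) h

end Quad

/-! ### Moore–Penrose inverse, rank and pseudodeterminant of symmetric matrices -/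

section Spectral

variable {a : Type*} [Fintype a] [DecidableEq a]

theorem exists_diagonalization {A : Matrix a a ℝ} (hA : Aᵀ = A) :
    ∃ (U : Matrix a a ℝ) (lam : a → ℝ), U * Uᵀ = 1 ∧ Uᵀ * U = 1 ∧ A = U * diagonal lam * Uᵀ := by
  have hH : A.IsHermitian := by rwa [IsHermitian, conjTranspose_eq_transpose_of_trivial]
  refine ⟨(hH.eigenvectorUnitary : Matrix a a ℝ), hH.eigenvalues, ?_, ?_, ?_⟩
  · simpa [star_eq_conjTranspose, conjTranspose_eq_transpose_of_trivial] using
      Unitary.coe_mul_star_self hH.eigenvectorUnitary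
  · simpa [star_eq_conjTranspose, conjTranspose_eq_transpose_of_trivial] using
      Unitary.coe_star_mul_self hH.eigenvectorUnitary
  · have := hH.spectral_theorem
    simpa [Unitary.conjStarAlgAut_apply, star_eq_conjTranspose,
      conjTranspose_eq_transpose_of_trivial] using this

theorem conj_diagonal_mul {U : Matrix a a ℝ} (hU : Uᵀ * U = 1) (e g : a → ℝ) :
    U * diagonal e * Uᵀ * (U * diagonal g * Uᵀ) = U * diagonal (fun i => e i * g i) * Uᵀ := by
  calc _ = U * diagonal e * (Uᵀ * U) * diagonal g * Uᵀ := by simp only [Matrix.mul_assoc]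
    _ = _ := by rw [hU, Matrix.mul_one, Matrix.mul_assoc U, diagonal_mul_diagonal]

theorem conj_diagonal_transpose (U : Matrix a a ℝ) (e : a → ℝ) :
    (U * diagonal e * Uᵀ)ᵀ = U * diagonal e * Uᵀ := by
  simp [transpose_mul, Matrix.mul_assoc]

theorem pinv_conj_diagonal {U : Matrix a a ℝ} (hU : Uᵀ * U = 1) (lam : a → ℝ) :
    pinv (U * diagonal lam * Uᵀ) = U * diagonal (fun i => (lam i)⁻¹) * Uᵀ := by
  refine (pinv_spec _).unique ⟨?_, ?_, ?_, ?_⟩ <;>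
    simp only [conj_diagonal_mul hU, conj_diagonal_transpose]
  · simp only [mul_inv_mul_cancel]
  · congr 3; funext i
    by_cases h : lam i = 0 <;> simp [h]

theorem charpoly_conj_diagonal {U : Matrix a a ℝ} (hU : Uᵀ * U = 1) (lam : a → ℝ) :
    (U * diagonal lam * Uᵀ).charpoly.roots = Multiset.map lam Finset.univ.val := by
  rw [Matrix.mul_assoc, Matrix.charpoly_mul_comm, Matrix.mul_assoc, hU, Matrix.mul_one,
    charpoly_diagonal]
  have := Polynomial.roots_multiset_prod_X_sub_C (Finset.univ.val.map lam)
  rwa [Multiset.map_map] at this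

theorem pdet_conj_diagonal {U : Matrix a a ℝ} (hU : Uᵀ * U = 1) (lam : a → ℝ) :
    pdet (U * diagonal lam * Uᵀ) = ∏ i, if lam i = 0 then 1 else lam i := by
  rw [pdet, charpoly_conj_diagonal hU]
  have : ∀ s : Multiset a, ((s.map lam).filter (fun r => r ≠ 0)).prod
      = (s.map fun i => if lam i = 0 then 1 else lam i).prod := by
    intro s
    induction s using Multiset.induction_on with
    | empty => simp
    | cons i s ih => by_cases h : lam i = 0 <;> simp_all
  exact this _

/-- The pseudodeterminant through the projection `1 - A† A` onto the kernel; in this form it depends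
continuously on the pair `(A, A†)`. -/
theorem pdet_eq_det {A : Matrix a a ℝ} (hA : Aᵀ = A) : pdet A = (A + (1 - pinv A * A)).det := by
  obtain ⟨U, lam, h1, h2, rfl⟩ := exists_diagonalization hA
  rw [pdet_conj_diagonal h2, pinv_conj_diagonal h2, conj_diagonal_mul h2]
  have h3 : U * diagonal lam * Uᵀ + (1 - U * diagonal (fun i => (lam i)⁻¹ * lam i) * Uᵀ)
      = U * diagonal (fun i => if lam i = 0 then 1 else lam i) * Uᵀ := by
    have : (diagonal (fun i => if lam i = 0 then 1 else lam i) : Matrix a a ℝ)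
        = diagonal lam + (1 - diagonal (fun i => (lam i)⁻¹ * lam i)) := by
      rw [← diagonal_one, diagonal_sub, diagonal_add]
      congr 1; funext i
      by_cases h : lam i = 0 <;> simp [h]
    rw [this, Matrix.mul_add, Matrix.mul_sub, Matrix.add_mul, Matrix.sub_mul, Matrix.mul_one, h1]
  rw [h3, det_mul_right_comm, h1, Matrix.one_mul, det_diagonal]

/-- The rank as the trace of the projection `A† A` onto the range, continuous in `(A, A†)`. -/
theorem rank_eq_trace {A : Matrix a a ℝ} (hA : Aᵀ = A) : (A.rank : ℝ) = (pinv A * A).trace := by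
  obtain ⟨U, lam, h1, h2, rfl⟩ := exists_diagonalization hA
  have hu : IsUnit U.det := by
    rw [← isUnit_iff_isUnit_det]; exact IsUnit.of_mul_eq_one _ h1
  have hu' : IsUnit Uᵀ.det := by rwa [det_transpose]
  rw [pinv_conj_diagonal h2, conj_diagonal_mul h2, rank_mul_eq_left_of_isUnit_det _ _ hu',
    rank_mul_eq_right_of_isUnit_det _ _ hu, rank_diagonal, Matrix.trace_mul_comm,
    ← Matrix.mul_assoc, h2, Matrix.one_mul, trace_diagonal]
  have : ∀ i, (lam i)⁻¹ * lam i = if lam i ≠ 0 then 1 else 0 := by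
    intro i; by_cases h : lam i = 0 <;> simp [h]
  simp only [this, Finset.sum_boole, Fintype.card_subtype]

theorem pdet_pos {A : Matrix a a ℝ} (hA : A.PosSemidef) : 0 < pdet A := by
  rw [pdet, hA.1.roots_charpoly_eq_eigenvalues]
  refine Multiset.prod_pos fun r hr => ?_
  rw [Multiset.mem_filter, Multiset.mem_map] at hr
  obtain ⟨⟨i, -, rfl⟩, hne⟩ := hr
  exact lt_of_le_of_ne (hA.eigenvalues_nonneg i) (Ne.symm hne)

/-- If `N` is the orthogonal projection onto the kernel of the symmetric matrix `A`, then `A + N`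
is invertible and inverts `A` on the orthogonal complement. -/
theorem pinv_eq_inv_sub {A N : Matrix a a ℝ} (hA : Aᵀ = A) (hN : Nᵀ = N) (hNN : N * N = N)
    (hAN : A * N = 0) (hu : IsUnit (A + N).det) : pinv A = (A + N)⁻¹ - N := by
  have hNA : N * A = 0 := by
    have := congrArg transpose hAN
    rwa [transpose_mul, hA, hN, transpose_zero] at this
  set X := (A + N)⁻¹ with hX
  have h1 : X * (A + N) = 1 := nonsing_inv_mul _ hu
  have h2 : (A + N) * X = 1 := mul_nonsing_inv _ hu
  have h3 : N * X = N := by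
    calc N * X = N * (A + N) * X := by rw [Matrix.mul_add, hNA, hNN, zero_add]
      _ = N := by rw [Matrix.mul_assoc, h2, Matrix.mul_one]
  have h4 : X * N = N := by
    calc X * N = X * ((A + N) * N) := by rw [Matrix.add_mul, hAN, hNN, zero_add]
      _ = N := by rw [← Matrix.mul_assoc, h1, Matrix.one_mul]
  have h5 : X * A = 1 - N := by
    rw [eq_sub_iff_add_eq, ← h1, Matrix.mul_add, h4]
  have h6 : A * X = 1 - N := by
    rw [eq_sub_iff_add_eq, ← h2, Matrix.add_mul, h3]
  have h7 : (X - N) * A = 1 - N := by rw [Matrix.sub_mul, h5, hNA, sub_zero]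
  have h8 : A * (X - N) = 1 - N := by rw [Matrix.mul_sub, h6, hAN, sub_zero]
  refine (pinv_spec A).unique ⟨?_, ?_, ?_, ?_⟩
  · rw [h8, Matrix.sub_mul, hNA, Matrix.one_mul, sub_zero]
  · rw [h7, Matrix.sub_mul, Matrix.one_mul, Matrix.mul_sub, h3, hNN, sub_self, sub_zero]
  · rw [h8, transpose_sub, transpose_one, hN]
  · rw [h7, transpose_sub, transpose_one, hN]

end Spectral

/-! ### Limits of matrix expressions -/

section Tendsto

variable {α a b c : Type*} {l : Filter α}

theorem tendsto_matrix_mul [Fintype b] {X : α → Matrix a b ℝ} {Y : α → Matrix b c ℝ}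
    {X' : Matrix a b ℝ} {Y' : Matrix b c ℝ} (hX : Tendsto X l (𝓝 X')) (hY : Tendsto Y l (𝓝 Y')) :
    Tendsto (fun k => X k * Y k) l (𝓝 (X' * Y')) := by
  have : Continuous fun p : Matrix a b ℝ × Matrix b c ℝ => p.1 * p.2 :=
    continuous_fst.matrix_mul continuous_snd
  exact (this.tendsto (X', Y')).comp (hX.prodMk_nhds hY)

theorem tendsto_matrix_transpose {X : α → Matrix a b ℝ} {X' : Matrix a b ℝ}
    (hX : Tendsto X l (𝓝 X')) : Tendsto (fun k => (X k)ᵀ) l (𝓝 X'ᵀ) :=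
  (continuous_id.matrix_transpose.tendsto X').comp hX

theorem tendsto_matrix_det [Fintype a] [DecidableEq a] {X : α → Matrix a a ℝ}
    {X' : Matrix a a ℝ} (hX : Tendsto X l (𝓝 X')) :
    Tendsto (fun k => (X k).det) l (𝓝 X'.det) :=
  (continuous_id.matrix_det.tendsto X').comp hX

theorem tendsto_matrix_inv [Fintype a] [DecidableEq a] {X : α → Matrix a a ℝ}
    {X' : Matrix a a ℝ} (hX : Tendsto X l (𝓝 X')) (h : X'.det ≠ 0) :
    Tendsto (fun k => (X k)⁻¹) l (𝓝 X'⁻¹) := by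
  simp only [inv_def, Ring.inverse_eq_inv']
  exact ((tendsto_matrix_det hX).inv₀ h).smul
    ((continuous_id.matrix_adjugate.tendsto X').comp hX)

end Tendsto

theorem mulVec_injective_of_mul_eq_one {a b : Type*} [Fintype a] [Fintype b] [DecidableEq a]
    {X : Matrix a b ℝ} {Y : Matrix b a ℝ} (h : X * Y = 1) : Function.Injective Y.mulVec := by
  intro x y hxy
  have := congrArg (X *ᵥ ·) hxy
  simpa only [mulVec_mulVec, h, one_mulVec] using this

theorem mulVec_injective_of_rank {a : Type*} {s : ℕ} [Fintype a] {E : Matrix a (Fin s) ℝ}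
    (h : E.rank = s) : Function.Injective E.mulVec := by
  have h1 : (Eᵀ * E).rank = s := by rw [rank_transpose_mul_self, h]
  have h2 : (Eᵀ * E).mulVecLin.range = ⊤ := by
    apply Submodule.eq_top_of_finrank_eq
    rw [Module.finrank_fin_fun]; exact h1
  have h3 : Function.Injective (Eᵀ * E).mulVecLin :=
    LinearMap.injective_iff_surjective.2 (LinearMap.range_eq_top.1 h2)
  intro x y hxy
  apply h3
  simp only [mulVecLin_apply, ← mulVec_mulVec]
  exact congrArg _ hxy

theorem _root_.Matrix.PosDef.conj {a b : Type*} [Fintype a] [Fintype b] {A : Matrix a a ℝ}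
    (hA : A.PosDef) {B : Matrix a b ℝ} (hB : Function.Injective B.mulVec) :
    (Bᵀ * A * B).PosDef := by
  simpa [conjTranspose_eq_transpose_of_trivial] using hA.conjTranspose_mul_mul_same hB

theorem _root_.Matrix.PosSemidef.conj {a b : Type*} [Fintype a] [Fintype b] {A : Matrix a a ℝ}
    (hA : A.PosSemidef) (B : Matrix b a ℝ) : (B * A * Bᵀ).PosSemidef := by
  simpa [conjTranspose_eq_transpose_of_trivial] using hA.mul_mul_conjTranspose_same B

/-! ### One step of a filter with an unknown input -/

section Step

variable {n t s : Type*} [Fintype n] [Fintype t] [Fintype s] [DecidableEq n]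
  {C : Matrix t n ℝ} {G : Matrix n s ℝ} {Pt : Matrix n n ℝ} {R Rt : Matrix t t ℝ}
  {M : Matrix s t ℝ} {Z : Matrix s s ℝ}

/-- The covariance of the residual is `Π R̃ Πᵀ = Π R̃` with the oblique projection `Π = 1 - C G M`. The
hypotheses on `M` hold for the weighted least squares gain `M = Z (C G)ᵀ R̃⁻¹`,
`Z = ((C G)ᵀ R̃⁻¹ C G)⁻¹`. -/
theorem predicted_residual_cov [DecidableEq t] [DecidableEq s]
    (hRt : Rt = C * Pt * Cᵀ + R) (hME : M * (C * G) = 1)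
    (hMR : M * Rt = Z * (C * G)ᵀ) (hRM : Rt * Mᵀ = C * G * Z) :
    C * (G * M * R * Mᵀ * Gᵀ + (1 - G * M * C) * Pt * (1 - G * M * C)ᵀ) * Cᵀ + R
      - C * G * M * R - R * Mᵀ * Gᵀ * Cᵀ = (1 - C * G * M) * Rt := by
  have h1 : C * (G * M * R * Mᵀ * Gᵀ + (1 - G * M * C) * Pt * (1 - G * M * C)ᵀ) * Cᵀ + R
      - C * G * M * R - R * Mᵀ * Gᵀ * Cᵀ = (1 - C * G * M) * Rt * (1 - C * G * M)ᵀ := by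
    subst hRt
    simp only [Matrix.mul_add, Matrix.add_mul, Matrix.mul_sub, Matrix.sub_mul, transpose_sub,
      transpose_mul, transpose_one, Matrix.mul_one, Matrix.one_mul, Matrix.mul_assoc]
    abel
  have h2 : Rt * (1 - C * G * M)ᵀ = (1 - C * G * M) * Rt := by
    rw [transpose_sub, transpose_one, Matrix.mul_sub, Matrix.sub_mul, Matrix.mul_one,
      Matrix.one_mul, transpose_mul, ← Matrix.mul_assoc, hRM, Matrix.mul_assoc (C * G) M, hMR,
      Matrix.mul_assoc]
  rw [h1, Matrix.mul_assoc, h2, ← Matrix.mul_assoc]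
  congr 1
  simp only [Matrix.mul_sub, Matrix.sub_mul, Matrix.mul_one, Matrix.one_mul]
  rw [Matrix.mul_assoc (C * G) M, ← Matrix.mul_assoc M, hME, Matrix.one_mul]
  abel

/-- The cross covariance of the state error and the residual is `P̃ Cᵀ Πᵀ`. -/
theorem gain_numerator [DecidableEq t] [DecidableEq s]
    (hRt : Rt = C * Pt * Cᵀ + R) (hME : M * (C * G) = 1)
    (hMR : M * Rt = Z * (C * G)ᵀ) :
    (G * M * R * Mᵀ * Gᵀ + (1 - G * M * C) * Pt * (1 - G * M * C)ᵀ) * Cᵀ - G * M * R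
      = Pt * Cᵀ * (1 - C * G * M)ᵀ := by
  have h1 : (G * M * R * Mᵀ * Gᵀ + (1 - G * M * C) * Pt * (1 - G * M * C)ᵀ) * Cᵀ - G * M * R
      = Pt * Cᵀ * (1 - C * G * M)ᵀ - G * (M * Rt * (1 - C * G * M)ᵀ) := by
    subst hRt
    simp only [Matrix.mul_add, Matrix.add_mul, Matrix.mul_sub, Matrix.sub_mul, transpose_sub,
      transpose_mul, transpose_one, Matrix.mul_one, Matrix.one_mul, Matrix.mul_assoc]
    abel
  have h2 : M * Rt * (1 - C * G * M)ᵀ = 0 := by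
    rw [hMR, Matrix.mul_assoc, ← transpose_mul, Matrix.sub_mul, Matrix.one_mul,
      Matrix.mul_assoc (C * G) M, hME, Matrix.mul_one, sub_self, transpose_zero, Matrix.mul_zero]
  rw [h1, h2, Matrix.mul_zero, sub_zero]

/-- Input estimation followed by the measurement update is a single update (in Joseph form) with the
total gain `G M + L (1 - C G M)`. -/
theorem updated_cov [DecidableEq t] (L : Matrix n t ℝ) :
    (1 - L * C) * G * M * R * Lᵀ + L * R * Mᵀ * Gᵀ * (1 - L * C)ᵀ
      + (1 - L * C) * (G * M * R * Mᵀ * Gᵀ + (1 - G * M * C) * Pt * (1 - G * M * C)ᵀ)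
        * (1 - L * C)ᵀ + L * R * Lᵀ
      = (1 - (G * M + L * (1 - C * G * M)) * C) * Pt * (1 - (G * M + L * (1 - C * G * M)) * C)ᵀ
        + (G * M + L * (1 - C * G * M)) * R * (G * M + L * (1 - C * G * M))ᵀ := by
  have h1 : 1 - (G * M + L * (1 - C * G * M)) * C = (1 - L * C) * (1 - G * M * C) := by
    simp only [Matrix.add_mul, Matrix.mul_sub, Matrix.sub_mul, Matrix.mul_one, Matrix.one_mul,
      Matrix.mul_assoc]
    abel
  have h2 : G * M + L * (1 - C * G * M) = (1 - L * C) * (G * M) + L := by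
    simp only [Matrix.mul_sub, Matrix.sub_mul, Matrix.mul_one, Matrix.one_mul, Matrix.mul_assoc]
    abel
  rw [h1, h2]
  generalize 1 - L * C = X
  simp only [Matrix.mul_add, Matrix.add_mul, transpose_add, transpose_mul, Matrix.mul_assoc]
  abel

/-- Optimality of the gain `K` among the unbiased ones, in dual form: first-order stationarity
`hstat` on the constraint `Gᵀ (a - Cᵀ κ) = 0` and convexity make `Kᵀ a` the minimizer. -/
theorem quad_gain_le {K : Matrix n t ℝ} {Y : Matrix s n ℝ} (hPt : Pt.PosSemidef)
    (hR : R.PosSemidef) (hKG : K * (C * G) = G)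
    (hstat : R * Kᵀ - C * Pt * (1 - K * C)ᵀ = C * G * Y)
    (x : n → ℝ) (κ : t → ℝ) (hκ : Gᵀ *ᵥ (x - Cᵀ *ᵥ κ) = 0) :
    x ⬝ᵥ ((1 - K * C) * Pt * (1 - K * C)ᵀ + K * R * Kᵀ) *ᵥ x
      ≤ (x - Cᵀ *ᵥ κ) ⬝ᵥ Pt *ᵥ (x - Cᵀ *ᵥ κ) + κ ⬝ᵥ R *ᵥ κ := by
  set δ : t → ℝ := κ - Kᵀ *ᵥ x with hδ
  have e1 : κ = Kᵀ *ᵥ x + δ := by rw [hδ]; abel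
  have e2 : x - Cᵀ *ᵥ κ = (1 - K * C)ᵀ *ᵥ x + -(Cᵀ *ᵥ δ) := by
    rw [e1, mulVec_add, transpose_sub, transpose_one, transpose_mul, sub_mulVec, one_mulVec,
      mulVec_mulVec]
    abel
  have hδ0 : (C * G)ᵀ *ᵥ δ = 0 := by
    have h1 : (C * G)ᵀ *ᵥ κ = Gᵀ *ᵥ x := by
      rw [mulVec_sub, sub_eq_zero, mulVec_mulVec, ← transpose_mul] at hκ
      exact hκ.symm
    rw [hδ, mulVec_sub, h1, mulVec_mulVec, ← transpose_mul, hKG, sub_self]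
  have hcross : (Kᵀ *ᵥ x) ⬝ᵥ R *ᵥ δ - ((1 - K * C)ᵀ *ᵥ x) ⬝ᵥ Pt *ᵥ (Cᵀ *ᵥ δ) = 0 := by
    have h1 : δ ⬝ᵥ (R * Kᵀ - C * Pt * (1 - K * C)ᵀ) *ᵥ x = 0 := by
      rw [hstat, ← mulVec_mulVec, dotProduct_mulVec, ← mulVec_transpose, hδ0, zero_dotProduct]
    rw [sub_mulVec, dotProduct_sub] at h1
    rw [← h1]
    congr 1
    · rw [dotProduct_comm, ← mulVec_mulVec, dotProduct_mulVec δ, ← mulVec_transpose,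
        hR.transpose_eq]
    · rw [dotProduct_comm, ← mulVec_mulVec, ← mulVec_mulVec, dotProduct_mulVec δ,
        ← mulVec_transpose, dotProduct_mulVec _ Pt, ← mulVec_transpose, hPt.transpose_eq]
  rw [e2, quad_add _ hPt.transpose_eq, e1, quad_add _ hR.transpose_eq, add_mulVec,
    dotProduct_add, quad_conj, quad_conj]
  have h3 := hPt.quad_nonneg (-(Cᵀ *ᵥ δ))
  have h4 := hR.quad_nonneg δ
  rw [mulVec_neg, dotProduct_neg]
  rw [mulVec_neg] at h3
  linarith

end Step

namespace Model.SVD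

variable {n m l : ℕ} {S : Model n m l} (τ : S.SVD)

/-! ### The filter of a model: gains and covariances -/

theorem R₂_posDef : τ.R₂.PosDef := by
  have := S.posDef_R.conj (mulVec_injective_of_mul_eq_one τ.U₂_orth)
  simpa [R₂, T₂] using this

theorem T₁_mul_U₁ : τ.T₁ * τ.U₁ = 1 := by
  have h : τ.U₂ᵀ * τ.U₁ = 0 := by
    have := congrArg transpose τ.U₁₂_orth
    simpa using this
  rw [T₁, Matrix.sub_mul, τ.U₁_orth, Matrix.mul_assoc _ τ.U₂ᵀ, h, Matrix.mul_zero, sub_zero]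

theorem R₁_posDef : τ.R₁.PosDef := by
  have h : Function.Injective τ.T₁ᵀ.mulVec := by
    apply mulVec_injective_of_mul_eq_one (X := τ.U₁ᵀ)
    rw [← transpose_mul, τ.T₁_mul_U₁, transpose_one]
  simpa [R₁] using S.posDef_R.conj h

theorem Qhat_posSemidef : τ.Qhat.PosSemidef := by
  have := (τ.R₁_posDef.posSemidef.conj (τ.G₁ * τ.M₁)).add S.posSemidef_Q
  simpa [Qhat, transpose_mul, Matrix.mul_assoc] using this

variable {P : Matrix (Fin n) (Fin n) ℝ}

theorem Ptilde_posSemidef (hP : P.PosSemidef) : (τ.Ptilde P).PosSemidef :=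
  (hP.conj τ.Ahat).add τ.Qhat_posSemidef

theorem Rtilde_posDef (hP : P.PosSemidef) : (τ.Rtilde P).PosDef :=
  PosDef.posSemidef_add ((τ.Ptilde_posSemidef hP).conj τ.C₂) τ.R₂_posDef

theorem Rtilde_det_ne_zero (hP : P.PosSemidef) : (τ.Rtilde P).det ≠ 0 :=
  (τ.Rtilde_posDef hP).det_pos.ne'

theorem Rtilde_transpose (hP : P.PosSemidef) : (τ.Rtilde P)ᵀ = τ.Rtilde P :=
  (τ.Rtilde_posDef hP).posSemidef.transpose_eq

theorem inputInfo_posDef (hτ : τ.DelayFree) (hP : P.PosSemidef) :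
    (τ.G₂ᵀ * τ.C₂ᵀ * (τ.Rtilde P)⁻¹ * τ.C₂ * τ.G₂).PosDef := by
  have := (τ.Rtilde_posDef hP).inv.conj (mulVec_injective_of_rank hτ)
  simpa [transpose_mul, Matrix.mul_assoc] using this

theorem M₂_mul (hτ : τ.DelayFree) (hP : P.PosSemidef) : τ.M₂ P * (τ.C₂ * τ.G₂) = 1 := by
  rw [M₂]
  simp only [← Matrix.mul_assoc]
  set J := τ.G₂ᵀ * τ.C₂ᵀ * (τ.Rtilde P)⁻¹ * τ.C₂ * τ.G₂ with hJ
  have : J⁻¹ * τ.G₂ᵀ * τ.C₂ᵀ * (τ.Rtilde P)⁻¹ * τ.C₂ * τ.G₂ = J⁻¹ * J := by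
    rw [hJ]; simp only [Matrix.mul_assoc]
  rw [this, nonsing_inv_mul _ (τ.inputInfo_posDef hτ hP).det_pos.ne'.isUnit]

theorem M₂_mul_Rtilde (hP : P.PosSemidef) : τ.M₂ P * τ.Rtilde P
    = (τ.G₂ᵀ * τ.C₂ᵀ * (τ.Rtilde P)⁻¹ * τ.C₂ * τ.G₂)⁻¹ * (τ.C₂ * τ.G₂)ᵀ := by
  rw [M₂, Matrix.mul_assoc _ _ (τ.Rtilde P),
    nonsing_inv_mul _ (τ.Rtilde_det_ne_zero hP).isUnit, Matrix.mul_one, transpose_mul,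
    Matrix.mul_assoc]

theorem Rtilde_mul_M₂_transpose (hτ : τ.DelayFree) (hP : P.PosSemidef) :
    τ.Rtilde P * (τ.M₂ P)ᵀ
      = τ.C₂ * τ.G₂ * (τ.G₂ᵀ * τ.C₂ᵀ * (τ.Rtilde P)⁻¹ * τ.C₂ * τ.G₂)⁻¹ := by
  have h := congrArg transpose (τ.M₂_mul_Rtilde hP)
  rwa [transpose_mul, transpose_mul, transpose_transpose, τ.Rtilde_transpose hP,
    transpose_nonsing_inv, (τ.inputInfo_posDef hτ hP).posSemidef.transpose_eq] at h

/-- The oblique projection `I - C₂ G₂ M₂` along the range of `C₂ G₂`, which turns innovations into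
residuals. -/
noncomputable def proj (P : Matrix (Fin n) (Fin n) ℝ) : Matrix (Fin τ.t) (Fin τ.t) ℝ :=
  1 - τ.C₂ * τ.G₂ * τ.M₂ P

theorem Rstar_eq (hτ : τ.DelayFree) (hP : P.PosSemidef) : τ.Rstar P = τ.proj P * τ.Rtilde P :=
  predicted_residual_cov rfl (τ.M₂_mul hτ hP) (τ.M₂_mul_Rtilde hP)
    (τ.Rtilde_mul_M₂_transpose hτ hP)

theorem proj_mul (hτ : τ.DelayFree) (hP : P.PosSemidef) : τ.proj P * (τ.C₂ * τ.G₂) = 0 := by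
  rw [proj, Matrix.sub_mul, Matrix.one_mul, Matrix.mul_assoc (τ.C₂ * τ.G₂), τ.M₂_mul hτ hP,
    Matrix.mul_one, sub_self]

theorem proj_mul_proj (hτ : τ.DelayFree) (hP : P.PosSemidef) :
    τ.proj P * τ.proj P = τ.proj P := by
  nth_rewrite 2 [proj]
  rw [Matrix.mul_sub, Matrix.mul_one, ← Matrix.mul_assoc, τ.proj_mul hτ hP, Matrix.zero_mul,
    sub_zero]

theorem Rstar_eq' (hτ : τ.DelayFree) (hP : P.PosSemidef) :
    τ.Rstar P = τ.Rtilde P * (τ.proj P)ᵀ := by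
  rw [τ.Rstar_eq hτ hP, proj, transpose_sub, transpose_one, Matrix.mul_sub, Matrix.sub_mul,
    Matrix.mul_one, Matrix.one_mul, transpose_mul _ (τ.M₂ P), ← Matrix.mul_assoc,
    τ.Rtilde_mul_M₂_transpose hτ hP, Matrix.mul_assoc (τ.C₂ * τ.G₂) (τ.M₂ P), τ.M₂_mul_Rtilde hP]
  simp only [Matrix.mul_assoc]

theorem Rstar_transpose (hτ : τ.DelayFree) (hP : P.PosSemidef) : (τ.Rstar P)ᵀ = τ.Rstar P := by
  nth_rewrite 1 [τ.Rstar_eq hτ hP]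
  rw [transpose_mul, τ.Rtilde_transpose hP, τ.Rstar_eq' hτ hP]

theorem Rstar_posSemidef (hτ : τ.DelayFree) (hP : P.PosSemidef) : (τ.Rstar P).PosSemidef := by
  have h : τ.Rstar P = τ.proj P * τ.Rtilde P * (τ.proj P)ᵀ := by
    rw [Matrix.mul_assoc, ← τ.Rstar_eq' hτ hP, τ.Rstar_eq hτ hP, ← Matrix.mul_assoc,
      τ.proj_mul_proj hτ hP]
  rw [h]
  exact (τ.Rtilde_posDef hP).posSemidef.conj _

theorem Ltilde_eq (hτ : τ.DelayFree) (hP : P.PosSemidef) :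
    τ.Ltilde P = τ.Ptilde P * τ.C₂ᵀ * (τ.proj P)ᵀ * pinv (τ.Rstar P) := by
  rw [Ltilde, proj, Pstar,
    gain_numerator (Rt := τ.Rtilde P) rfl (τ.M₂_mul hτ hP) (τ.M₂_mul_Rtilde hP)]

/-- The total gain `G₂ M₂ + L̃ (I - C₂ G₂ M₂)` from the innovation `z₂ - C₂ x̂_{k|k-1} - D₂ u` to the
state estimate `x̂_{k|k}`. -/
noncomputable def gain (P : Matrix (Fin n) (Fin n) ℝ) : Matrix (Fin n) (Fin τ.t) ℝ :=
  τ.G₂ * τ.M₂ P + τ.Ltilde P * τ.proj P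

/-- The pseudoinverse cancels from the total gain: `Πᵀ R̃⋆† Π = R̃⁻¹ Π`. -/
theorem gain_eq (hτ : τ.DelayFree) (hP : P.PosSemidef) :
    τ.gain P = τ.G₂ * τ.M₂ P + τ.Ptilde P * τ.C₂ᵀ * ((τ.Rtilde P)⁻¹ * τ.proj P) := by
  have hu := (τ.Rtilde_det_ne_zero hP).isUnit
  have h1 : (τ.proj P)ᵀ = (τ.Rtilde P)⁻¹ * τ.Rstar P := by
    rw [τ.Rstar_eq' hτ hP, ← Matrix.mul_assoc, nonsing_inv_mul _ hu, Matrix.one_mul]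
  have h2 : τ.proj P = τ.Rstar P * (τ.Rtilde P)⁻¹ := by
    rw [τ.Rstar_eq hτ hP, Matrix.mul_assoc, mul_nonsing_inv _ hu, Matrix.mul_one]
  have h3 : (τ.proj P)ᵀ * pinv (τ.Rstar P) * τ.proj P = (τ.Rtilde P)⁻¹ * τ.proj P := by
    rw [h1, h2]
    calc (τ.Rtilde P)⁻¹ * τ.Rstar P * pinv (τ.Rstar P) * (τ.Rstar P * (τ.Rtilde P)⁻¹)
        = (τ.Rtilde P)⁻¹ * (τ.Rstar P * pinv (τ.Rstar P) * τ.Rstar P) * (τ.Rtilde P)⁻¹ := by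
          simp only [Matrix.mul_assoc]
      _ = _ := by rw [(pinv_spec _).1, Matrix.mul_assoc]
  rw [gain, τ.Ltilde_eq hτ hP]
  congr 1
  rw [← h3]; simp only [Matrix.mul_assoc]

/-- The total gain is unbiased with respect to the unknown input. -/
theorem gain_mul (hτ : τ.DelayFree) (hP : P.PosSemidef) : τ.gain P * (τ.C₂ * τ.G₂) = τ.G₂ := by
  rw [gain, Matrix.add_mul, Matrix.mul_assoc, τ.M₂_mul hτ hP, Matrix.mul_assoc, τ.proj_mul hτ hP,
    Matrix.mul_one, Matrix.mul_zero, add_zero]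

/-- The error transition matrix `(I - K C₂) Â` of the filter with total gain `K`. -/
noncomputable def errorMap (K : Matrix (Fin n) (Fin τ.t) ℝ) : Matrix (Fin n) (Fin n) ℝ :=
  (1 - K * τ.C₂) * τ.Ahat

/-- The covariance that the noises add to the error in one step of the filter with total
gain `K`. -/
noncomputable def errorNoise (K : Matrix (Fin n) (Fin τ.t) ℝ) : Matrix (Fin n) (Fin n) ℝ :=
  (1 - K * τ.C₂) * τ.Qhat * (1 - K * τ.C₂)ᵀ + K * τ.R₂ * Kᵀ

theorem covStep_eq_update (P : Matrix (Fin n) (Fin n) ℝ) : τ.covStep P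
    = (1 - τ.gain P * τ.C₂) * τ.Ptilde P * (1 - τ.gain P * τ.C₂)ᵀ
      + τ.gain P * τ.R₂ * (τ.gain P)ᵀ :=
  updated_cov (τ.Ltilde P)

theorem errorMap_conj_add (K : Matrix (Fin n) (Fin τ.t) ℝ) (P : Matrix (Fin n) (Fin n) ℝ) :
    τ.errorMap K * P * (τ.errorMap K)ᵀ + τ.errorNoise K
      = (1 - K * τ.C₂) * τ.Ptilde P * (1 - K * τ.C₂)ᵀ + K * τ.R₂ * Kᵀ := by
  rw [errorMap, errorNoise, Ptilde, transpose_mul, Matrix.mul_add, Matrix.add_mul]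
  simp only [Matrix.mul_assoc, add_assoc]

theorem covStep_eq (P : Matrix (Fin n) (Fin n) ℝ) : τ.covStep P
    = τ.errorMap (τ.gain P) * P * (τ.errorMap (τ.gain P))ᵀ + τ.errorNoise (τ.gain P) := by
  rw [covStep_eq_update, errorMap_conj_add]

theorem errorNoise_posSemidef (K : Matrix (Fin n) (Fin τ.t) ℝ) : (τ.errorNoise K).PosSemidef :=
  (τ.Qhat_posSemidef.conj _).add (τ.R₂_posDef.posSemidef.conj K)

theorem covStep_posSemidef (hP : P.PosSemidef) : (τ.covStep P).PosSemidef := by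
  rw [covStep_eq]
  exact (hP.conj _).add (τ.errorNoise_posSemidef _)

theorem cov_posSemidef (hP : P.PosSemidef) (k : ℕ) : (τ.cov P k).PosSemidef := by
  induction k with
  | zero => exact hP
  | succ k ih => exact τ.covStep_posSemidef ih

/-- Each quadratic form of the updated covariance is the minimum of the cost of the dual control
problem, in which `κ` is constrained by unbiasedness with respect to the unknown input. -/
theorem quad_covStep_le (hτ : τ.DelayFree) (hP : P.PosSemidef) (x : Fin n → ℝ) (κ : Fin τ.t → ℝ)
    (hκ : τ.G₂ᵀ *ᵥ (x - τ.C₂ᵀ *ᵥ κ) = 0) :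
    x ⬝ᵥ τ.covStep P *ᵥ x
      ≤ (x - τ.C₂ᵀ *ᵥ κ) ⬝ᵥ τ.Ptilde P *ᵥ (x - τ.C₂ᵀ *ᵥ κ) + κ ⬝ᵥ τ.R₂ *ᵥ κ := by
  rw [covStep_eq_update]
  set Z := (τ.G₂ᵀ * τ.C₂ᵀ * (τ.Rtilde P)⁻¹ * τ.C₂ * τ.G₂)⁻¹ with hZ
  refine quad_gain_le (Y := Z * τ.G₂ᵀ - τ.M₂ P * τ.C₂ * τ.Ptilde P) (τ.Ptilde_posSemidef hP)
    τ.R₂_posDef.posSemidef (τ.gain_mul hτ hP) ?_ x κ hκ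
  have hPt := (τ.Ptilde_posSemidef hP).transpose_eq
  have h1 : τ.R₂ * (τ.gain P)ᵀ - τ.C₂ * τ.Ptilde P * (1 - τ.gain P * τ.C₂)ᵀ
      = τ.Rtilde P * (τ.gain P)ᵀ - τ.C₂ * τ.Ptilde P := by
    rw [Rtilde]
    simp only [Matrix.mul_sub, Matrix.add_mul, transpose_sub, transpose_mul, transpose_one,
      Matrix.mul_one, Matrix.mul_assoc]
    abel
  have h2 : τ.Rtilde P * (τ.gain P)ᵀ
      = τ.C₂ * τ.G₂ * Z * τ.G₂ᵀ + τ.proj P * (τ.C₂ * τ.Ptilde P) := by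
    have h3 : τ.Rtilde P * ((τ.proj P)ᵀ * (τ.Rtilde P)⁻¹) = τ.proj P := by
      rw [← Matrix.mul_assoc, ← τ.Rstar_eq' hτ hP, τ.Rstar_eq hτ hP, Matrix.mul_assoc,
        mul_nonsing_inv _ (τ.Rtilde_det_ne_zero hP).isUnit, Matrix.mul_one]
    rw [τ.gain_eq hτ hP, transpose_add, Matrix.mul_add, transpose_mul, ← Matrix.mul_assoc,
      τ.Rtilde_mul_M₂_transpose hτ hP, transpose_mul _ ((τ.Rtilde P)⁻¹ * τ.proj P),
      transpose_mul (τ.Rtilde P)⁻¹, transpose_nonsing_inv, τ.Rtilde_transpose hP, transpose_mul,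
      transpose_transpose, hPt, ← Matrix.mul_assoc (τ.Rtilde P), h3]
  rw [h1, h2, proj, Matrix.sub_mul, Matrix.one_mul, Matrix.mul_sub]
  simp only [Matrix.mul_assoc]
  abel

theorem quad_covStep (P : Matrix (Fin n) (Fin n) ℝ) (x : Fin n → ℝ) :
    x ⬝ᵥ τ.covStep P *ᵥ x
      = ((τ.errorMap (τ.gain P))ᵀ *ᵥ x) ⬝ᵥ P *ᵥ ((τ.errorMap (τ.gain P))ᵀ *ᵥ x)
        + x ⬝ᵥ τ.errorNoise (τ.gain P) *ᵥ x := by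
  rw [covStep_eq, add_mulVec, dotProduct_add, quad_conj]

/-- The filter's covariance is no larger than that of any other unbiased gain `K`, for which the
covariance update is the affine map `P ↦ F P Fᵀ + N`. -/
theorem quad_covStep_le_gain (hτ : τ.DelayFree) (hP : P.PosSemidef)
    {K : Matrix (Fin n) (Fin τ.t) ℝ} (hK : K * (τ.C₂ * τ.G₂) = τ.G₂) (x : Fin n → ℝ) :
    x ⬝ᵥ τ.covStep P *ᵥ x
      ≤ x ⬝ᵥ (τ.errorMap K * P * (τ.errorMap K)ᵀ + τ.errorNoise K) *ᵥ x := by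
  have h0 : x - τ.C₂ᵀ *ᵥ (Kᵀ *ᵥ x) = (1 - K * τ.C₂)ᵀ *ᵥ x := by
    rw [transpose_sub, transpose_one, transpose_mul, sub_mulVec, one_mulVec, mulVec_mulVec]
  refine (τ.quad_covStep_le hτ hP x (Kᵀ *ᵥ x) ?_).trans_eq ?_
  · have h1 : (1 - K * τ.C₂) * τ.G₂ = 0 := by
      rw [Matrix.sub_mul, Matrix.one_mul, Matrix.mul_assoc, hK, sub_self]
    rw [h0, mulVec_mulVec, ← transpose_mul, h1, transpose_zero, zero_mulVec]
  · rw [errorMap_conj_add, add_mulVec, dotProduct_add, quad_conj, quad_conj, h0]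

theorem quad_covStep_mono (hτ : τ.DelayFree) {P P' : Matrix (Fin n) (Fin n) ℝ}
    (hP : P.PosSemidef) (hP' : P'.PosSemidef)
    (h : ∀ x : Fin n → ℝ, x ⬝ᵥ P *ᵥ x ≤ x ⬝ᵥ P' *ᵥ x) (x : Fin n → ℝ) :
    x ⬝ᵥ τ.covStep P *ᵥ x ≤ x ⬝ᵥ τ.covStep P' *ᵥ x := by
  refine (τ.quad_covStep_le_gain hτ hP (τ.gain_mul hτ hP') x).trans ?_
  rw [quad_covStep, add_mulVec, dotProduct_add, quad_conj]
  gcongr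
  exact h _

theorem quad_cov_mono (hτ : τ.DelayFree) {P P' : Matrix (Fin n) (Fin n) ℝ}
    (hP : P.PosSemidef) (hP' : P'.PosSemidef)
    (h : ∀ x : Fin n → ℝ, x ⬝ᵥ P *ᵥ x ≤ x ⬝ᵥ P' *ᵥ x) (k : ℕ) (x : Fin n → ℝ) :
    x ⬝ᵥ τ.cov P k *ᵥ x ≤ x ⬝ᵥ τ.cov P' k *ᵥ x := by
  induction k generalizing x with
  | zero => exact h x
  | succ k ih =>
    exact τ.quad_covStep_mono hτ (τ.cov_posSemidef hP k) (τ.cov_posSemidef hP' k) ih x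

/-! ### Continuity of the filter in the covariance -/

section Continuity

variable {α : Type*} {f : Filter α} {X : α → Matrix (Fin n) (Fin n) ℝ}

theorem tendsto_Ptilde (hX : Tendsto X f (𝓝 P)) :
    Tendsto (fun k => τ.Ptilde (X k)) f (𝓝 (τ.Ptilde P)) :=
  (tendsto_matrix_mul (tendsto_matrix_mul tendsto_const_nhds hX) tendsto_const_nhds).add
    tendsto_const_nhds

theorem tendsto_Rtilde (hX : Tendsto X f (𝓝 P)) :
    Tendsto (fun k => τ.Rtilde (X k)) f (𝓝 (τ.Rtilde P)) :=
  (tendsto_matrix_mul (tendsto_matrix_mul tendsto_const_nhds (τ.tendsto_Ptilde hX))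
    tendsto_const_nhds).add tendsto_const_nhds

theorem tendsto_Rtilde_inv (hP : P.PosSemidef) (hX : Tendsto X f (𝓝 P)) :
    Tendsto (fun k => (τ.Rtilde (X k))⁻¹) f (𝓝 (τ.Rtilde P)⁻¹) :=
  tendsto_matrix_inv (τ.tendsto_Rtilde hX) (τ.Rtilde_det_ne_zero hP)

theorem tendsto_M₂ (hτ : τ.DelayFree) (hP : P.PosSemidef) (hX : Tendsto X f (𝓝 P)) :
    Tendsto (fun k => τ.M₂ (X k)) f (𝓝 (τ.M₂ P)) := by
  have h := τ.tendsto_Rtilde_inv hP hX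
  refine tendsto_matrix_mul (tendsto_matrix_mul (tendsto_matrix_mul (tendsto_matrix_inv ?_
    (τ.inputInfo_posDef hτ hP).det_pos.ne') tendsto_const_nhds) tendsto_const_nhds) h
  exact tendsto_matrix_mul (tendsto_matrix_mul (tendsto_matrix_mul tendsto_const_nhds h)
    tendsto_const_nhds) tendsto_const_nhds

theorem tendsto_proj (hτ : τ.DelayFree) (hP : P.PosSemidef) (hX : Tendsto X f (𝓝 P)) :
    Tendsto (fun k => τ.proj (X k)) f (𝓝 (τ.proj P)) :=
  tendsto_const_nhds.sub (tendsto_matrix_mul tendsto_const_nhds (τ.tendsto_M₂ hτ hP hX))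

theorem tendsto_Rstar (hτ : τ.DelayFree) (hP : P.PosSemidef) (hXP : ∀ k, (X k).PosSemidef)
    (hX : Tendsto X f (𝓝 P)) : Tendsto (fun k => τ.Rstar (X k)) f (𝓝 (τ.Rstar P)) := by
  rw [τ.Rstar_eq hτ hP]
  simp only [fun k => τ.Rstar_eq hτ (hXP k)]
  exact tendsto_matrix_mul (τ.tendsto_proj hτ hP hX) (τ.tendsto_Rtilde hX)

/-- A basis of the kernel of `R̃⋆₂`. -/
noncomputable def kerBasis (P : Matrix (Fin n) (Fin n) ℝ) : Matrix (Fin τ.t) (Fin τ.s) ℝ :=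
  (τ.Rtilde P)⁻¹ * (τ.C₂ * τ.G₂)

/-- The orthogonal projection onto the kernel of `R̃⋆₂`. -/
noncomputable def kerProj (P : Matrix (Fin n) (Fin n) ℝ) : Matrix (Fin τ.t) (Fin τ.t) ℝ :=
  τ.kerBasis P * ((τ.kerBasis P)ᵀ * τ.kerBasis P)⁻¹ * (τ.kerBasis P)ᵀ

theorem kerBasis_gram_det_pos (hτ : τ.DelayFree) (hP : P.PosSemidef) :
    0 < ((τ.kerBasis P)ᵀ * τ.kerBasis P).det := by
  have hinj : Function.Injective (τ.kerBasis P).mulVec := by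
    intro x y hxy
    have h := congrArg (τ.Rtilde P *ᵥ ·) hxy
    simp only [kerBasis, mulVec_mulVec, ← Matrix.mul_assoc,
      mul_nonsing_inv _ (τ.Rtilde_det_ne_zero hP).isUnit, Matrix.one_mul] at h
    exact mulVec_injective_of_rank hτ h
  have := (PosDef.one (n := Fin τ.t) (R := ℝ)).conj hinj
  rw [Matrix.mul_one] at this
  exact this.det_pos

/-- The kernel of `R̃⋆₂` is the range of `R̃₂⁻¹ C₂ G₂`, so the pseudoinverse is obtained from a genuine
inverse by adding the projection onto the kernel. -/
theorem pinv_Rstar (hτ : τ.DelayFree) (hP : P.PosSemidef) :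
    IsUnit (τ.Rstar P + τ.kerProj P).det ∧
      pinv (τ.Rstar P) = (τ.Rstar P + τ.kerProj P)⁻¹ - τ.kerProj P := by
  have hu := (τ.kerBasis_gram_det_pos hτ hP).ne'.isUnit
  set B := τ.kerBasis P with hB
  have hRB : τ.Rstar P * B = 0 := by
    rw [τ.Rstar_eq hτ hP, hB, kerBasis, Matrix.mul_assoc, ← Matrix.mul_assoc (τ.Rtilde P),
      mul_nonsing_inv _ (τ.Rtilde_det_ne_zero hP).isUnit, Matrix.one_mul, τ.proj_mul hτ hP]
  have hgt : (Bᵀ * B)ᵀ = Bᵀ * B := by rw [transpose_mul, transpose_transpose]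
  have hN : (τ.kerProj P)ᵀ = τ.kerProj P := by
    rw [kerProj, ← hB, transpose_mul, transpose_mul, transpose_transpose, transpose_nonsing_inv,
      hgt, Matrix.mul_assoc]
  have hNN : τ.kerProj P * τ.kerProj P = τ.kerProj P := by
    rw [kerProj, ← hB]
    calc B * (Bᵀ * B)⁻¹ * Bᵀ * (B * (Bᵀ * B)⁻¹ * Bᵀ)
        = B * ((Bᵀ * B)⁻¹ * (Bᵀ * B)) * (Bᵀ * B)⁻¹ * Bᵀ := by simp only [Matrix.mul_assoc]
      _ = _ := by rw [nonsing_inv_mul _ hu, Matrix.mul_one]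
  have hAN : τ.Rstar P * τ.kerProj P = 0 := by
    rw [kerProj, ← hB, Matrix.mul_assoc B, ← Matrix.mul_assoc, hRB, Matrix.zero_mul]
  have hunit : IsUnit (τ.Rstar P + τ.kerProj P).det := by
    rw [← isUnit_iff_isUnit_det, ← mulVec_injective_iff_isUnit]
    refine (injective_iff_map_eq_zero (τ.Rstar P + τ.kerProj P).mulVecLin).2 fun x hx => ?_
    rw [mulVecLin_apply] at hx
    -- apply the projection: the kernel part of `x` vanishes, hence also `R̃⋆₂ x`
    have h1 : τ.kerProj P *ᵥ x = 0 := by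
      have h2 := congrArg (τ.kerProj P *ᵥ ·) hx
      have h3 : τ.kerProj P * τ.Rstar P = 0 := by
        have := congrArg transpose hAN
        rwa [transpose_mul, τ.Rstar_transpose hτ hP, hN, transpose_zero] at this
      simpa only [mulVec_mulVec, Matrix.mul_add, h3, hNN, zero_add, mulVec_zero] using h2
    have h4 : τ.Rstar P *ᵥ x = 0 := by
      rwa [add_mulVec, h1, add_zero] at hx
    -- `R̃⋆₂ x = R̃₂ Πᵀ x` and `Πᵀ x = x - M₂ᵀ (C₂ G₂)ᵀ x`
    have h5 : (τ.proj P)ᵀ *ᵥ x = 0 := by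
      have h6 := congrArg ((τ.Rtilde P)⁻¹ *ᵥ ·) h4
      simpa only [τ.Rstar_eq' hτ hP, mulVec_mulVec, ← Matrix.mul_assoc,
        nonsing_inv_mul _ (τ.Rtilde_det_ne_zero hP).isUnit, Matrix.one_mul, mulVec_zero] using h6
    have h7 : x = B *ᵥ ((τ.G₂ᵀ * τ.C₂ᵀ * (τ.Rtilde P)⁻¹ * τ.C₂ * τ.G₂)⁻¹ *ᵥ
        ((τ.C₂ * τ.G₂)ᵀ *ᵥ x)) := by
      have h8 : (τ.M₂ P)ᵀ = B * (τ.G₂ᵀ * τ.C₂ᵀ * (τ.Rtilde P)⁻¹ * τ.C₂ * τ.G₂)⁻¹ := by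
        rw [hB, kerBasis, Matrix.mul_assoc, ← τ.Rtilde_mul_M₂_transpose hτ hP, ← Matrix.mul_assoc,
          nonsing_inv_mul _ (τ.Rtilde_det_ne_zero hP).isUnit, Matrix.one_mul]
      rw [proj, transpose_sub, transpose_one, sub_mulVec, one_mulVec, sub_eq_zero,
        transpose_mul _ (τ.M₂ P), h8] at h5
      simpa only [mulVec_mulVec, Matrix.mul_assoc] using h5
    have h9 : τ.kerProj P * B = B := by
      rw [kerProj, ← hB, Matrix.mul_assoc, Matrix.mul_assoc, nonsing_inv_mul _ hu, Matrix.mul_one]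
    rw [h7, mulVec_mulVec, h9, ← h7] at h1
    exact h1
  exact ⟨hunit, pinv_eq_inv_sub (τ.Rstar_transpose hτ hP) hN hNN hAN hunit⟩

/-- Along covariances the pseudoinverse of `R̃⋆₂` is continuous, because the rank of `R̃⋆₂` is constant. -/
theorem tendsto_pinv_Rstar (hτ : τ.DelayFree) (hP : P.PosSemidef) (hXP : ∀ k, (X k).PosSemidef)
    (hX : Tendsto X f (𝓝 P)) :
    Tendsto (fun k => pinv (τ.Rstar (X k))) f (𝓝 (pinv (τ.Rstar P))) := by
  have hB : Tendsto (fun k => τ.kerBasis (X k)) f (𝓝 (τ.kerBasis P)) :=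
    tendsto_matrix_mul (τ.tendsto_Rtilde_inv hP hX) tendsto_const_nhds
  have hN : Tendsto (fun k => τ.kerProj (X k)) f (𝓝 (τ.kerProj P)) :=
    tendsto_matrix_mul (tendsto_matrix_mul hB (tendsto_matrix_inv
      (tendsto_matrix_mul (tendsto_matrix_transpose hB) hB)
      (τ.kerBasis_gram_det_pos hτ hP).ne')) (tendsto_matrix_transpose hB)
  rw [(τ.pinv_Rstar hτ hP).2]
  simp only [fun k => (τ.pinv_Rstar hτ (hXP k)).2]
  exact (tendsto_matrix_inv ((τ.tendsto_Rstar hτ hP hXP hX).add hN)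
    (τ.pinv_Rstar hτ hP).1.ne_zero).sub hN

theorem tendsto_Ltilde (hτ : τ.DelayFree) (hP : P.PosSemidef) (hXP : ∀ k, (X k).PosSemidef)
    (hX : Tendsto X f (𝓝 P)) : Tendsto (fun k => τ.Ltilde (X k)) f (𝓝 (τ.Ltilde P)) := by
  rw [τ.Ltilde_eq hτ hP]
  simp only [fun k => τ.Ltilde_eq hτ (hXP k)]
  exact tendsto_matrix_mul (tendsto_matrix_mul (tendsto_matrix_mul (τ.tendsto_Ptilde hX)
    tendsto_const_nhds) (tendsto_matrix_transpose (τ.tendsto_proj hτ hP hX)))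
    (τ.tendsto_pinv_Rstar hτ hP hXP hX)

theorem tendsto_gain (hτ : τ.DelayFree) (hP : P.PosSemidef) (hXP : ∀ k, (X k).PosSemidef)
    (hX : Tendsto X f (𝓝 P)) : Tendsto (fun k => τ.gain (X k)) f (𝓝 (τ.gain P)) :=
  (tendsto_matrix_mul tendsto_const_nhds (τ.tendsto_M₂ hτ hP hX)).add
    (tendsto_matrix_mul (τ.tendsto_Ltilde hτ hP hXP hX) (τ.tendsto_proj hτ hP hX))

theorem tendsto_covStep (hτ : τ.DelayFree) (hP : P.PosSemidef) (hXP : ∀ k, (X k).PosSemidef)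
    (hX : Tendsto X f (𝓝 P)) : Tendsto (fun k => τ.covStep (X k)) f (𝓝 (τ.covStep P)) := by
  simp only [covStep_eq_update]
  have hK := τ.tendsto_gain hτ hP hXP hX
  have hF : Tendsto (fun k => 1 - τ.gain (X k) * τ.C₂) f (𝓝 (1 - τ.gain P * τ.C₂)) :=
    tendsto_const_nhds.sub (tendsto_matrix_mul hK tendsto_const_nhds)
  exact (tendsto_matrix_mul (tendsto_matrix_mul hF (τ.tendsto_Ptilde hX))
    (tendsto_matrix_transpose hF)).add (tendsto_matrix_mul
    (tendsto_matrix_mul hK tendsto_const_nhds) (tendsto_matrix_transpose hK))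

theorem tendsto_rank_Rstar (hτ : τ.DelayFree) (hP : P.PosSemidef) (hXP : ∀ k, (X k).PosSemidef)
    (hX : Tendsto X f (𝓝 P)) :
    Tendsto (fun k => ((τ.Rstar (X k)).rank : ℝ)) f (𝓝 ((τ.Rstar P).rank : ℝ)) := by
  simp only [fun k => rank_eq_trace (τ.Rstar_transpose hτ (hXP k)),
    rank_eq_trace (τ.Rstar_transpose hτ hP)]
  exact (continuous_id.matrix_trace.tendsto _).comp
    (tendsto_matrix_mul (τ.tendsto_pinv_Rstar hτ hP hXP hX) (τ.tendsto_Rstar hτ hP hXP hX))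

theorem tendsto_pdet_Rstar (hτ : τ.DelayFree) (hP : P.PosSemidef) (hXP : ∀ k, (X k).PosSemidef)
    (hX : Tendsto X f (𝓝 P)) :
    Tendsto (fun k => pdet (τ.Rstar (X k))) f (𝓝 (pdet (τ.Rstar P))) := by
  simp only [fun k => pdet_eq_det (τ.Rstar_transpose hτ (hXP k)),
    pdet_eq_det (τ.Rstar_transpose hτ hP)]
  have hR := τ.tendsto_Rstar hτ hP hXP hX
  exact tendsto_matrix_det (hR.add (tendsto_const_nhds.sub
    (tendsto_matrix_mul (τ.tendsto_pinv_Rstar hτ hP hXP hX) hR)))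

end Continuity

end Model.SVD

/-! ### Linear algebra for the Riccati recursion -/

section LinAlg

variable {a b : Type*} [Fintype a] [Fintype b]

/-- A linear functional that vanishes on the kernel of `X` is a combination of the rows of `X`. -/
theorem exists_eq_transpose_mulVec {X : Matrix b a ℝ} {w : a → ℝ}
    (h : ∀ x, X *ᵥ x = 0 → w ⬝ᵥ x = 0) : ∃ c, w = Xᵀ *ᵥ c := by
  classical
  obtain ⟨h1, h2, h3, h4⟩ := pinv_spec X
  set J := pinv X * X with hJ
  have hJJ : J * J = J := by rw [hJ, ← Matrix.mul_assoc, h2]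
  have h5 : w ⬝ᵥ ((1 - J) *ᵥ w) = 0 := by
    apply h
    rw [mulVec_mulVec, Matrix.mul_sub, Matrix.mul_one, hJ, ← Matrix.mul_assoc, h1, sub_self,
      zero_mulVec]
  have h6 : (1 - J) *ᵥ w = 0 := by
    rw [← dotProduct_self_eq_zero, dotProduct_mulVec, ← mulVec_transpose, transpose_sub,
      transpose_one, h4, mulVec_mulVec]
    have : (1 - J) * (1 - J) = 1 - J := by
      rw [Matrix.mul_sub, Matrix.sub_mul, Matrix.sub_mul, hJJ]; simp
    rw [this, dotProduct_comm]; exact h5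
  refine ⟨(pinv X)ᵀ *ᵥ w, ?_⟩
  rw [mulVec_mulVec, ← transpose_mul, h4]
  rwa [sub_mulVec, one_mulVec, sub_eq_zero] at h6

/-- The orthogonal projection whose kernel is a given subspace. -/
theorem exists_projection_of_submodule (V : Submodule ℝ (a → ℝ)) :
    ∃ Φ : Matrix a a ℝ, Φᵀ = Φ ∧ Φ * Φ = Φ ∧ ∀ x, Φ *ᵥ x = 0 ↔ x ∈ V := by
  classical
  obtain ⟨W, hW⟩ := V.exists_isCompl
  set X : Matrix a a ℝ := LinearMap.toMatrix' (W.projection V hW.symm) with hX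
  have hker : ∀ x, X *ᵥ x = 0 ↔ x ∈ V := by
    intro x
    rw [hX, LinearMap.toMatrix'_mulVec, ← LinearMap.mem_ker, Submodule.ker_projection]
  obtain ⟨h1, h2, h3, h4⟩ := pinv_spec X
  refine ⟨pinv X * X, h4, by rw [← Matrix.mul_assoc, h2], fun x => ?_⟩
  rw [← hker]
  constructor
  · intro h
    rw [← h1, Matrix.mul_assoc, ← mulVec_mulVec, h, mulVec_zero]
  · intro h
    rw [← mulVec_mulVec, h, mulVec_zero]

theorem quad_add_le {P : Matrix a a ℝ} (hP : P.PosSemidef) {ε : ℝ} (hε : 0 < ε) (x y : a → ℝ) :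
    (x + y) ⬝ᵥ P *ᵥ (x + y) ≤ (1 + ε) * (x ⬝ᵥ P *ᵥ x) + (1 + ε⁻¹) * (y ⬝ᵥ P *ᵥ y) := by
  have h := hP.quad_nonneg (ε • x + -y)
  rw [quad_add _ hP.transpose_eq] at h
  simp only [mulVec_smul, mulVec_neg, dotProduct_smul, smul_dotProduct, dotProduct_neg,
    neg_dotProduct, smul_eq_mul, neg_neg] at h
  rw [quad_add _ hP.transpose_eq]
  have h2 := mul_nonneg (inv_nonneg.2 hε.le) h
  have h3 : ε⁻¹ * (ε * (ε * (x ⬝ᵥ P *ᵥ x)) + 2 * -(ε * (x ⬝ᵥ P *ᵥ y)) + y ⬝ᵥ P *ᵥ y)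
      = ε * (x ⬝ᵥ P *ᵥ x) - 2 * (x ⬝ᵥ P *ᵥ y) + ε⁻¹ * (y ⬝ᵥ P *ᵥ y) := by
    field_simp; ring
  rw [h3] at h2
  linarith

theorem quad_le_norm (P : Matrix a a ℝ) (x : a → ℝ) :
    x ⬝ᵥ P *ᵥ x ≤ (∑ i, ∑ j, |P i j|) * ‖x‖ ^ 2 := by
  simp only [dotProduct, mulVec, Finset.mul_sum, Finset.sum_mul]
  refine Finset.sum_le_sum fun i _ => Finset.sum_le_sum fun j _ => ?_
  have h1 : x i * (P i j * x j) ≤ |P i j| * (|x i| * |x j|) := by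
    calc _ ≤ |x i * (P i j * x j)| := le_abs_self _
      _ = _ := by rw [abs_mul, abs_mul]; ring
  refine h1.trans (mul_le_mul_of_nonneg_left ?_ (abs_nonneg _))
  rw [sq]
  exact mul_le_mul (norm_le_pi_norm x i) (norm_le_pi_norm x j) (abs_nonneg _) (norm_nonneg _)

/-- A complex eigenvalue of `Mᵀ` in terms of the real and imaginary parts of its eigenvector. -/
theorem mem_spectrum_map_iff [DecidableEq a] (M : Matrix a a ℝ) (z : ℂ) :
    z ∈ spectrum ℂ (M.map (fun r : ℝ => (r : ℂ))) ↔ ∃ x y : a → ℝ, (x ≠ 0 ∨ y ≠ 0) ∧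
      Mᵀ *ᵥ x = z.re • x - z.im • y ∧ Mᵀ *ᵥ y = z.im • x + z.re • y := by
  have h0 : z ∈ spectrum ℂ (M.map (fun r : ℝ => (r : ℂ))) ↔
      ∃ v : a → ℂ, v ≠ 0 ∧ Mᵀ.map (fun r : ℝ => (r : ℂ)) *ᵥ v = z • v := by
    rw [mem_spectrum_iff_isRoot_charpoly, ← charpoly_transpose, ← mem_spectrum_iff_isRoot_charpoly,
      spectrum.mem_iff, isUnit_iff_isUnit_det, isUnit_iff_ne_zero, not_not,
      ← exists_mulVec_eq_zero_iff, ← Matrix.transpose_map]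
    refine exists_congr fun v => and_congr_right fun _ => ?_
    rw [sub_mulVec, sub_eq_zero, algebraMap_eq_diagonal, eq_comm]
    have : diagonal (algebraMap ℂ (a → ℂ) z) *ᵥ v = z • v := by
      ext i; simp [mulVec_diagonal]
    rw [this]
  rw [h0]
  have hre : ∀ (v : a → ℂ) i, ((Mᵀ.map (fun r : ℝ => (r : ℂ)) *ᵥ v) i).re
      = (Mᵀ *ᵥ fun j => (v j).re) i := by
    intro v i; simp [mulVec, dotProduct, Complex.re_sum]
  have him : ∀ (v : a → ℂ) i, ((Mᵀ.map (fun r : ℝ => (r : ℂ)) *ᵥ v) i).im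
      = (Mᵀ *ᵥ fun j => (v j).im) i := by
    intro v i; simp [mulVec, dotProduct, Complex.im_sum]
  constructor
  · rintro ⟨v, hv, h⟩
    refine ⟨fun j => (v j).re, fun j => (v j).im, ?_, ?_, ?_⟩
    · by_contra hcon
      push Not at hcon
      apply hv
      funext i
      exact Complex.ext (congrFun hcon.1 i) (congrFun hcon.2 i)
    · ext i; rw [← hre, h]; simp
    · ext i; rw [← him, h]; simp [add_comm]
  · rintro ⟨x, y, hxy, hx, hy⟩
    refine ⟨fun j => ⟨x j, y j⟩, ?_, ?_⟩
    · intro h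
      have hx0 : x = 0 := by ext i; simpa using congrArg Complex.re (congrFun h i)
      have hy0 : y = 0 := by ext i; simpa using congrArg Complex.im (congrFun h i)
      simp [hx0, hy0] at hxy
    · funext i
      refine Complex.ext ?_ ?_
      · rw [hre]; change (Mᵀ *ᵥ x) i = _; rw [hx]; simp
      · rw [him]; change (Mᵀ *ᵥ y) i = _; rw [hy]; simp [add_comm]

end LinAlg

namespace Model.SVD

variable {n m l : ℕ} {S : Model n m l} (τ : S.SVD)

/-! ### Convergence of the Riccati recursion -/

theorem cov_succ' (P : Matrix (Fin n) (Fin n) ℝ) (k : ℕ) :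
    τ.cov P (k + 1) = τ.cov (τ.covStep P) k := by
  induction k with
  | zero => rfl
  | succ k ih => exact congrArg τ.covStep ih

theorem quad_cov_zero_monotone (hτ : τ.DelayFree) (x : Fin n → ℝ) :
    Monotone fun k => x ⬝ᵥ τ.cov 0 k *ᵥ x := by
  refine monotone_nat_of_le_succ fun k => ?_
  rw [cov_succ']
  refine τ.quad_cov_mono hτ PosSemidef.zero (τ.covStep_posSemidef PosSemidef.zero) (fun y => ?_) k x
  simpa using (τ.covStep_posSemidef PosSemidef.zero).quad_nonneg y

/-- The directions in which the covariances of the filter started from `0` stay bounded. -/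
def boundedDirections : Submodule ℝ (Fin n → ℝ) where
  carrier := {x | ∃ c, ∀ k, x ⬝ᵥ τ.cov 0 k *ᵥ x ≤ c}
  zero_mem' := ⟨0, by simp⟩
  add_mem' := by
    rintro x y ⟨c, hc⟩ ⟨d, hd⟩
    refine ⟨(1 + 1) * c + (1 + 1⁻¹) * d, fun k => ?_⟩
    refine (quad_add_le (τ.cov_posSemidef PosSemidef.zero k) one_pos x y).trans ?_
    have := hc k
    have := hd k
    linarith
  smul_mem' := by
    rintro r x ⟨c, hc⟩
    refine ⟨r ^ 2 * c, fun k => ?_⟩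
    have := mul_le_mul_of_nonneg_left (hc k) (sq_nonneg r)
    simp only [mulVec_smul, dotProduct_smul, smul_dotProduct, smul_eq_mul]
    linarith

/-- One step of the dual control problem: if some admissible decomposition `b + C₂ᵀ κ` leads to a
direction `Âᵀ b` of bounded covariance, then the direction itself has bounded covariance. -/
theorem mem_boundedDirections (hτ : τ.DelayFree) {b : Fin n → ℝ} (κ : Fin τ.t → ℝ)
    (hb : τ.G₂ᵀ *ᵥ b = 0) (hAb : τ.Ahatᵀ *ᵥ b ∈ τ.boundedDirections) :
    b + τ.C₂ᵀ *ᵥ κ ∈ τ.boundedDirections := by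
  obtain ⟨c, hc⟩ := hAb
  have hc0 : 0 ≤ c := by simpa [cov] using hc 0
  have e : b + τ.C₂ᵀ *ᵥ κ - τ.C₂ᵀ *ᵥ κ = b := by abel
  have h1 := τ.Qhat_posSemidef.quad_nonneg b
  have h2 := τ.R₂_posDef.posSemidef.quad_nonneg κ
  refine ⟨c + b ⬝ᵥ τ.Qhat *ᵥ b + κ ⬝ᵥ τ.R₂ *ᵥ κ, fun k => ?_⟩
  cases k with
  | zero => simp only [cov, zero_mulVec, dotProduct_zero]; linarith
  | succ k =>
    refine (τ.quad_covStep_le hτ (τ.cov_posSemidef PosSemidef.zero k) _ κ (by rwa [e])).trans ?_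
    rw [e, Ptilde, add_mulVec, dotProduct_add, quad_conj]
    linarith [hc k]

/-- A trajectory of `x ↦ (I - G₂ M C₂) Â x` inside the kernel of `C₂` is a trajectory of the model
with zero output, for a suitable unknown input. -/
theorem tendsto_zero_of_strongly_detectable (hS : S.StronglyDetectable)
    (M : Matrix (Fin τ.s) (Fin τ.t) ℝ) {x : ℕ → Fin n → ℝ}
    (hx : ∀ k, x (k + 1) = ((1 - τ.G₂ * M * τ.C₂) * τ.Ahat) *ᵥ x k)
    (hC : ∀ k, τ.C₂ *ᵥ x k = 0) : Tendsto x atTop (𝓝 0) := by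
  refine hS x (fun k => -(τ.V₁ *ᵥ (τ.M₁ *ᵥ (τ.C₁ *ᵥ x k)))
    - τ.V₂ *ᵥ (M *ᵥ (τ.C₂ *ᵥ (τ.Ahat *ᵥ x k)))) (fun k => ?_) (fun k => ?_)
  · rw [hx, ← mulVec_mulVec, sub_mulVec, one_mulVec, mulVec_sub, mulVec_neg]
    nth_rewrite 1 [Ahat]
    simp only [sub_mulVec, ← mulVec_mulVec, G₁, G₂]
    abel
  · have hσ : diagonal τ.σ * τ.M₁ = 1 := by
      rw [M₁, mul_nonsing_inv]
      rw [det_diagonal]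
      exact (Finset.prod_pos fun i _ => τ.σ_pos i).ne'.isUnit
    have h1 : τ.V₁ᵀ *ᵥ (-(τ.V₁ *ᵥ (τ.M₁ *ᵥ (τ.C₁ *ᵥ x k)))
        - τ.V₂ *ᵥ (M *ᵥ (τ.C₂ *ᵥ (τ.Ahat *ᵥ x k)))) = -(τ.M₁ *ᵥ (τ.C₁ *ᵥ x k)) := by
      rw [mulVec_sub, mulVec_neg, mulVec_mulVec _ τ.V₁ᵀ τ.V₁, τ.V₁_orth, one_mulVec,
        mulVec_mulVec _ τ.V₁ᵀ τ.V₂, τ.V₁₂_orth, zero_mulVec, sub_zero]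
    have h2 : τ.U₂ᵀ *ᵥ (S.C *ᵥ x k) = 0 := by
      have := hC k
      rwa [C₂, T₂, ← mulVec_mulVec] at this
    have h3 : τ.C₁ *ᵥ x k = τ.U₁ᵀ *ᵥ (S.C *ᵥ x k) := by
      rw [C₁, T₁, ← mulVec_mulVec, sub_mulVec, ← mulVec_mulVec _ _ τ.U₂ᵀ, h2, mulVec_zero, sub_zero]
    rw [τ.H_eq, ← mulVec_mulVec, h1, ← mulVec_mulVec, mulVec_neg, mulVec_mulVec _ (diagonal τ.σ),
      hσ, one_mulVec, h3, mulVec_neg]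
    have h4 : S.C *ᵥ x k = τ.U₁ *ᵥ (τ.U₁ᵀ *ᵥ (S.C *ᵥ x k)) + τ.U₂ *ᵥ (τ.U₂ᵀ *ᵥ (S.C *ᵥ x k)) := by
      rw [mulVec_mulVec _ τ.U₁, mulVec_mulVec _ τ.U₂, ← add_mulVec, τ.U_complete, one_mulVec]
    rw [h2, mulVec_zero, add_zero] at h4
    rw [← h4, add_neg_cancel]

/-- Strong detectability bounds the covariances. On the orthogonal complement of the bounded
directions the map `(I - G₂ M C₂) Â` is invertible and unobservable, so it is stable there; then its
transpose carries the bound to every direction. -/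
theorem boundedDirections_eq_top (hS : S.StronglyDetectable) (hτ : τ.DelayFree) (x : Fin n → ℝ) :
    x ∈ τ.boundedDirections := by
  obtain ⟨Φ, hΦt, hΦΦ, hker⟩ := exists_projection_of_submodule τ.boundedDirections
  set M := τ.M₂ 0 with hM
  have hME : M * (τ.C₂ * τ.G₂) = 1 := τ.M₂_mul hτ PosSemidef.zero
  set K := τ.G₂ * M with hK
  have hKE : K * (τ.C₂ * τ.G₂) = τ.G₂ := by rw [hK, Matrix.mul_assoc, hME, Matrix.mul_one]
  set At := τ.errorMap K with hAt
  -- the complement of the bounded directions is unobservable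
  have hCΦ : τ.C₂ * Φ = 0 := by
    have h1 : Φ * τ.C₂ᵀ = 0 := by
      refine Matrix.ext_of_mulVec_single fun j => ?_
      rw [← mulVec_mulVec, zero_mulVec, hker]
      simpa using τ.mem_boundedDirections hτ (b := 0) (Pi.single j 1) (by simp) (by simp)
    have := congrArg transpose h1
    rwa [transpose_mul, transpose_transpose, hΦt, transpose_zero] at this
  -- the dual of `mem_boundedDirections`: `b` with `G₂ᵀ b = 0` and `Φ Âᵀ b = 0` satisfies `Φ b = 0`,
  -- so the range of `Φ` lies in that of `(I - G₂ M C₂) Â Φ`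
  have hsurj : ∀ v, ∃ c, Φ *ᵥ v = (At * Φ) *ᵥ c := by
    intro v
    obtain ⟨c, hc⟩ := exists_eq_transpose_mulVec (X := fromRows τ.G₂ᵀ (Φ * τ.Ahatᵀ))
      (w := Φ *ᵥ v) (fun b hb => by
        rw [fromRows_mulVec] at hb
        have hb1 : τ.G₂ᵀ *ᵥ b = 0 := funext fun i => congrFun hb (Sum.inl i)
        have hb2 : (Φ * τ.Ahatᵀ) *ᵥ b = 0 := funext fun i => congrFun hb (Sum.inr i)
        rw [← mulVec_mulVec, hker] at hb2
        have hb3 := τ.mem_boundedDirections hτ 0 hb1 hb2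
        rw [mulVec_zero, add_zero, ← hker] at hb3
        rw [dotProduct_comm, dotProduct_mulVec, ← mulVec_transpose, hΦt, hb3, zero_dotProduct])
    rw [transpose_fromRows, transpose_transpose, transpose_mul, transpose_transpose, hΦt,
      fromCols_mulVec] at hc
    refine ⟨c ∘ Sum.inr, ?_⟩
    have h1 : (1 - K * τ.C₂) *ᵥ (Φ *ᵥ v) = Φ *ᵥ v := by
      rw [sub_mulVec, one_mulVec, ← mulVec_mulVec, mulVec_mulVec _ τ.C₂, hCΦ, zero_mulVec,
        mulVec_zero, sub_zero]
    have h2 : (1 - K * τ.C₂) * τ.G₂ = 0 := by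
      rw [Matrix.sub_mul, Matrix.one_mul, Matrix.mul_assoc, hKE, sub_self]
    rw [← h1, hc, mulVec_add, mulVec_mulVec, h2, zero_mulVec, zero_add, mulVec_mulVec, hAt,
      errorMap, ← Matrix.mul_assoc]
  set T := At * Φ with hT
  -- by dimension count the two ranges agree, so `T` maps the range of `Φ` into itself
  have hΦT : Φ * T = T := by
    have hle : Φ.mulVecLin.range ≤ T.mulVecLin.range := by
      rintro _ ⟨v, rfl⟩
      obtain ⟨c, hc⟩ := hsurj v
      exact ⟨c, hc.symm⟩
    have hrank : Module.finrank ℝ T.mulVecLin.range ≤ Module.finrank ℝ Φ.mulVecLin.range :=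
      rank_mul_le_right At Φ
    have heq := Submodule.eq_of_le_of_finrank_le hle hrank
    refine Matrix.ext_of_mulVec_single fun j => ?_
    have : T.mulVecLin (Pi.single j 1) ∈ Φ.mulVecLin.range := heq ▸ ⟨_, rfl⟩
    obtain ⟨v, hv⟩ := this
    simp only [mulVecLin_apply] at hv
    rw [← mulVec_mulVec, ← hv, mulVec_mulVec, hΦΦ]
  have hpowΦ : ∀ k, Φ * (T ^ k * Φ) = T ^ k * Φ := by
    intro k
    cases k with
    | zero => rw [pow_zero, Matrix.one_mul, hΦΦ]
    | succ k => rw [pow_succ', ← Matrix.mul_assoc, ← Matrix.mul_assoc, hΦT]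
  have hlim : Tendsto (fun k => T ^ k * Φ) atTop (𝓝 0) := by
    have hcol : ∀ v, Tendsto (fun k => (T ^ k * Φ) *ᵥ v) atTop (𝓝 0) := by
      intro v
      refine τ.tendsto_zero_of_strongly_detectable hS M (fun k => ?_) (fun k => ?_)
      · have h1 : T ^ (k + 1) * Φ = At * (T ^ k * Φ) := by
          rw [pow_succ', Matrix.mul_assoc, hT, Matrix.mul_assoc, ← hT, hpowΦ]
        rw [h1, ← mulVec_mulVec]; rfl
      · rw [← hpowΦ, mulVec_mulVec, ← Matrix.mul_assoc, hCΦ, Matrix.zero_mul, zero_mulVec]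
    refine tendsto_matrix_iff.2 fun i j => ?_
    have := (tendsto_pi_nhds.1 (hcol (Pi.single j 1))) i
    simpa using this
  have hTstable : PowerStable T := by
    have h1 : Tendsto (fun k => T ^ k * Φ * T) atTop (𝓝 0) := by
      simpa using tendsto_matrix_mul hlim (tendsto_const_nhds (x := T))
    refine (tendsto_add_atTop_iff_nat 1).1 (h1.congr fun k => ?_)
    rw [Matrix.mul_assoc, hΦT, pow_succ]
  -- uniform bound on the bounded directions
  have hp := fun k => τ.cov_posSemidef (P := 0) PosSemidef.zero k
  obtain ⟨c₁, hc₁⟩ : ∃ c₁, ∀ k y,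
      ((1 - Φ) *ᵥ y) ⬝ᵥ τ.cov 0 k *ᵥ ((1 - Φ) *ᵥ y) ≤ c₁ * ‖y‖ ^ 2 := by
    have hsym : (1 - Φ)ᵀ = 1 - Φ := by rw [transpose_sub, transpose_one, hΦt]
    have hq : ∀ k y, y ⬝ᵥ ((1 - Φ) * τ.cov 0 k * (1 - Φ)) *ᵥ y
        = ((1 - Φ) *ᵥ y) ⬝ᵥ τ.cov 0 k *ᵥ ((1 - Φ) *ᵥ y) := by
      intro k y
      have := quad_conj (1 - Φ) (τ.cov 0 k) y
      rwa [hsym] at this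
    obtain ⟨L, hL⟩ := exists_tendsto_of_quad
      (P := fun k => (1 - Φ) * τ.cov 0 k * (1 - Φ)) (fun k => by
        rw [transpose_mul, transpose_mul, hsym, (hp k).transpose_eq, Matrix.mul_assoc])
      (fun y => by
        have hmem : (1 - Φ) *ᵥ y ∈ τ.boundedDirections := by
          rw [← hker, mulVec_mulVec, Matrix.mul_sub, Matrix.mul_one, hΦΦ, sub_self, zero_mulVec]
        obtain ⟨c, hc⟩ := hmem
        refine ⟨_, tendsto_atTop_ciSup (f := fun k => y ⬝ᵥ ((1 - Φ) * τ.cov 0 k * (1 - Φ)) *ᵥ y)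
          ?_ ⟨c, ?_⟩⟩
        · simp only [hq]; exact τ.quad_cov_zero_monotone hτ _
        · rintro _ ⟨k, rfl⟩; simp only [hq]; exact hc k)
    have hcont : Continuous fun N : Matrix (Fin n) (Fin n) ℝ => ∑ i, ∑ j, |N i j| := by fun_prop
    obtain ⟨c₁, hc₁⟩ := ((hcont.tendsto L).comp hL).bddAbove_range
    refine ⟨c₁, fun k y => ?_⟩
    rw [← hq]
    exact (quad_le_norm _ y).trans
      (mul_le_mul_of_nonneg_right (hc₁ ⟨k, rfl⟩) (sq_nonneg _))
  obtain ⟨N, c, ρ, -, hρ0, hρ, -, hN1, -, -, hN4⟩ := hTstable.transpose.exists_norm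
  set ε := 1 - ρ with hε
  have hε0 : 0 < ε := by linarith
  -- the one-step inequality for the quadratic forms
  obtain ⟨D, hD0, hD⟩ : ∃ D, 0 ≤ D ∧ ∀ k y, y ⬝ᵥ τ.cov 0 (k + 1) *ᵥ y
      ≤ D * ‖y‖ ^ 2 + (1 + ε) * ((Tᵀ *ᵥ y) ⬝ᵥ τ.cov 0 k *ᵥ (Tᵀ *ᵥ y)) := by
    set a₁ := ∑ i, ∑ j, |τ.errorNoise K i j| with ha₁
    set a₂ := ∑ i, ∑ j, |Atᵀ i j| with ha₂
    have ha₁0 : 0 ≤ a₁ := by positivity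
    have ha₂0 : 0 ≤ a₂ := by positivity
    refine ⟨a₁ + (1 + ε⁻¹) * (|c₁| * a₂ ^ 2), by positivity, fun k y => ?_⟩
    have h1 := τ.quad_covStep_le_gain hτ (hp k) hKE y
    rw [add_mulVec, dotProduct_add, quad_conj] at h1
    have h2 := quad_le_norm (τ.errorNoise K) y
    have h3 : Atᵀ *ᵥ y = Tᵀ *ᵥ y + (1 - Φ) *ᵥ (Atᵀ *ᵥ y) := by
      rw [hT, transpose_mul, hΦt, ← mulVec_mulVec, sub_mulVec, one_mulVec]; abel
    have h4 := quad_add_le (hp k) hε0 (Tᵀ *ᵥ y) ((1 - Φ) *ᵥ (Atᵀ *ᵥ y))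
    rw [← h3] at h4
    have h5 := hc₁ k (Atᵀ *ᵥ y)
    have h6 : c₁ * ‖Atᵀ *ᵥ y‖ ^ 2 ≤ |c₁| * a₂ ^ 2 * ‖y‖ ^ 2 := by
      have h7 := pow_le_pow_left₀ (norm_nonneg _) (norm_mulVec_le Atᵀ y) 2
      calc c₁ * ‖Atᵀ *ᵥ y‖ ^ 2 ≤ |c₁| * ‖Atᵀ *ᵥ y‖ ^ 2 :=
            mul_le_mul_of_nonneg_right (le_abs_self _) (sq_nonneg _)
        _ ≤ |c₁| * (a₂ * ‖y‖) ^ 2 := mul_le_mul_of_nonneg_left h7 (abs_nonneg _)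
        _ = _ := by ring
    have h8 := mul_le_mul_of_nonneg_left (h5.trans h6)
      (show 0 ≤ 1 + ε⁻¹ by positivity)
    change y ⬝ᵥ τ.covStep (τ.cov 0 k) *ᵥ y ≤ _
    linarith
  have hNn : ∀ y, ‖y‖ ^ 2 ≤ N y ^ 2 := fun y => pow_le_pow_left₀ (norm_nonneg _) (hN1 y) 2
  have hbound : ∀ k y, y ⬝ᵥ τ.cov 0 k *ᵥ y ≤ D / (1 - ρ) * N y ^ 2 := by
    intro k
    induction k with
    | zero =>
      intro y
      simp only [cov, zero_mulVec, dotProduct_zero]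
      exact mul_nonneg (div_nonneg hD0 hε0.le) (sq_nonneg _)
    | succ k ih =>
      intro y
      have h1 := hD k y
      have h2 := ih (Tᵀ *ᵥ y)
      have h0 : 0 ≤ N (Tᵀ *ᵥ y) := (norm_nonneg _).trans (hN1 _)
      have h3 := pow_le_pow_left₀ h0 (hN4 y) 2
      have hB : 0 ≤ D / (1 - ρ) := div_nonneg hD0 hε0.le
      have h4 : (1 + ε) * (D / (1 - ρ) * N (Tᵀ *ᵥ y) ^ 2) ≤ D / (1 - ρ) * (ρ * N y ^ 2) := by
        -- `ε = 1 - ρ` makes `(1 + ε) ρ² = (2 - ρ) ρ ρ ≤ ρ`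
        have h5 : (1 + ε) * N (Tᵀ *ᵥ y) ^ 2 ≤ ρ * N y ^ 2 := by
          calc (1 + ε) * N (Tᵀ *ᵥ y) ^ 2 ≤ (1 + ε) * (ρ * N y) ^ 2 :=
                mul_le_mul_of_nonneg_left h3 (by linarith)
            _ = ((2 - ρ) * ρ) * (ρ * N y ^ 2) := by rw [hε]; ring
            _ ≤ 1 * (ρ * N y ^ 2) := by
                refine mul_le_mul_of_nonneg_right ?_ (by positivity)
                nlinarith [sq_nonneg (1 - ρ)]
            _ = _ := one_mul _
        calc _ = D / (1 - ρ) * ((1 + ε) * N (Tᵀ *ᵥ y) ^ 2) := by ring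
          _ ≤ _ := mul_le_mul_of_nonneg_left h5 hB
      have h6 := mul_le_mul_of_nonneg_left h2 (show 0 ≤ 1 + ε by linarith)
      have h7 := mul_le_mul_of_nonneg_left (hNn y) hD0
      have h8 : D * N y ^ 2 + D / (1 - ρ) * (ρ * N y ^ 2) = D / (1 - ρ) * N y ^ 2 := by
        have : (1 - ρ) ≠ 0 := hε0.ne'
        field_simp; ring
      linarith
  exact ⟨_, fun k => hbound k x⟩

/-- Started from `0`, the covariances increase and are bounded, so they converge to a fixed point of the
Riccati recursion. -/
theorem exists_tendsto_cov_zero (hS : S.StronglyDetectable) (hτ : τ.DelayFree) :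
    ∃ P, P.PosSemidef ∧ τ.covStep P = P ∧ Tendsto (τ.cov 0) atTop (𝓝 P) := by
  have hp := fun k => τ.cov_posSemidef (P := 0) PosSemidef.zero k
  obtain ⟨P, hP⟩ := exists_tendsto_of_quad (fun k => (hp k).transpose_eq) fun x => by
    obtain ⟨c, hc⟩ := τ.boundedDirections_eq_top hS hτ x
    exact ⟨_, tendsto_atTop_ciSup (τ.quad_cov_zero_monotone hτ x)
      ⟨c, by rintro _ ⟨k, rfl⟩; exact hc k⟩⟩
  have hPs := posSemidef_of_tendsto hP hp
  exact ⟨P, hPs, tendsto_nhds_unique (τ.tendsto_covStep hτ hPs hp hP)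
    ((tendsto_add_atTop_iff_nat 1).2 hP), hP⟩

/-- A direction that no noise excites in the closed loop is not reached by the unknown input nor by
the process noise, and the filter does not act on it. -/
theorem unexcited_direction {K : Matrix (Fin n) (Fin τ.t) ℝ}
    (hK : K * (τ.C₂ * τ.G₂) = τ.G₂) {x : Fin n → ℝ} (hx : x ⬝ᵥ τ.errorNoise K *ᵥ x = 0) :
    S.Q *ᵥ x = 0 ∧ S.Gᵀ *ᵥ x = 0 ∧ (τ.errorMap K)ᵀ *ᵥ x = S.Aᵀ *ᵥ x := by
  rw [errorNoise, add_mulVec, dotProduct_add, quad_conj, quad_conj] at hx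
  have h1 := τ.Qhat_posSemidef.quad_nonneg ((1 - K * τ.C₂)ᵀ *ᵥ x)
  have h2 := τ.R₂_posDef.posSemidef.quad_nonneg (Kᵀ *ᵥ x)
  have hKx : Kᵀ *ᵥ x = 0 := by
    by_contra hne
    have := τ.R₂_posDef.dotProduct_mulVec_pos hne
    rw [star_trivial] at this
    linarith
  have hFx : (1 - K * τ.C₂)ᵀ *ᵥ x = x := by
    rw [transpose_sub, transpose_one, sub_mulVec, one_mulVec, transpose_mul, ← mulVec_mulVec, hKx,
      mulVec_zero, sub_zero]
  have hQ : x ⬝ᵥ τ.Qhat *ᵥ x = 0 := by rw [hFx] at hx h1; linarith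
  have hQ' : τ.Qhat = (τ.G₁ * τ.M₁) * τ.R₁ * (τ.G₁ * τ.M₁)ᵀ + S.Q := by
    rw [Qhat, transpose_mul]; simp only [Matrix.mul_assoc]
  rw [hQ', add_mulVec, dotProduct_add, quad_conj] at hQ
  have h3 := S.posSemidef_Q.quad_nonneg x
  have h4 := τ.R₁_posDef.posSemidef.quad_nonneg ((τ.G₁ * τ.M₁)ᵀ *ᵥ x)
  have hG₁M : (τ.G₁ * τ.M₁)ᵀ *ᵥ x = 0 := by
    by_contra hne
    have := τ.R₁_posDef.dotProduct_mulVec_pos hne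
    rw [star_trivial] at this
    linarith
  have hQx : S.Q *ᵥ x = 0 := by
    rw [← S.posSemidef_Q.dotProduct_mulVec_zero_iff, star_trivial]
    linarith
  have hσ : diagonal τ.σ * τ.M₁ᵀ = 1 := by
    rw [M₁, transpose_nonsing_inv, diagonal_transpose, mul_nonsing_inv]
    rw [det_diagonal]
    exact (Finset.prod_pos fun i _ => τ.σ_pos i).ne'.isUnit
  have hG₁ : τ.G₁ᵀ *ᵥ x = 0 := by
    have := congrArg (diagonal τ.σ *ᵥ ·) hG₁M
    simpa only [transpose_mul, mulVec_mulVec, ← Matrix.mul_assoc, hσ, Matrix.one_mul,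
      mulVec_zero] using this
  have hG₂ : τ.G₂ᵀ *ᵥ x = 0 := by
    rw [← hK, transpose_mul, ← mulVec_mulVec, hKx, mulVec_zero]
  refine ⟨hQx, ?_, ?_⟩
  · have h5 : S.Gᵀ *ᵥ x = τ.V₁ *ᵥ (τ.G₁ᵀ *ᵥ x) + τ.V₂ *ᵥ (τ.G₂ᵀ *ᵥ x) := by
      rw [G₁, G₂, transpose_mul, transpose_mul, mulVec_mulVec, mulVec_mulVec, ← add_mulVec,
        ← Matrix.mul_assoc, ← Matrix.mul_assoc, ← Matrix.add_mul, τ.V_complete, Matrix.one_mul]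
    rw [h5, hG₁, hG₂, mulVec_zero, mulVec_zero, add_zero]
  · rw [errorMap, transpose_mul, ← mulVec_mulVec, hFx, Ahat, transpose_sub, sub_mulVec,
      transpose_mul _ τ.C₁, ← mulVec_mulVec _ _ (τ.G₁ * τ.M₁)ᵀ, hG₁M, mulVec_zero, sub_zero]

/-- At a fixed point of the Riccati recursion the filter is stable: for a left eigenvector of the
error transition matrix with an eigenvalue outside the open unit disc, the fixed-point equation
leaves no room for noise, so it is an eigenvector of the model that stabilizability excludes. -/
theorem isStable_errorMap (hS : S.Stabilizable) (hτ : τ.DelayFree)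
    {P : Matrix (Fin n) (Fin n) ℝ} (hP : P.PosSemidef) (hfix : τ.covStep P = P) :
    IsStable (τ.errorMap (τ.gain P)) := by
  obtain ⟨K₁, K₂, hstab⟩ := hS
  intro z hz
  by_contra hz1
  obtain ⟨x, y, hxy, hx, hy⟩ := (mem_spectrum_map_iff _ z).1 hz
  have hqx := τ.quad_covStep P x
  have hqy := τ.quad_covStep P y
  rw [hfix, hx, sub_eq_add_neg, ← neg_smul, quad_add _ hP.transpose_eq] at hqx
  rw [hfix, hy, quad_add _ hP.transpose_eq] at hqy
  simp only [mulVec_smul, dotProduct_smul, smul_dotProduct, smul_eq_mul] at hqx hqy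
  have hNx := (τ.errorNoise_posSemidef (τ.gain P)).quad_nonneg x
  have hNy := (τ.errorNoise_posSemidef (τ.gain P)).quad_nonneg y
  have hPx := hP.quad_nonneg x
  have hPy := hP.quad_nonneg y
  have hzz : 1 ≤ z.re ^ 2 + z.im ^ 2 := by
    have h1 := Complex.sq_norm z
    rw [Complex.normSq_apply] at h1
    have h2 : 1 ≤ ‖z‖ := not_lt.1 hz1
    nlinarith
  -- summed over real and imaginary part, the fixed-point equation says that the noise terms equal
  -- `-(|z|² - 1)` times a nonnegative number, so both vanish
  have hprod : 0 ≤ (z.re ^ 2 + z.im ^ 2 - 1) * (x ⬝ᵥ P *ᵥ x + y ⬝ᵥ P *ᵥ y) :=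
    mul_nonneg (by linarith) (by linarith)
  have hsum : x ⬝ᵥ τ.errorNoise (τ.gain P) *ᵥ x + y ⬝ᵥ τ.errorNoise (τ.gain P) *ᵥ y
      = -((z.re ^ 2 + z.im ^ 2 - 1) * (x ⬝ᵥ P *ᵥ x + y ⬝ᵥ P *ᵥ y)) := by linarith
  obtain ⟨hQx, hGx, hAx⟩ := τ.unexcited_direction (τ.gain_mul hτ hP)
    (show x ⬝ᵥ τ.errorNoise (τ.gain P) *ᵥ x = 0 by linarith)
  obtain ⟨hQy, hGy, hAy⟩ := τ.unexcited_direction (τ.gain_mul hτ hP)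
    (show y ⬝ᵥ τ.errorNoise (τ.gain P) *ᵥ y = 0 by linarith)
  have key : ∀ x, S.Q *ᵥ x = 0 → S.Gᵀ *ᵥ x = 0 →
      (S.A + S.G * K₁ + S.Q * K₂)ᵀ *ᵥ x = S.Aᵀ *ᵥ x := by
    intro x hQ hG
    rw [transpose_add, transpose_add, transpose_mul, transpose_mul, add_mulVec, add_mulVec,
      ← mulVec_mulVec, ← mulVec_mulVec, hG, S.posSemidef_Q.transpose_eq, hQ, mulVec_zero,
      mulVec_zero, add_zero, add_zero]
  refine hz1 (hstab z ((mem_spectrum_map_iff _ z).2 ⟨x, y, hxy, ?_, ?_⟩))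
  · rw [key x hQx hGx, ← hAx, hx]
  · rw [key y hQy hGy, ← hAy, hy]

/-- From every initial covariance the Riccati recursion converges to a stabilizing fixed point: it
is squeezed between the recursion from `0` and the recursion with the steady-state gain. -/
theorem exists_tendsto_cov (hS : S.StronglyDetectable) (hS' : S.Stabilizable) (hτ : τ.DelayFree)
    {P₀ : Matrix (Fin n) (Fin n) ℝ} (hP₀ : P₀.PosSemidef) :
    ∃ P, P.PosSemidef ∧ Tendsto (τ.cov P₀) atTop (𝓝 P) ∧ IsStable (τ.errorMap (τ.gain P)) := by
  obtain ⟨P, hP, hfix, hlim⟩ := τ.exists_tendsto_cov_zero hS hτ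
  have hst := τ.isStable_errorMap hS' hτ hP hfix
  refine ⟨P, hP, ?_, hst⟩
  set F := τ.errorMap (τ.gain P) with hF
  set N := τ.errorNoise (τ.gain P) with hN
  have hup : Tendsto (fun k => (fun Y => F * Y * Fᵀ + N)^[k] P₀) atTop (𝓝 P) :=
    hst.powerStable.tendsto_lyapunov (by rw [hF, hN, ← covStep_eq, hfix]) P₀
  have hle : ∀ k x, x ⬝ᵥ τ.cov P₀ k *ᵥ x ≤ x ⬝ᵥ (fun Y => F * Y * Fᵀ + N)^[k] P₀ *ᵥ x := by
    intro k
    induction k with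
    | zero => exact fun x => le_rfl
    | succ k ih =>
      intro x
      refine (τ.quad_covStep_le_gain hτ (τ.cov_posSemidef hP₀ k) (τ.gain_mul hτ hP) x).trans ?_
      rw [Function.iterate_succ_apply', add_mulVec, add_mulVec, dotProduct_add, dotProduct_add,
        quad_conj, quad_conj]
      gcongr
      exact ih _
  refine tendsto_of_quad (fun k => (τ.cov_posSemidef hP₀ k).transpose_eq) hP.transpose_eq
    fun x => tendsto_of_tendsto_of_tendsto_of_le_of_le (tendsto_quad hlim x) (tendsto_quad hup x)
      (fun k => τ.quad_cov_mono hτ PosSemidef.zero hP₀ (fun y => ?_) k x) (fun k => hle k x)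
  simpa using hP₀.quad_nonneg y

end Model.SVD

/-! ### Limits of correlations -/

theorem avg_sum {κ : Type*} (s : Finset κ) (f : κ → ℕ → ℝ) (K : ℕ) :
    avg (fun k => ∑ p ∈ s, f p k) K = ∑ p ∈ s, avg (f p) K := by
  simp only [avg]
  rw [Finset.sum_comm, Finset.mul_sum]

theorem abs_avg_le (f : ℕ → ℝ) (K : ℕ) : |avg f K| ≤ avg (fun k => |f k|) K := by
  rw [avg, abs_mul, abs_of_nonneg (by positivity : (0 : ℝ) ≤ (K : ℝ)⁻¹)]
  exact mul_le_mul_of_nonneg_left (Finset.abs_sum_le_sum_abs _ _) (by positivity)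

theorem tendsto_avg_mul_zero {e f : ℕ → ℝ} {c : ℝ} (he : Tendsto e atTop (𝓝 0))
    (hf : ∀ k, 0 ≤ f k) (hc : Tendsto (avg f) atTop (𝓝 c)) :
    Tendsto (avg fun k => e k * f k) atTop (𝓝 0) := by
  rw [Metric.tendsto_atTop]
  intro ε hε
  have hc0 : 0 ≤ c := ge_of_tendsto' hc (avg_nonneg hf)
  set δ := ε / (2 * (c + 1)) with hδ
  have hδ0 : 0 < δ := by positivity
  obtain ⟨k₀, hk₀⟩ := (Metric.tendsto_atTop.1 he) δ hδ0
  set h : ℕ → ℝ := fun k => if k < k₀ then |e k * f k| else 0 with hh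
  have hh0 : Tendsto (avg h) atTop (𝓝 0) := by
    refine tendsto_avg_of_tendsto (tendsto_const_nhds.congr' ?_)
    filter_upwards [eventually_ge_atTop k₀] with k hk
    simp [hh, not_lt.2 hk]
  have hle : ∀ k, |e k * f k| ≤ h k + δ * f k := by
    intro k
    by_cases hk : k < k₀
    · have := mul_nonneg hδ0.le (hf k)
      simp only [hh, hk, if_true]; linarith
    · have h1 := hk₀ k (not_lt.1 hk)
      rw [Real.dist_eq, sub_zero] at h1
      simp only [hh, hk, if_false, zero_add, abs_mul, abs_of_nonneg (hf k)]
      exact mul_le_mul_of_nonneg_right h1.le (hf k)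
  have hlim : Tendsto (fun K => avg h K + δ * avg f K) atTop (𝓝 (0 + δ * c)) :=
    hh0.add (hc.const_mul δ)
  have hlt : 0 + δ * c < ε := by
    rw [hδ, zero_add, div_mul_eq_mul_div, div_lt_iff₀ (by positivity)]
    nlinarith
  obtain ⟨K₀, hK₀⟩ := eventually_atTop.1 (hlim.eventually (gt_mem_nhds hlt))
  refine ⟨K₀, fun K hK => ?_⟩
  rw [Real.dist_eq, sub_zero]
  refine ((abs_avg_le _ K).trans (avg_mono hle K)).trans_lt ?_
  rw [avg_add, avg_const_mul]
  exact hK₀ K hK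

/-- The limit form of the Cauchy–Schwarz inequality, from its weighted arithmetic-geometric form. -/
theorem tendsto_zero_of_weighted_bound {x g z : ℕ → ℝ} {c : ℝ} (hx : Tendsto x atTop (𝓝 c))
    (hg : Tendsto g atTop (𝓝 0)) (h : ∀ t > 0, ∀ k, |z k| ≤ t * x k + t⁻¹ * g k) :
    Tendsto z atTop (𝓝 0) := by
  rw [Metric.tendsto_atTop]
  intro ε hε
  set t := ε / (2 * (|c| + 1)) with ht
  have ht0 : 0 < t := by positivity
  have hlim : Tendsto (fun k => t * x k + t⁻¹ * g k) atTop (𝓝 (t * c + t⁻¹ * 0)) :=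
    (hx.const_mul t).add (hg.const_mul t⁻¹)
  have hlt : t * c + t⁻¹ * 0 < ε := by
    have h1 : t * c ≤ t * |c| := mul_le_mul_of_nonneg_left (le_abs_self c) ht0.le
    have h2 : t * |c| < ε := by
      rw [ht, div_mul_eq_mul_div, div_lt_iff₀ (by positivity)]
      nlinarith [abs_nonneg c]
    linarith
  obtain ⟨K₀, hK₀⟩ := eventually_atTop.1 (hlim.eventually (gt_mem_nhds hlt))
  refine ⟨K₀, fun k hk => ?_⟩
  rw [Real.dist_eq, sub_zero]
  exact (h t ht0 k).trans_lt (hK₀ k hk)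

theorem abs_mul_le_weighted {t : ℝ} (ht : 0 < t) (x y : ℝ) :
    |x * y| ≤ t * (x * x) + t⁻¹ * (y * y) := by
  have h1 : t⁻¹ * (t * |x| - |y|) ^ 2 = t * (x * x) - 2 * |x * y| + t⁻¹ * (y * y) := by
    rw [abs_mul, sub_sq, mul_pow, sq_abs, sq_abs]; field_simp
  have h2 : 0 ≤ t⁻¹ * (t * |x| - |y|) ^ 2 := by positivity
  have h3 := abs_nonneg (x * y)
  linarith

variable {Ω : Type*} [MeasurableSpace Ω] {μ : Measure Ω}

/-- Two square integrable processes have limit correlation `c` if the expectations of their products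
converge to `c` and so do, almost surely, the time averages of their products. -/
structure LimCorr (μ : Measure Ω) (X Y : ℕ → Ω → ℝ) (c : ℝ) : Prop where
  memLp_left : ∀ k, MemLp (X k) 2 μ
  memLp_right : ∀ k, MemLp (Y k) 2 μ
  tendsto_integral : Tendsto (fun k => ∫ ω, X k ω * Y k ω ∂μ) atTop (𝓝 c)
  tendsto_avg : ∀ᵐ ω ∂μ, Tendsto (avg fun k => X k ω * Y k ω) atTop (𝓝 c)

theorem integrable_mul_of_memLp_two {X Y : Ω → ℝ} (hX : MemLp X 2 μ) (hY : MemLp Y 2 μ) :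
    Integrable (fun ω => X ω * Y ω) μ := hX.integrable_mul hY

namespace LimCorr

variable {X Y Z : ℕ → Ω → ℝ} {c d : ℝ}

theorem symm (h : LimCorr μ X Y c) : LimCorr μ Y X c where
  memLp_left := h.memLp_right
  memLp_right := h.memLp_left
  tendsto_integral := by simpa only [mul_comm] using h.tendsto_integral
  tendsto_avg := by simpa only [mul_comm] using h.tendsto_avg

theorem sum {κ ι : Type*} [Fintype κ] [Fintype ι] {X : κ → ℕ → Ω → ℝ} {Y : ι → ℕ → Ω → ℝ}
    {c : κ → ι → ℝ} (hX : ∀ p k, MemLp (X p k) 2 μ) (hY : ∀ q k, MemLp (Y q k) 2 μ)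
    (h : ∀ p q, LimCorr μ (X p) (Y q) (c p q)) :
    LimCorr μ (fun k ω => ∑ p, X p k ω) (fun k ω => ∑ q, Y q k ω) (∑ p, ∑ q, c p q) where
  memLp_left k := memLp_finsetSum _ fun p _ => hX p k
  memLp_right k := memLp_finsetSum _ fun q _ => hY q k
  tendsto_integral := by
    refine (tendsto_finsetSum _ fun p _ => tendsto_finsetSum _ fun q _ =>
      (h p q).tendsto_integral).congr fun k => ?_
    simp only [Finset.sum_mul_sum]
    have hint : ∀ p q, Integrable (fun ω => X p k ω * Y q k ω) μ := fun p q =>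
      integrable_mul_of_memLp_two (hX p k) (hY q k)
    rw [integral_finsetSum _ fun p _ => integrable_finsetSum _ fun q _ => hint p q]
    exact Finset.sum_congr rfl fun p _ => (integral_finsetSum _ fun q _ => hint p q).symm
  tendsto_avg := by
    have hae : ∀ᵐ ω ∂μ, ∀ p q, Tendsto (avg fun k => X p k ω * Y q k ω) atTop (𝓝 (c p q)) :=
      ae_all_iff.2 fun p => ae_all_iff.2 fun q => (h p q).tendsto_avg
    filter_upwards [hae] with ω hω
    refine (tendsto_finsetSum _ fun p _ => tendsto_finsetSum _ fun q _ => hω p q).congr fun K => ?_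
    simp only [Finset.sum_mul_sum, avg_sum]

theorem add_left (h₁ : LimCorr μ X Z c) (h₂ : LimCorr μ Y Z d) :
    LimCorr μ (fun k ω => X k ω + Y k ω) Z (c + d) where
  memLp_left k := (h₁.memLp_left k).add (h₂.memLp_left k)
  memLp_right := h₁.memLp_right
  tendsto_integral := by
    refine (h₁.tendsto_integral.add h₂.tendsto_integral).congr fun k => ?_
    simp only [add_mul]
    exact (integral_add (integrable_mul_of_memLp_two (h₁.memLp_left k) (h₁.memLp_right k))
      (integrable_mul_of_memLp_two (h₂.memLp_left k) (h₂.memLp_right k))).symm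
  tendsto_avg := by
    filter_upwards [h₁.tendsto_avg, h₂.tendsto_avg] with ω hω₁ hω₂
    refine (hω₁.add hω₂).congr fun K => ?_
    simp only [add_mul, avg_add]

theorem const_mul_left (h : LimCorr μ X Y c) (r : ℝ) :
    LimCorr μ (fun k ω => r * X k ω) Y (r * c) where
  memLp_left k := (h.memLp_left k).const_mul r
  memLp_right := h.memLp_right
  tendsto_integral := by
    refine (h.tendsto_integral.const_mul r).congr fun k => ?_
    simp only [mul_assoc, integral_const_mul]
  tendsto_avg := by
    filter_upwards [h.tendsto_avg] with ω hω
    refine (hω.const_mul r).congr fun K => ?_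
    simp only [mul_assoc, avg_const_mul]

theorem zero_right_of_self (hX : LimCorr μ X X c) (hY : LimCorr μ Y Y 0) : LimCorr μ X Y 0 where
  memLp_left := hX.memLp_left
  memLp_right := hY.memLp_left
  tendsto_integral := by
    refine tendsto_zero_of_weighted_bound hX.tendsto_integral hY.tendsto_integral
      fun t ht k => ?_
    have iX := integrable_mul_of_memLp_two (hX.memLp_left k) (hX.memLp_left k)
    have iY := integrable_mul_of_memLp_two (hY.memLp_left k) (hY.memLp_left k)
    have iXY := integrable_mul_of_memLp_two (hX.memLp_left k) (hY.memLp_left k)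
    calc |∫ ω, X k ω * Y k ω ∂μ| ≤ ∫ ω, |X k ω * Y k ω| ∂μ := abs_integral_le_integral_abs
      _ ≤ ∫ ω, (t * (X k ω * X k ω) + t⁻¹ * (Y k ω * Y k ω)) ∂μ :=
          integral_mono iXY.abs ((iX.const_mul t).add (iY.const_mul t⁻¹))
            fun ω => abs_mul_le_weighted ht _ _
      _ = _ := by
          rw [integral_add (iX.const_mul t) (iY.const_mul t⁻¹), integral_const_mul,
            integral_const_mul]
  tendsto_avg := by
    filter_upwards [hX.tendsto_avg, hY.tendsto_avg] with ω hω₁ hω₂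
    refine tendsto_zero_of_weighted_bound hω₁ hω₂ fun t ht K => ?_
    refine ((abs_avg_le _ K).trans (avg_mono (fun k => abs_mul_le_weighted ht _ _) K)).trans_eq ?_
    rw [avg_add, avg_const_mul, avg_const_mul]

theorem vanishing_mul (h : LimCorr μ X X c) {e : ℕ → ℝ} (he : Tendsto e atTop (𝓝 0)) :
    LimCorr μ (fun k ω => e k * X k ω) (fun k ω => e k * X k ω) 0 where
  memLp_left k := (h.memLp_left k).const_mul _
  memLp_right k := (h.memLp_left k).const_mul _
  tendsto_integral := by
    have h1 := (he.mul he).mul h.tendsto_integral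
    simp only [zero_mul] at h1
    refine h1.congr fun k => ?_
    rw [← integral_const_mul]
    exact integral_congr_ae (ae_of_all _ fun ω => by ring)
  tendsto_avg := by
    have he2 : Tendsto (fun k => e k * e k) atTop (𝓝 0) := by simpa using he.mul he
    filter_upwards [h.tendsto_avg] with ω hω
    have h1 := tendsto_avg_mul_zero he2 (fun k => mul_self_nonneg (X k ω)) hω
    refine h1.congr fun K => congrArg (avg · K) (funext fun k => by ring)

end LimCorr

/-! ### Vector processes with a limit covariance -/

section HasLimitCov

variable {a b : Type*}

/-- The limit covariance of a vector process, both in mean and almost surely in time average. -/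
def HasLimitCov (μ : Measure Ω) (X : ℕ → Ω → a → ℝ) (Ξ : Matrix a a ℝ) : Prop :=
  ∀ i j, LimCorr μ (fun k ω => X k ω i) (fun k ω => X k ω j) (Ξ i j)

/-- A process that vanishes asymptotically, both in mean square and almost surely in time-averaged
square. -/
def Negligible (μ : Measure Ω) (g : ℕ → Ω → a → ℝ) : Prop :=
  ∀ i, LimCorr μ (fun k ω => g k ω i) (fun k ω => g k ω i) 0

theorem HasLimitCov.memLp {X : ℕ → Ω → a → ℝ} {Ξ : Matrix a a ℝ} (h : HasLimitCov μ X Ξ) (k : ℕ)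
    (i : a) : MemLp (fun ω => X k ω i) 2 μ := (h i i).memLp_left k

theorem Negligible.memLp {g : ℕ → Ω → a → ℝ} (h : Negligible μ g) (k : ℕ) (i : a) :
    MemLp (fun ω => g k ω i) 2 μ := (h i).memLp_left k

theorem Negligible.hasLimitCov {g : ℕ → Ω → a → ℝ} (h : Negligible μ g) : HasLimitCov μ g 0 :=
  fun i j => (h i).zero_right_of_self (h j)

theorem HasLimitCov.tendsto_secondMoment {X : ℕ → Ω → a → ℝ} {Ξ : Matrix a a ℝ}
    (h : HasLimitCov μ X Ξ) : Tendsto (fun k => secondMoment μ (X k) (X k)) atTop (𝓝 Ξ) :=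
  tendsto_matrix_iff.2 fun i j => (h i j).tendsto_integral

theorem HasLimitCov.add_negligible {X g : ℕ → Ω → a → ℝ} {Ξ : Matrix a a ℝ}
    (h : HasLimitCov μ X Ξ) (hg : Negligible μ g) :
    HasLimitCov μ (fun k ω => X k ω + g k ω) Ξ := by
  intro i j
  have hXg : ∀ i j, LimCorr μ (fun k ω => X k ω i) (fun k ω => g k ω j) 0 := fun i j =>
    (h i i).zero_right_of_self (hg j)
  have h1 : LimCorr μ (fun k ω => X k ω i + g k ω i) (fun k ω => X k ω j) (Ξ i j + 0) :=
    (h i j).add_left (hXg j i).symm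
  have h2 : LimCorr μ (fun k ω => X k ω i + g k ω i) (fun k ω => g k ω j) (0 + 0) :=
    (hXg i j).add_left (hg.hasLimitCov i j)
  have h3 := (h1.symm.add_left h2.symm).symm
  simp only [add_zero] at h3
  exact h3

theorem Negligible.add {f g : ℕ → Ω → a → ℝ} (hf : Negligible μ f) (hg : Negligible μ g) :
    Negligible μ (fun k ω => f k ω + g k ω) :=
  fun i => hf.hasLimitCov.add_negligible hg i i

theorem HasLimitCov.const_mulVec [Fintype a] {X : ℕ → Ω → a → ℝ} {Ξ : Matrix a a ℝ}
    (h : HasLimitCov μ X Ξ) (B : Matrix b a ℝ) : HasLimitCov μ (fun k ω => B *ᵥ X k ω) (B * Ξ * Bᵀ) := by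
  intro i j
  have hB : ∀ p q, LimCorr μ (fun k ω => B i p * X k ω p) (fun k ω => B j q * X k ω q)
      (B j q * (B i p * Ξ p q)) := fun p q =>
    (((h p q).const_mul_left (B i p)).symm.const_mul_left (B j q)).symm
  have h1 := LimCorr.sum (fun p k => (h.memLp k p).const_mul (B i p))
    (fun q k => (h.memLp k q).const_mul (B j q)) hB
  have h2 : (B * Ξ * Bᵀ) i j = ∑ p, ∑ q, B j q * (B i p * Ξ p q) := by
    simp only [Matrix.mul_apply, transpose_apply, Finset.sum_mul]
    rw [Finset.sum_comm]
    exact Finset.sum_congr rfl fun p _ => Finset.sum_congr rfl fun q _ => by ring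
  rw [h2]
  exact h1

theorem HasLimitCov.vanishing_mulVec [Fintype a] {X : ℕ → Ω → a → ℝ} {Ξ : Matrix a a ℝ}
    (h : HasLimitCov μ X Ξ) {E : ℕ → Matrix b a ℝ} (hE : Tendsto E atTop (𝓝 0)) :
    Negligible μ (fun k ω => E k *ᵥ X k ω) := by
  intro i
  have hE' : ∀ p, LimCorr μ (fun k ω => E k i p * X k ω p) (fun k ω => E k i p * X k ω p) 0 :=
    fun p => (h p p).vanishing_mul (tendsto_matrix_iff.1 hE i p)
  have h1 := LimCorr.sum (fun p k => (hE' p).memLp_left k) (fun p k => (hE' p).memLp_left k)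
    (c := fun _ _ => 0) fun p q => (hE' p).zero_right_of_self (hE' q)
  simp only [Finset.sum_const_zero] at h1
  exact h1

theorem HasLimitCov.mulVec [Fintype a] {X : ℕ → Ω → a → ℝ} {Ξ : Matrix a a ℝ}
    (h : HasLimitCov μ X Ξ)
    {B : ℕ → Matrix b a ℝ} {B' : Matrix b a ℝ} (hB : Tendsto B atTop (𝓝 B')) :
    HasLimitCov μ (fun k ω => B k *ᵥ X k ω) (B' * Ξ * B'ᵀ) := by
  have hE : Tendsto (fun k => B k - B') atTop (𝓝 0) := by
    simpa using hB.sub_const B'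
  have h1 := (h.const_mulVec B').add_negligible (h.vanishing_mulVec hE)
  simpa only [sub_mulVec, add_sub_cancel] using h1

/-- Quadratic forms `Xᵀ S X` with convergent weights `S k` converge in mean, and in time average to
the same limit. -/
theorem HasLimitCov.exists_tendsto_quad [Fintype a] [DecidableEq a]
    {X : ℕ → Ω → a → ℝ} {Ξ : Matrix a a ℝ} (h : HasLimitCov μ X Ξ) {S : ℕ → Matrix a a ℝ} {S' : Matrix a a ℝ}
    (hS : Tendsto S atTop (𝓝 S')) :
    (∀ k, Integrable (fun ω => X k ω ⬝ᵥ S k *ᵥ X k ω) μ) ∧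
    ∃ c, Tendsto (fun k => ∫ ω, X k ω ⬝ᵥ S k *ᵥ X k ω ∂μ) atTop (𝓝 c) ∧
      ∀ᵐ ω ∂μ, Tendsto (avg fun k => X k ω ⬝ᵥ S k *ᵥ X k ω) atTop (𝓝 c) := by
  -- the stacked process `(X, S X)`
  have hB : Tendsto (fun k => fromRows (1 : Matrix a a ℝ) (S k)) atTop (𝓝 (fromRows 1 S')) := by
    refine tendsto_matrix_iff.2 fun i j => ?_
    cases i with
    | inl i => simp
    | inr i => simpa using tendsto_matrix_iff.1 hS i j
  have h1 := h.mulVec hB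
  set Θ := fromRows (1 : Matrix a a ℝ) S' * Ξ * (fromRows (1 : Matrix a a ℝ) S')ᵀ
  have h2 : ∀ i, LimCorr μ (fun k ω => X k ω i) (fun k ω => (S k *ᵥ X k ω) i)
      (Θ (Sum.inl i) (Sum.inr i)) := by
    intro i
    simpa [fromRows_mulVec] using h1 (Sum.inl i) (Sum.inr i)
  have hint : ∀ k i, Integrable (fun ω => X k ω i * (S k *ᵥ X k ω) i) μ := fun k i =>
    integrable_mul_of_memLp_two ((h2 i).memLp_left k) ((h2 i).memLp_right k)
  refine ⟨fun k => integrable_finsetSum _ fun i _ => hint k i,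
    ∑ i, Θ (Sum.inl i) (Sum.inr i), ?_, ?_⟩
  · refine (tendsto_finsetSum _ fun i _ => (h2 i).tendsto_integral).congr fun k => ?_
    exact (integral_finsetSum _ fun i _ => hint k i).symm
  · have hae : ∀ᵐ ω ∂μ, ∀ i, Tendsto (avg fun k => X k ω i * (S k *ᵥ X k ω) i) atTop
        (𝓝 (Θ (Sum.inl i) (Sum.inr i))) := ae_all_iff.2 fun i => (h2 i).tendsto_avg
    filter_upwards [hae] with ω hω
    refine (tendsto_finsetSum _ fun i _ => hω i).congr fun K => ?_
    simp only [dotProduct, avg_sum]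

theorem negligible_of_eventually_zero {g : ℕ → Ω → a → ℝ} {T : ℕ}
    (hg : ∀ k i, MemLp (fun ω => g k ω i) 2 μ) (hT : ∀ k ≥ T, ∀ ω, g k ω = 0) :
    Negligible μ g := by
  intro i
  refine ⟨fun k => hg k i, fun k => hg k i, ?_, ae_of_all _ fun ω => ?_⟩
  · refine tendsto_const_nhds.congr' ?_
    filter_upwards [eventually_ge_atTop T] with k hk
    simp [hT k hk]
  · refine tendsto_avg_of_tendsto (tendsto_const_nhds.congr' ?_)
    filter_upwards [eventually_ge_atTop T] with k hk
    simp [hT k hk]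

theorem memLp_mulVec [Fintype a] {X : Ω → a → ℝ} (hX : ∀ i, MemLp (fun ω => X ω i) 2 μ)
    (B : Matrix b a ℝ) (i : b) : MemLp (fun ω => (B *ᵥ X ω) i) 2 μ :=
  memLp_finsetSum _ fun p _ => (hX p).const_mul (B i p)

/-- A linear recursion whose transition matrices converge to a stable matrix has a negligible
solution if its forcing term is negligible. -/
theorem negligible_of_recursion [Fintype a] [DecidableEq a] {A : ℕ → Matrix a a ℝ}
    {A' : Matrix a a ℝ}
    (hA : Tendsto A atTop (𝓝 A')) (hA' : PowerStable A') {δ g : ℕ → Ω → a → ℝ}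
    (hδ₀ : ∀ i, MemLp (fun ω => δ 0 ω i) 2 μ) (hg : Negligible μ g)
    (hrec : ∀ k ω, δ (k + 1) ω = A k *ᵥ δ k ω + g k ω) : Negligible μ δ := by
  have hmem : ∀ k i, MemLp (fun ω => δ k ω i) 2 μ := by
    intro k
    induction k with
    | zero => exact hδ₀
    | succ k ih =>
      intro i
      simp only [hrec]
      exact (memLp_mulVec ih (A k) i).add (hg.memLp k i)
  obtain ⟨N, c, ρ, hc, hρ0, hρ, hNcont, hN1, hN2, hN3, hN4⟩ := hA'.exists_norm
  have hN0 : ∀ x, 0 ≤ N x := fun x => (norm_nonneg x).trans (hN1 x)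
  set r := (1 + ρ) / 2 with hr
  have hr1 : 0 < 1 - r := by rw [hr]; linarith
  have hr0 : 0 ≤ r := by rw [hr]; linarith
  -- the contraction survives the perturbation of the matrices
  have hev : ∀ᶠ k in atTop, ∀ x, N (A k *ᵥ x) ≤ r * N x := by
    have hE : Tendsto (fun k => A k - A') atTop (𝓝 0) := by simpa using hA.sub_const A'
    have hη : 0 < (1 - ρ) / (2 * c) := div_pos (by linarith) (by linarith)
    filter_upwards [(tendsto_sum_abs hE).eventually (gt_mem_nhds hη)] with k hk x
    have h1 : A k *ᵥ x = A' *ᵥ x + (A k - A') *ᵥ x := by rw [sub_mulVec]; abel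
    have h2 : N ((A k - A') *ᵥ x) ≤ (1 - ρ) / 2 * N x := by
      calc N ((A k - A') *ᵥ x) ≤ c * ‖(A k - A') *ᵥ x‖ := hN2 _
        _ ≤ c * ((1 - ρ) / (2 * c) * ‖x‖) := by
            refine mul_le_mul_of_nonneg_left ((norm_mulVec_le _ x).trans ?_) hc.le
            exact mul_le_mul_of_nonneg_right hk.le (norm_nonneg _)
        _ = (1 - ρ) / 2 * ‖x‖ := by field_simp
        _ ≤ (1 - ρ) / 2 * N x := mul_le_mul_of_nonneg_left (hN1 x) (by linarith)
    rw [h1]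
    have := hN3 (A' *ᵥ x) ((A k - A') *ᵥ x)
    have := hN4 x
    rw [hr]; linarith
  set C := c ^ 2 / (1 - r) with hC
  have hC0 : 0 ≤ C := by positivity
  have hnorm : ∀ x : a → ℝ, ‖x‖ ^ 2 ≤ ∑ i, x i * x i := by
    intro x
    have hs : 0 ≤ ∑ i, x i * x i := Finset.sum_nonneg fun i _ => mul_self_nonneg _
    have h1 : ‖x‖ ≤ Real.sqrt (∑ i, x i * x i) := by
      refine (pi_norm_le_iff_of_nonneg (Real.sqrt_nonneg _)).2 fun i => ?_
      rw [Real.norm_eq_abs, ← Real.sqrt_mul_self_eq_abs]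
      exact Real.sqrt_le_sqrt (Finset.single_le_sum (f := fun i => x i * x i)
        (fun i _ => mul_self_nonneg _) (Finset.mem_univ i))
    calc ‖x‖ ^ 2 ≤ Real.sqrt (∑ i, x i * x i) ^ 2 := pow_le_pow_left₀ (norm_nonneg _) h1 2
      _ = _ := Real.sq_sqrt hs
  have hstep : ∀ᶠ k in atTop, ∀ ω, N (δ (k + 1) ω) ^ 2
      ≤ r * N (δ k ω) ^ 2 + C * ∑ i, g k ω i * g k ω i := by
    filter_upwards [hev] with k hk ω
    have h1 : N (δ (k + 1) ω) ≤ r * N (δ k ω) + c * ‖g k ω‖ := by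
      rw [hrec]
      exact (hN3 _ _).trans (add_le_add (hk _) (hN2 _))
    have h2 : (r * N (δ k ω) + c * ‖g k ω‖) ^ 2 ≤ r * N (δ k ω) ^ 2 + C * ‖g k ω‖ ^ 2 := by
      have h3 : r * N (δ k ω) ^ 2 + C * ‖g k ω‖ ^ 2 - (r * N (δ k ω) + c * ‖g k ω‖) ^ 2
          = r / (1 - r) * ((1 - r) * N (δ k ω) - c * ‖g k ω‖) ^ 2 := by
        rw [hC]; field_simp; ring
      have h4 : 0 ≤ r / (1 - r) * ((1 - r) * N (δ k ω) - c * ‖g k ω‖) ^ 2 := by positivity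
      linarith
    exact ((pow_le_pow_left₀ (hN0 _) h1 2).trans h2).trans
      (add_le_add_right (mul_le_mul_of_nonneg_left (hnorm _) hC0) _)
  have hle : ∀ k ω i, δ k ω i * δ k ω i ≤ N (δ k ω) ^ 2 := by
    intro k ω i
    rw [← sq, ← sq_abs]
    exact pow_le_pow_left₀ (abs_nonneg _) ((norm_le_pi_norm (δ k ω) i).trans (hN1 _)) 2
  have hgint : ∀ k, Integrable (fun ω => ∑ i, g k ω i * g k ω i) μ := fun k =>
    integrable_finsetSum _ fun i _ => integrable_mul_of_memLp_two (hg.memLp k i) (hg.memLp k i)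
  have hNint : ∀ k, Integrable (fun ω => N (δ k ω) ^ 2) μ := by
    intro k
    have hmeas : AEStronglyMeasurable (δ k) μ :=
      (memLp_pi_iff.2 fun i => hmem k i).aestronglyMeasurable
    refine Integrable.mono' (g := fun ω => c ^ 2 * ∑ i, δ k ω i * δ k ω i)
      ((integrable_finsetSum _ fun i _ =>
        integrable_mul_of_memLp_two (hmem k i) (hmem k i)).const_mul _)
      ((hNcont.comp_aestronglyMeasurable hmeas).pow 2) (ae_of_all _ fun ω => ?_)
    rw [Real.norm_eq_abs, abs_of_nonneg (sq_nonneg _)]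
    calc N (δ k ω) ^ 2 ≤ (c * ‖δ k ω‖) ^ 2 := pow_le_pow_left₀ (hN0 _) (hN2 _) 2
      _ = c ^ 2 * ‖δ k ω‖ ^ 2 := mul_pow _ _ _
      _ ≤ _ := mul_le_mul_of_nonneg_left (hnorm _) (sq_nonneg _)
  intro i
  refine ⟨fun k => hmem k i, fun k => hmem k i, ?_, ?_⟩
  · have hgl : Tendsto (fun k => ∫ ω, C * ∑ i, g k ω i * g k ω i ∂μ) atTop (𝓝 0) := by
      have h1 : Tendsto (fun k => C * ∑ i, ∫ ω, g k ω i * g k ω i ∂μ) atTop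
          (𝓝 (C * ∑ _i : a, (0 : ℝ))) :=
        (tendsto_finsetSum _ fun i _ => (hg i).tendsto_integral).const_mul C
      simp only [Finset.sum_const_zero, mul_zero] at h1
      refine h1.congr fun k => ?_
      rw [integral_const_mul, integral_finsetSum _ fun i _ =>
        integrable_mul_of_memLp_two (hg.memLp k i) (hg.memLp k i)]
    have hlim : Tendsto (fun k => ∫ ω, N (δ k ω) ^ 2 ∂μ) atTop (𝓝 0) := by
      refine tendsto_zero_of_contraction hr0 (by linarith)
        (fun k => integral_nonneg fun ω => sq_nonneg _) hgl ?_
      filter_upwards [hstep] with k hk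
      rw [← integral_const_mul, ← integral_add ((hNint k).const_mul r) ((hgint k).const_mul C)]
      exact integral_mono (hNint (k + 1)) (((hNint k).const_mul r).add ((hgint k).const_mul C)) hk
    exact squeeze_zero (fun k => integral_nonneg fun ω => mul_self_nonneg _)
      (fun k => integral_mono (integrable_mul_of_memLp_two (hmem k i) (hmem k i)) (hNint k)
        fun ω => hle k ω i) hlim
  · have hae : ∀ᵐ ω ∂μ, ∀ i, Tendsto (avg fun k => g k ω i * g k ω i) atTop (𝓝 0) :=
      ae_all_iff.2 fun i => (hg i).tendsto_avg
    filter_upwards [hae] with ω hω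
    have hgl : Tendsto (avg fun k => C * ∑ i, g k ω i * g k ω i) atTop (𝓝 0) := by
      have h1 : Tendsto (fun K => C * ∑ i, avg (fun k => g k ω i * g k ω i) K) atTop
          (𝓝 (C * ∑ _i : a, (0 : ℝ))) :=
        (tendsto_finsetSum _ fun i _ => hω i).const_mul C
      simp only [Finset.sum_const_zero, mul_zero] at h1
      refine h1.congr fun K => ?_
      rw [avg_const_mul, avg_sum]
    exact tendsto_avg_zero_of_le (fun k => mul_self_nonneg _) (fun k => hle k ω i)
      (tendsto_avg_zero_of_contraction (by linarith) (fun k => sq_nonneg _)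
        (fun k => mul_nonneg hC0 (Finset.sum_nonneg fun i _ => mul_self_nonneg _)) hgl
        (hstep.mono fun k hk => hk ω))

end HasLimitCov

variable {Ω : Type*} [MeasurableSpace Ω] {μ : Measure Ω}

/-! ### A strong law for orthogonal sequences -/

theorem ae_tendsto_zero_of_summable {Z : ℕ → Ω → ℝ} {B : ℕ → ℝ} (hZ : ∀ k ω, 0 ≤ Z k ω)
    (hint : ∀ k, Integrable (Z k) μ) (hle : ∀ k, ∫ ω, Z k ω ∂μ ≤ B k) (hB : Summable B) :
    ∀ᵐ ω ∂μ, Tendsto (fun k => Z k ω) atTop (𝓝 0) := by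
  have hB0 : ∀ k, 0 ≤ B k := fun k => (integral_nonneg (hZ k)).trans (hle k)
  have hmeas : ∀ k, AEMeasurable (fun ω => ENNReal.ofReal (Z k ω)) μ := fun k =>
    (hint k).aestronglyMeasurable.aemeasurable.ennreal_ofReal
  have hfin : ∫⁻ ω, ∑' k, ENNReal.ofReal (Z k ω) ∂μ ≠ ⊤ := by
    rw [lintegral_tsum hmeas]
    have h1 : ∑' k, ∫⁻ ω, ENNReal.ofReal (Z k ω) ∂μ ≤ ∑' k, ENNReal.ofReal (B k) := by
      refine ENNReal.tsum_le_tsum fun k => ?_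
      rw [← ofReal_integral_eq_lintegral_ofReal (hint k) (ae_of_all _ (hZ k))]
      exact ENNReal.ofReal_le_ofReal (hle k)
    refine ne_top_of_le_ne_top ?_ h1
    rw [← ENNReal.ofReal_tsum_of_nonneg hB0 hB]
    exact ENNReal.ofReal_ne_top
  filter_upwards [ae_lt_top' (AEMeasurable.tsum hmeas) hfin] with ω hω
  have h1 := ENNReal.tendsto_atTop_zero_of_tsum_ne_top hω.ne
  have h2 := (ENNReal.tendsto_toReal ENNReal.zero_ne_top).comp h1
  refine h2.congr fun k => ?_
  exact ENNReal.toReal_ofReal (hZ k ω)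

/-- Orthogonal random variables with bounded second moments obey the strong law of large numbers:
along the squares the means converge by summability of their second moments, and the sum of absolute
values over a gap between squares is too small to matter. -/
theorem ae_tendsto_avg_of_orthogonal {X : ℕ → Ω → ℝ} {C : ℝ} (hX : ∀ k, MemLp (X k) 2 μ)
    (horth : ∀ j k, j < k → ∫ ω, X j ω * X k ω ∂μ = 0)
    (hC : ∀ k, ∫ ω, X k ω * X k ω ∂μ ≤ C) :
    ∀ᵐ ω ∂μ, Tendsto (avg fun k => X k ω) atTop (𝓝 0) := by
  have hC0 : 0 ≤ C := (integral_nonneg fun ω => mul_self_nonneg _).trans (hC 0)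
  have hint : ∀ j k, Integrable (fun ω => X j ω * X k ω) μ := fun j k =>
    integrable_mul_of_memLp_two (hX j) (hX k)
  set s : ℕ → Ω → ℝ := fun K ω => ∑ k ∈ Finset.range K, X k ω with hs
  have hsL : ∀ K, MemLp (s K) 2 μ := fun K => memLp_finsetSum _ fun k _ => hX k
  have hsC : ∀ K : ℕ, ∫ ω, s K ω ^ 2 ∂μ ≤ C * K := by
    intro K
    induction K with
    | zero => simp [hs]
    | succ K ih =>
      have h0 : ∫ ω, s K ω * X K ω ∂μ = 0 := by
        simp only [hs, Finset.sum_mul]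
        rw [integral_finsetSum _ fun k _ => hint k K]
        exact Finset.sum_eq_zero fun k hk => horth k K (Finset.mem_range.1 hk)
      have h1 : ∀ ω, s (K + 1) ω ^ 2 = s K ω ^ 2 + (2 * (s K ω * X K ω) + X K ω * X K ω) := by
        intro ω
        simp only [hs, Finset.sum_range_succ]
        ring
      have i1 := integrable_mul_of_memLp_two (hsL K) (hX K)
      have i2 : Integrable (fun ω => 2 * (s K ω * X K ω) + X K ω * X K ω) μ :=
        (i1.const_mul 2).add (hint K K)
      simp only [h1]
      rw [integral_add (hsL K).integrable_sq i2,
        integral_add (i1.const_mul 2) (hint K K), integral_const_mul, h0]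
      push_cast
      linarith [hC K]
  -- the means along the squares
  have hY : ∀ᵐ ω ∂μ, Tendsto (fun m : ℕ => (((m : ℝ) ^ 2)⁻¹ * s (m ^ 2) ω) ^ 2) atTop (𝓝 0) := by
    refine ae_tendsto_zero_of_summable (B := fun m : ℕ => C * ((m : ℝ) ^ 2)⁻¹)
      (fun k ω => sq_nonneg _) (fun m => ((hsL (m ^ 2)).const_mul _).integrable_sq) (fun m => ?_)
      ((Real.summable_nat_pow_inv.2 one_lt_two).mul_left C)
    simp only [mul_pow]
    rw [integral_const_mul]
    have h1 := hsC (m ^ 2)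
    push_cast at h1
    rcases Nat.eq_zero_or_pos m with rfl | hm
    · simp
    · have hm0 : (0 : ℝ) < m := by exact_mod_cast hm
      calc (((m : ℝ) ^ 2)⁻¹) ^ 2 * ∫ ω, s (m ^ 2) ω ^ 2 ∂μ
          ≤ (((m : ℝ) ^ 2)⁻¹) ^ 2 * (C * (m : ℝ) ^ 2) :=
            mul_le_mul_of_nonneg_left h1 (by positivity)
        _ = C * ((m : ℝ) ^ 2)⁻¹ := by field_simp
  -- the gaps between the squares
  have hB : ∀ᵐ ω ∂μ, Tendsto (fun m : ℕ => (((m : ℝ) ^ 2)⁻¹ *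
      ∑ k ∈ Finset.Ico (m ^ 2) ((m + 1) ^ 2), |X k ω|) ^ 2) atTop (𝓝 0) := by
    have hXa : ∀ k, MemLp (fun ω => |X k ω|) 2 μ := fun k => (hX k).abs
    have hbL : ∀ m : ℕ, MemLp (fun ω => ∑ k ∈ Finset.Ico (m ^ 2) ((m + 1) ^ 2), |X k ω|) 2 μ :=
      fun m => memLp_finsetSum _ fun k _ => hXa k
    refine ae_tendsto_zero_of_summable (B := fun m : ℕ => (9 * C) * ((m : ℝ) ^ 2)⁻¹)
      (fun k ω => sq_nonneg _) (fun m => ((hbL m).const_mul _).integrable_sq) (fun m => ?_)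
      ((Real.summable_nat_pow_inv.2 one_lt_two).mul_left (9 * C))
    simp only [mul_pow]
    rw [integral_const_mul]
    rcases Nat.eq_zero_or_pos m with rfl | hm
    · simp
    · have hm0 : (1 : ℝ) ≤ m := by exact_mod_cast hm
      have hcard : (Finset.Ico (m ^ 2) ((m + 1) ^ 2)).card = 2 * m + 1 := by
        rw [Nat.card_Ico]
        have : (m + 1) ^ 2 = m ^ 2 + (2 * m + 1) := by ring
        omega
      have h1 : ∫ ω, (∑ k ∈ Finset.Ico (m ^ 2) ((m + 1) ^ 2), |X k ω|) ^ 2 ∂μ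
          ≤ (2 * m + 1) * ((2 * m + 1) * C) := by
        calc _ ≤ ∫ ω, (2 * m + 1) * ∑ k ∈ Finset.Ico (m ^ 2) ((m + 1) ^ 2), X k ω * X k ω ∂μ := by
              refine integral_mono (hbL m).integrable_sq
                ((integrable_finsetSum _ fun k _ => hint k k).const_mul _) fun ω => ?_
              have := sq_sum_le_card_mul_sum_sq (s := Finset.Ico (m ^ 2) ((m + 1) ^ 2))
                (f := fun k => |X k ω|)
              rw [hcard] at this
              push_cast at this
              simpa only [sq_abs, ← sq] using this
          _ ≤ _ := by
              rw [integral_const_mul, integral_finsetSum _ fun k _ => hint k k]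
              refine mul_le_mul_of_nonneg_left ?_ (by positivity)
              refine (Finset.sum_le_card_nsmul _ _ C fun k _ => hC k).trans_eq ?_
              rw [hcard, nsmul_eq_mul]; push_cast; ring
      calc (((m : ℝ) ^ 2)⁻¹) ^ 2 * ∫ ω, (∑ k ∈ Finset.Ico (m ^ 2) ((m + 1) ^ 2), |X k ω|) ^ 2 ∂μ
          ≤ (((m : ℝ) ^ 2)⁻¹) ^ 2 * ((3 * m) * ((3 * m) * C)) := by
            refine mul_le_mul_of_nonneg_left (h1.trans ?_) (by positivity)
            have h2 : (2 * (m : ℝ) + 1) ≤ 3 * m := by linarith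
            exact mul_le_mul h2 (mul_le_mul_of_nonneg_right h2 hC0) (by positivity) (by positivity)
        _ = 9 * C * ((m : ℝ) ^ 2)⁻¹ := by field_simp; ring
  filter_upwards [hY, hB] with ω hYω hBω
  have habs : ∀ {f : ℕ → ℝ}, Tendsto (fun m => f m ^ 2) atTop (𝓝 0) →
      Tendsto (fun m => |f m|) atTop (𝓝 0) := by
    intro f hf
    have := (Real.continuous_sqrt.tendsto 0).comp hf
    simpa [Function.comp_def, Real.sqrt_sq_eq_abs] using this
  have hsqrt : Tendsto (fun K : ℕ => Nat.sqrt K) atTop atTop :=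
    tendsto_atTop.2 fun b => eventually_atTop.2 ⟨b ^ 2, fun K hK => Nat.le_sqrt'.2 hK⟩
  have hsum := ((habs hYω).add (habs hBω)).comp hsqrt
  rw [add_zero] at hsum
  refine squeeze_zero_norm' ?_ hsum
  filter_upwards [eventually_gt_atTop 0] with K hK
  set m := Nat.sqrt K with hm
  have hm1 : m ^ 2 ≤ K := Nat.sqrt_le' K
  have hm2 : K < (m + 1) ^ 2 := Nat.lt_succ_sqrt' K
  have hm0 : 0 < m := Nat.sqrt_pos.2 hK
  have hmr : (0 : ℝ) < (m : ℝ) ^ 2 := by positivity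
  have hsK : |s K ω| ≤ |s (m ^ 2) ω| + ∑ k ∈ Finset.Ico (m ^ 2) ((m + 1) ^ 2), |X k ω| := by
    have h1 : s K ω = s (m ^ 2) ω + ∑ k ∈ Finset.Ico (m ^ 2) K, X k ω :=
      (Finset.sum_range_add_sum_Ico _ hm1).symm
    rw [h1]
    refine (abs_add_le _ _).trans (add_le_add_right ((Finset.abs_sum_le_sum_abs _ _).trans ?_) _)
    exact Finset.sum_le_sum_of_subset_of_nonneg
      (Finset.Ico_subset_Ico_right hm2.le) fun k _ _ => abs_nonneg _
  have hinv : (K : ℝ)⁻¹ ≤ ((m : ℝ) ^ 2)⁻¹ := by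
    refine inv_anti₀ hmr ?_
    exact_mod_cast hm1
  calc ‖avg (fun k => X k ω) K‖ = (K : ℝ)⁻¹ * |s K ω| := by
        rw [Real.norm_eq_abs, avg, abs_mul, abs_of_nonneg (by positivity : (0 : ℝ) ≤ (K : ℝ)⁻¹)]
    _ ≤ ((m : ℝ) ^ 2)⁻¹ * (|s (m ^ 2) ω|
          + ∑ k ∈ Finset.Ico (m ^ 2) ((m + 1) ^ 2), |X k ω|) :=
        mul_le_mul hinv hsK (abs_nonneg _) (by positivity)
    _ = _ := by
        have h3 : 0 ≤ ∑ k ∈ Finset.Ico (m ^ 2) ((m + 1) ^ 2), |X k ω| :=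
          Finset.sum_nonneg fun k _ => abs_nonneg _
        rw [mul_add, Function.comp_apply, ← hm, abs_mul, abs_mul,
          abs_of_nonneg (inv_nonneg.2 hmr.le), abs_of_nonneg h3]

/-! ### Second moments -/

section SecondMoment

variable {a b c : Type*}

theorem secondMoment_transpose (X : Ω → a → ℝ) (Y : Ω → b → ℝ) :
    (secondMoment μ X Y)ᵀ = secondMoment μ Y X := by
  ext i j; simp only [secondMoment, transpose_apply, of_apply, mul_comm]

theorem secondMoment_mulVec [Fintype a] {X : Ω → a → ℝ} {Y : Ω → b → ℝ}
    (hX : ∀ i, MemLp (fun ω => X ω i) 2 μ) (hY : ∀ i, MemLp (fun ω => Y ω i) 2 μ)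
    (B : Matrix c a ℝ) : secondMoment μ (fun ω => B *ᵥ X ω) Y = B * secondMoment μ X Y := by
  ext i j
  simp only [secondMoment, of_apply, Matrix.mul_apply, mulVec, dotProduct, Finset.sum_mul,
    mul_assoc]
  rw [integral_finsetSum _ fun p _ =>
    (integrable_mul_of_memLp_two (hX p) (hY j)).const_mul (B i p)]
  simp only [integral_const_mul]

theorem secondMoment_add {X X' : Ω → a → ℝ} {Y : Ω → b → ℝ}
    (hX : ∀ i, MemLp (fun ω => X ω i) 2 μ) (hX' : ∀ i, MemLp (fun ω => X' ω i) 2 μ)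
    (hY : ∀ i, MemLp (fun ω => Y ω i) 2 μ) :
    secondMoment μ (fun ω => X ω + X' ω) Y = secondMoment μ X Y + secondMoment μ X' Y := by
  ext i j
  simp only [secondMoment, of_apply, Matrix.add_apply, Pi.add_apply, add_mul]
  exact integral_add (integrable_mul_of_memLp_two (hX i) (hY j))
    (integrable_mul_of_memLp_two (hX' i) (hY j))

end SecondMoment

/-- The time average `(1 / K) ∑_{k < K} x k (y k)ᵀ`. -/
noncomputable def avgOuter {a b : Type*} (x : ℕ → a → ℝ) (y : ℕ → b → ℝ) (K : ℕ) : Matrix a b ℝ :=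
  of fun i j => avg (fun k => x k i * y k j) K

section AvgOuter

variable {a b c : Type*}

theorem avgOuter_transpose (x : ℕ → a → ℝ) (y : ℕ → b → ℝ) (K : ℕ) :
    (avgOuter x y K)ᵀ = avgOuter y x K := by
  ext i j; simp only [avgOuter, transpose_apply, of_apply, mul_comm]

theorem avgOuter_mulVec [Fintype a] (B : Matrix c a ℝ) (x : ℕ → a → ℝ) (y : ℕ → b → ℝ) (K : ℕ) :
    avgOuter (fun k => B *ᵥ x k) y K = B * avgOuter x y K := by
  ext i j
  simp only [avgOuter, of_apply, Matrix.mul_apply, mulVec, dotProduct, Finset.sum_mul, mul_assoc,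
    avg_sum, avg_const_mul]

theorem avgOuter_add (x x' : ℕ → a → ℝ) (y : ℕ → b → ℝ) (K : ℕ) :
    avgOuter (fun k => x k + x' k) y K = avgOuter x y K + avgOuter x' y K := by
  ext i j
  simp only [avgOuter, of_apply, Matrix.add_apply, Pi.add_apply, add_mul, avg_add]

theorem avgOuter_response_left [Fintype a] [Fintype b] (A : Matrix c a ℝ) (W : Matrix c b ℝ)
    {d : Type*} (x : ℕ → a → ℝ) (z : ℕ → b → ℝ) (y : ℕ → d → ℝ) (K : ℕ) :
    avgOuter (fun k => A *ᵥ x k + W *ᵥ z k) y K = A * avgOuter x y K + W * avgOuter z y K := by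
  rw [avgOuter_add, avgOuter_mulVec, avgOuter_mulVec]

theorem avgOuter_response_right [Fintype a] [Fintype b] (A : Matrix c a ℝ) (W : Matrix c b ℝ)
    {d : Type*} (x : ℕ → a → ℝ) (z : ℕ → b → ℝ) (y : ℕ → d → ℝ) (K : ℕ) :
    avgOuter y (fun k => A *ᵥ x k + W *ᵥ z k) K = avgOuter y x K * Aᵀ + avgOuter y z K * Wᵀ := by
  rw [← avgOuter_transpose, avgOuter_response_left, transpose_add, transpose_mul, transpose_mul,
    avgOuter_transpose, avgOuter_transpose]

end AvgOuter

/-! ### The stationary response of a stable linear system to white noise -/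

section Response

variable {a b : Type*} [Fintype a] [Fintype b]

/-- The response `x_{k+1} = A x_k + W z_k`, `x_0 = 0`, of a linear system. -/
def linResponse (A : Matrix a a ℝ) (W : Matrix a b ℝ) (z : ℕ → b → ℝ) : ℕ → a → ℝ
  | 0 => 0
  | k + 1 => A *ᵥ linResponse A W z k + W *ᵥ z k

theorem linResponse_congr (A : Matrix a a ℝ) (W : Matrix a b ℝ) {z z' : ℕ → b → ℝ} {k : ℕ}
    (h : ∀ i < k, z i = z' i) : linResponse A W z k = linResponse A W z' k := by
  induction k with
  | zero => rfl
  | succ k ih =>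
    rw [linResponse, linResponse, ih fun i hi => h i (by omega), h k (by omega)]

theorem measurable_linResponse (A : Matrix a a ℝ) (W : Matrix a b ℝ) (k : ℕ) :
    Measurable fun z : ℕ → b → ℝ => linResponse A W z k := by
  induction k with
  | zero => exact measurable_const
  | succ k ih =>
    have h1 : Measurable fun x : a → ℝ => A *ᵥ x :=
      (Continuous.matrix_mulVec continuous_const continuous_id).measurable
    have h2 : Measurable fun x : b → ℝ => W *ᵥ x :=
      (Continuous.matrix_mulVec continuous_const continuous_id).measurable
    exact (h1.comp ih).add (h2.comp (measurable_pi_apply k))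

/-- White noise in the wide sense needed here: independent in time, centred, with a constant
covariance `N` that is also its limit covariance. -/
structure IsWhiteNoise (μ : Measure Ω) (e : ℕ → Ω → b → ℝ) (N : Matrix b b ℝ) : Prop where
  indep : iIndepFun e μ
  mean : ∀ k i, ∫ ω, e k ω i ∂μ = 0
  cov : ∀ k, secondMoment μ (e k) (e k) = N
  limitCov : HasLimitCov μ e N

variable {e : ℕ → Ω → b → ℝ} {N : Matrix b b ℝ}

theorem IsWhiteNoise.aemeasurable (he : IsWhiteNoise μ e N) (k : ℕ) : AEMeasurable (e k) μ :=
  aemeasurable_pi_iff.2 fun i => (he.limitCov.memLp k i).aestronglyMeasurable.aemeasurable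

/-- A functional of the noise before time `k` is independent of the noise at time `k`. -/
theorem IsWhiteNoise.indepFun_past (he : IsWhiteNoise μ e N) {F : (ℕ → b → ℝ) → ℝ}
    (hF : Measurable F) {k : ℕ} (hdep : ∀ z z', (∀ i < k, z i = z' i) → F z = F z') (j : b) :
    IndepFun (fun ω => F fun i => e i ω) (fun ω => e k ω j) μ := by
  have h1 := he.indep.indepFun_finset₀ (Finset.range k) {k} (by simp) he.aemeasurable
  let ext : ((i : Finset.range k) → b → ℝ) → ℕ → b → ℝ := fun z i =>
    if hi : i ∈ Finset.range k then z ⟨i, hi⟩ else 0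
  have hext : Measurable ext := by
    refine measurable_pi_lambda _ fun i => ?_
    by_cases hi : i ∈ Finset.range k
    · simp only [ext, hi, dif_pos]
      exact measurable_pi_apply _
    · simp only [ext, hi, dif_neg, not_false_eq_true]
      exact measurable_const
  have h2 := h1.comp (φ := fun z => F (ext z)) (ψ := fun z => z ⟨k, Finset.mem_singleton_self k⟩ j)
    (hF.comp hext) (show Measurable fun z : ((i : ({k} : Finset ℕ)) → b → ℝ) =>
        z ⟨k, Finset.mem_singleton_self k⟩ j from (measurable_pi_apply j).comp
      (measurable_pi_apply (⟨k, Finset.mem_singleton_self k⟩ : ({k} : Finset ℕ))))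
  have h3 : ((fun z => F (ext z)) ∘ fun ω (i : Finset.range k) => e i ω)
      = fun ω => F fun i => e i ω := by
    funext ω
    refine hdep _ _ fun i hi => ?_
    simp [ext, hi]
  rwa [h3] at h2

variable (A : Matrix a a ℝ) (W : Matrix a b ℝ)

theorem IsWhiteNoise.memLp_response (he : IsWhiteNoise μ e N) (k : ℕ) (i : a) :
    MemLp (fun ω => linResponse A W (fun j => e j ω) k i) 2 μ := by
  induction k generalizing i with
  | zero =>
    have : (fun ω : Ω => linResponse A W (fun j => e j ω) 0 i) = fun _ => (0 : ℝ) := rfl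
    rw [this]; exact MemLp.zero'
  | succ k ih => exact (memLp_mulVec ih A i).add (memLp_mulVec (he.limitCov.memLp k) W i)

/-- The response at time `k` depends on the noise before time `k` only. -/
theorem IsWhiteNoise.response_orthogonal (he : IsWhiteNoise μ e N) (k : ℕ) :
    secondMoment μ (fun ω => linResponse A W (fun j => e j ω) k) (e k) = 0 := by
  ext i j
  have hind := he.indepFun_past (k := k) (F := fun z => linResponse A W z k i)
    ((measurable_pi_apply i).comp (measurable_linResponse A W k))
    (fun z z' h => by rw [linResponse_congr A W h]) j
  simp only [secondMoment, of_apply, Matrix.zero_apply]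
  rw [hind.integral_fun_mul_eq_mul_integral (he.memLp_response A W k i).aestronglyMeasurable
    (he.limitCov.memLp k j).aestronglyMeasurable, he.mean, mul_zero]

theorem IsWhiteNoise.secondMoment_response_succ (he : IsWhiteNoise μ e N) (k : ℕ) :
    secondMoment μ (fun ω => linResponse A W (fun j => e j ω) (k + 1))
        (fun ω => linResponse A W (fun j => e j ω) (k + 1))
      = A * secondMoment μ (fun ω => linResponse A W (fun j => e j ω) k)
          (fun ω => linResponse A W (fun j => e j ω) k) * Aᵀ + W * N * Wᵀ := by
  set η : Ω → a → ℝ := fun ω => linResponse A W (fun j => e j ω) k with hη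
  have m1 : ∀ i, MemLp (fun ω => η ω i) 2 μ := he.memLp_response A W k
  have m2 := he.limitCov.memLp k
  have m3 : ∀ i, MemLp (fun ω => (A *ᵥ η ω) i) 2 μ := memLp_mulVec m1 A
  have m4 : ∀ i, MemLp (fun ω => (W *ᵥ e k ω) i) 2 μ := memLp_mulVec m2 W
  have m5 : ∀ i, MemLp (fun ω => (A *ᵥ η ω + W *ᵥ e k ω) i) 2 μ := fun i => (m3 i).add (m4 i)
  change secondMoment μ (fun ω => A *ᵥ η ω + W *ᵥ e k ω) (fun ω => A *ᵥ η ω + W *ᵥ e k ω) = _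
  have o1 : secondMoment μ η (e k) = 0 := he.response_orthogonal A W k
  have o2 : secondMoment μ (e k) η = 0 := by rw [← secondMoment_transpose, o1, transpose_zero]
  have r1 : secondMoment μ η (fun ω => A *ᵥ η ω + W *ᵥ e k ω) = secondMoment μ η η * Aᵀ := by
    rw [← secondMoment_transpose, secondMoment_add m3 m4 m1, secondMoment_mulVec m1 m1,
      secondMoment_mulVec m2 m1, o2, Matrix.mul_zero, add_zero, transpose_mul,
      secondMoment_transpose]
  have r2 : secondMoment μ (e k) (fun ω => A *ᵥ η ω + W *ᵥ e k ω) = N * Wᵀ := by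
    rw [← secondMoment_transpose, secondMoment_add m3 m4 m2, secondMoment_mulVec m1 m2,
      secondMoment_mulVec m2 m2, o1, Matrix.mul_zero, zero_add, transpose_mul,
      secondMoment_transpose, he.cov]
  rw [secondMoment_add m3 m4 m5, secondMoment_mulVec m1 m5, secondMoment_mulVec m2 m5, r1, r2,
    Matrix.mul_assoc, Matrix.mul_assoc]

variable {A W}

theorem IsWhiteNoise.tendsto_secondMoment_response [DecidableEq a] (he : IsWhiteNoise μ e N)
    (hA : PowerStable A) {Ψ : Matrix a a ℝ} (hΨ : A * Ψ * Aᵀ + W * N * Wᵀ = Ψ) :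
    Tendsto (fun k => secondMoment μ (fun ω => linResponse A W (fun j => e j ω) k)
      (fun ω => linResponse A W (fun j => e j ω) k)) atTop (𝓝 Ψ) := by
  refine (hA.tendsto_lyapunov hΨ 0).congr fun k => ?_
  induction k with
  | zero => ext i j; simp [secondMoment, linResponse]
  | succ k ih => rw [Function.iterate_succ_apply', ih, he.secondMoment_response_succ]

/-- The noise is asymptotically uncorrelated, in time average too, with the earlier response. -/
theorem IsWhiteNoise.ae_tendsto_avg_response_mul [DecidableEq a] [IsProbabilityMeasure μ]
    (he : IsWhiteNoise μ e N) (hA : PowerStable A) (i : a) (j : b) :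
    ∀ᵐ ω ∂μ, Tendsto (avg fun k => linResponse A W (fun j => e j ω) k i * e k ω j) atTop (𝓝 0) := by
  obtain ⟨Ψ, hΨ⟩ := hA.exists_lyapunov (W * N * Wᵀ)
  set η : ℕ → Ω → a → ℝ := fun k ω => linResponse A W (fun j => e j ω) k with hη
  have hηm : ∀ k i, MemLp (fun ω => η k ω i) 2 μ := he.memLp_response A W
  have hem := he.limitCov.memLp
  have hmeas : ∀ k i, Measurable fun z : ℕ → b → ℝ => linResponse A W z k i := fun k i =>
    (measurable_pi_apply i).comp (measurable_linResponse A W k)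
  have hsq : ∀ k, IndepFun (fun ω => η k ω i ^ 2) (fun ω => e k ω j ^ 2) μ := by
    intro k
    have := (he.indepFun_past (k := k) (F := fun z => linResponse A W z k i) (hmeas k i)
      (fun z z' h => by rw [linResponse_congr A W h]) j).comp
      (φ := fun r => r ^ 2) (ψ := fun r => r ^ 2) (by fun_prop) (by fun_prop)
    exact this
  have hXint : ∀ k, Integrable (fun ω => (η k ω i * e k ω j) ^ 2) μ := by
    intro k
    have := (hsq k).integrable_mul (hηm k i).integrable_sq (hem k j).integrable_sq
    refine this.congr (ae_of_all _ fun ω => ?_)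
    simp [mul_pow]
  have hX : ∀ k, MemLp (fun ω => η k ω i * e k ω j) 2 μ := fun k =>
    (memLp_two_iff_integrable_sq ((hηm k i).aestronglyMeasurable.mul
      (hem k j).aestronglyMeasurable)).2 (hXint k)
  have hlim := tendsto_matrix_iff.1 (he.tendsto_secondMoment_response hA hΨ) i i
  obtain ⟨C, hC⟩ := hlim.bddAbove_range
  refine ae_tendsto_avg_of_orthogonal (C := C * N j j) hX (fun k k' hkk => ?_) (fun k => ?_)
  · have hind := he.indepFun_past (k := k')
      (F := fun z => linResponse A W z k i * z k j * linResponse A W z k' i)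
      (((hmeas k i).mul ((measurable_pi_apply j).comp (measurable_pi_apply k))).mul (hmeas k' i))
      (fun z z' h => by
        rw [linResponse_congr A W h, linResponse_congr A W (k := k) fun i hi => h i (by omega),
          h k hkk]) j
    have h1 := hind.integral_fun_mul_eq_mul_integral
      (((hX k).aestronglyMeasurable).mul (hηm k' i).aestronglyMeasurable)
      (hem k' j).aestronglyMeasurable
    rw [he.mean, mul_zero] at h1
    rw [← h1]
    exact integral_congr_ae (ae_of_all _ fun ω => by ring)
  · have h1 := (hsq k).integral_fun_mul_eq_mul_integral
      (hηm k i).integrable_sq.aestronglyMeasurable (hem k j).integrable_sq.aestronglyMeasurable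
    have h2 : ∫ ω, e k ω j ^ 2 ∂μ = N j j := by
      rw [← he.cov k]; simp only [secondMoment, of_apply, sq]
    have h3 : ∫ ω, η k ω i ^ 2 ∂μ ≤ C := by
      have := hC ⟨k, rfl⟩
      simpa only [secondMoment, of_apply, sq] using this
    have h4 : 0 ≤ N j j := by
      rw [← h2]; exact integral_nonneg fun ω => sq_nonneg _
    calc ∫ ω, η k ω i * e k ω j * (η k ω i * e k ω j) ∂μ
        = ∫ ω, η k ω i ^ 2 * e k ω j ^ 2 ∂μ := integral_congr_ae (ae_of_all _ fun ω => by ring)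
      _ = (∫ ω, η k ω i ^ 2 ∂μ) * N j j := by rw [h1, h2]
      _ ≤ C * N j j := mul_le_mul_of_nonneg_right h3 h4

/-- If the time-averaged covariance of the input converges, then the response of a stable system
grows more slowly than the square root of time. -/
theorem tendsto_response_sq_div [DecidableEq a] (hA : PowerStable A) {z : ℕ → b → ℝ} {c : b → ℝ}
    (hz : ∀ j, Tendsto (avg fun k => z k j * z k j) atTop (𝓝 (c j))) (i j : a) :
    Tendsto (fun K : ℕ => (K : ℝ)⁻¹ * (linResponse A W z K i * linResponse A W z K j)) atTop
      (𝓝 0) := by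
  obtain ⟨N, d, ρ, hd, hρ0, hρ, -, hN1, hN2, hN3, hN4⟩ := hA.exists_norm
  have hN0 : ∀ x, 0 ≤ N x := fun x => (norm_nonneg x).trans (hN1 x)
  set x := linResponse A W z with hx
  set D := d * ∑ i, ∑ j, |W i j| with hD
  have hD0 : 0 ≤ D := by positivity
  -- the norm of the response divided by the square root of time is a contracted sequence
  have hinput : Tendsto (fun k : ℕ => D * ∑ j, Real.sqrt (z k j * z k j / ((k : ℝ) + 1))) atTop
      (𝓝 0) := by
    have h1 : ∀ j, Tendsto (fun k : ℕ => Real.sqrt (z k j * z k j / ((k : ℝ) + 1))) atTop (𝓝 0) :=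
      fun j => by
        have := (Real.continuous_sqrt.tendsto 0).comp (tendsto_div_of_tendsto_avg (hz j))
        simpa [Function.comp_def] using this
    simpa using (tendsto_finsetSum Finset.univ fun j _ => h1 j).const_mul D
  have hlim : Tendsto (fun k : ℕ => N (x k) / Real.sqrt k) atTop (𝓝 0) := by
    refine tendsto_zero_of_contraction hρ0 hρ (fun k => div_nonneg (hN0 _) (Real.sqrt_nonneg _))
      hinput ?_
    filter_upwards [eventually_gt_atTop 0] with k hk
    have hk0 : (0 : ℝ) < k := by exact_mod_cast hk
    have hs0 : 0 < Real.sqrt k := Real.sqrt_pos.2 hk0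
    have hs1 : 0 < Real.sqrt ((k : ℝ) + 1) := Real.sqrt_pos.2 (by linarith)
    have h1 : N (x (k + 1)) ≤ ρ * N (x k) + D * ‖z k‖ := by
      refine (hN3 _ _).trans (add_le_add (hN4 _) ((hN2 _).trans ?_))
      rw [hD, mul_assoc]
      exact mul_le_mul_of_nonneg_left (norm_mulVec_le W _) hd.le
    have h2 : ‖z k‖ / Real.sqrt ((k : ℝ) + 1)
        ≤ ∑ j, Real.sqrt (z k j * z k j / ((k : ℝ) + 1)) := by
      have h3 : ∀ j, Real.sqrt (z k j * z k j / ((k : ℝ) + 1))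
          = |z k j| / Real.sqrt ((k : ℝ) + 1) := fun j => by
        rw [Real.sqrt_div (mul_self_nonneg _), Real.sqrt_mul_self_eq_abs]
      simp only [h3, ← Finset.sum_div]
      refine div_le_div_of_nonneg_right ?_ hs1.le
      refine (pi_norm_le_iff_of_nonneg (Finset.sum_nonneg fun j _ => abs_nonneg _)).2 fun j => ?_
      exact Finset.single_le_sum (f := fun j => |z k j|) (fun j _ => abs_nonneg _)
        (Finset.mem_univ j)
    push_cast
    calc N (x (k + 1)) / Real.sqrt ((k : ℝ) + 1)
        ≤ (ρ * N (x k) + D * ‖z k‖) / Real.sqrt ((k : ℝ) + 1) :=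
          div_le_div_of_nonneg_right h1 hs1.le
      _ = ρ * (N (x k) / Real.sqrt ((k : ℝ) + 1)) + D * (‖z k‖ / Real.sqrt ((k : ℝ) + 1)) := by
          ring
      _ ≤ _ := by
          refine add_le_add (mul_le_mul_of_nonneg_left ?_ hρ0) (mul_le_mul_of_nonneg_left h2 hD0)
          exact div_le_div_of_nonneg_left (hN0 _) hs0 (Real.sqrt_le_sqrt (by linarith))
  have hsq : Tendsto (fun k : ℕ => (N (x k) / Real.sqrt k) ^ 2) atTop (𝓝 0) := by
    simpa using hlim.pow 2
  refine squeeze_zero_norm (fun K => ?_) hsq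
  rw [div_pow, Real.sq_sqrt (Nat.cast_nonneg K), norm_mul, norm_mul, Real.norm_eq_abs,
    abs_of_nonneg (by positivity : (0 : ℝ) ≤ (K : ℝ)⁻¹), inv_mul_eq_div, sq]
  refine div_le_div_of_nonneg_right ?_ (Nat.cast_nonneg K)
  exact mul_le_mul ((norm_le_pi_norm _ i).trans (hN1 _)) ((norm_le_pi_norm _ j).trans (hN1 _))
    (norm_nonneg _) (hN0 _)

/-- The response of a stable system to white noise, together with the current noise, has a limit
covariance; that of the response is the solution `Ψ` of the Lyapunov equation. -/
theorem IsWhiteNoise.hasLimitCov_response [DecidableEq a] [IsProbabilityMeasure μ]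
    (he : IsWhiteNoise μ e N) (hA : PowerStable A) {Ψ : Matrix a a ℝ}
    (hΨ : A * Ψ * Aᵀ + W * N * Wᵀ = Ψ) :
    HasLimitCov μ (fun k ω => Sum.elim (linResponse A W (fun j => e j ω) k) (e k ω))
      (fromBlocks Ψ 0 0 N) := by
  have hηm : ∀ k i, MemLp (fun ω => linResponse A W (fun j => e j ω) k i) 2 μ :=
    he.memLp_response A W
  have hem := he.limitCov.memLp
  have hcross : ∀ᵐ ω ∂μ, ∀ i j,
      Tendsto (avg fun k => linResponse A W (fun j => e j ω) k i * e k ω j) atTop (𝓝 0) :=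
    ae_all_iff.2 fun i => ae_all_iff.2 fun j => he.ae_tendsto_avg_response_mul hA i j
  have hnoise : ∀ᵐ ω ∂μ, ∀ i j, Tendsto (avg fun k => e k ω i * e k ω j) atTop (𝓝 (N i j)) :=
    ae_all_iff.2 fun i => ae_all_iff.2 fun j => (he.limitCov i j).tendsto_avg
  have hae : ∀ᵐ ω ∂μ, Tendsto (avgOuter (fun k => linResponse A W (fun j => e j ω) k)
      (fun k => linResponse A W (fun j => e j ω) k)) atTop (𝓝 Ψ) := by
    filter_upwards [hcross, hnoise] with ω hω₁ hω₂
    set x := linResponse A W (fun j => e j ω) with hx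
    set z : ℕ → b → ℝ := fun k => e k ω with hz
    refine hA.tendsto_of_asymptotic_lyapunov hΨ ?_
    have hC : Tendsto (avgOuter x z) atTop (𝓝 0) := tendsto_matrix_iff.2 fun i j => hω₁ i j
    have hE : Tendsto (avgOuter z z) atTop (𝓝 N) := tendsto_matrix_iff.2 fun i j => hω₂ i j
    have hbd : Tendsto (fun K : ℕ => (of fun i j => (K : ℝ)⁻¹ * (x K i * x K j) : Matrix a a ℝ))
        atTop (𝓝 0) := tendsto_matrix_iff.2 fun i j =>
      tendsto_response_sq_div hA (fun j => hω₂ j j) i j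
    have hshift : ∀ K, avgOuter (fun k => x (k + 1)) (fun k => x (k + 1)) K
        = avgOuter x x K + of fun i j => (K : ℝ)⁻¹ * (x K i * x K j) := by
      intro K
      ext i j
      simp only [avgOuter, of_apply, Matrix.add_apply]
      rw [avg_succ_sub (fun k => x k i * x k j)]
      simp [hx, linResponse]
    have hexp : ∀ K, avgOuter (fun k => x (k + 1)) (fun k => x (k + 1)) K
        = A * avgOuter x x K * Aᵀ + A * avgOuter x z K * Wᵀ + W * (avgOuter x z K)ᵀ * Aᵀ
          + W * avgOuter z z K * Wᵀ := by
      intro K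
      have hx1 : (fun k => x (k + 1)) = fun k => A *ᵥ x k + W *ᵥ z k := rfl
      rw [hx1, avgOuter_response_left, avgOuter_response_right, avgOuter_response_right,
        ← avgOuter_transpose x z]
      simp only [Matrix.mul_add, Matrix.mul_assoc]
      abel
    have hlim : Tendsto (fun K => A * avgOuter x z K * Wᵀ + W * (avgOuter x z K)ᵀ * Aᵀ
        + W * avgOuter z z K * Wᵀ - of fun i j => (K : ℝ)⁻¹ * (x K i * x K j)) atTop
        (𝓝 (A * (0 : Matrix a b ℝ) * Wᵀ + W * (0 : Matrix a b ℝ)ᵀ * Aᵀ + W * N * Wᵀ - 0)) :=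
      (((tendsto_matrix_mul (tendsto_matrix_mul tendsto_const_nhds hC) tendsto_const_nhds).add
        (tendsto_matrix_mul (tendsto_matrix_mul tendsto_const_nhds (tendsto_matrix_transpose hC))
          tendsto_const_nhds)).add
        (tendsto_matrix_mul (tendsto_matrix_mul tendsto_const_nhds hE) tendsto_const_nhds)).sub hbd
    simp only [transpose_zero, Matrix.mul_zero, Matrix.zero_mul, zero_add, sub_zero] at hlim
    refine hlim.congr fun K => ?_
    have h4 := (hshift K).symm.trans (hexp K)
    rw [eq_sub_iff_add_eq, sub_add_eq_add_sub, sub_eq_iff_eq_add, h4]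
    abel
  have h12 : ∀ i j, LimCorr μ (fun k ω => linResponse A W (fun j => e j ω) k i)
      (fun k ω => e k ω j) 0 := fun i j =>
    ⟨fun k => hηm k i, fun k => hem k j, by
      refine tendsto_const_nhds.congr fun k => ?_
      exact (congrFun (congrFun (he.response_orthogonal A W k) i) j).symm,
      he.ae_tendsto_avg_response_mul hA i j⟩
  rintro (i | i) (j | j)
  · refine ⟨fun k => hηm k i, fun k => hηm k j,
      tendsto_matrix_iff.1 (he.tendsto_secondMoment_response hA hΨ) i j, ?_⟩
    filter_upwards [hae] with ω hω
    exact tendsto_matrix_iff.1 hω i j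
  · exact h12 i j
  · exact (h12 j i).symm
  · exact he.limitCov i j

end Response

/-! ### Gaussian white noise -/

section Gaussian

variable {b : Type*} [Fintype b] {e : ℕ → Ω → b → ℝ} {N : Matrix b b ℝ}

/-- Independent centred Gaussian vectors with a common covariance are white noise. The strong law
applies to the squares of their linear functionals, which are identically distributed, and
polarization gives the products of components. -/
theorem isWhiteNoise_of_gaussian [IsProbabilityMeasure μ] (hind : iIndepFun e μ)
    (hgauss : ∀ k (c : b → ℝ), HasGaussianLaw (fun ω => c ⬝ᵥ e k ω) μ)
    (hmean : ∀ k i, ∫ ω, e k ω i ∂μ = 0) (hcov : ∀ k, secondMoment μ (e k) (e k) = N) :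
    IsWhiteNoise μ e N := by
  classical
  have hmem : ∀ k i, MemLp (fun ω => e k ω i) 2 μ := by
    intro k i
    have := (hgauss k (Pi.single i 1)).memLp_two
    simpa using this
  have hmean' : ∀ k (c : b → ℝ), ∫ ω, c ⬝ᵥ e k ω ∂μ = 0 := by
    intro k c
    simp only [dotProduct]
    rw [integral_finsetSum _ fun i _ => ((hmem k i).integrable one_le_two).const_mul (c i)]
    simp only [integral_const_mul, hmean, mul_zero, Finset.sum_const_zero]
  have hsq : ∀ k (c : b → ℝ), ∫ ω, (c ⬝ᵥ e k ω) ^ 2 ∂μ = ∑ i, ∑ j, c i * c j * N i j := by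
    intro k c
    have h1 : ∀ ω, (c ⬝ᵥ e k ω) ^ 2 = ∑ i, ∑ j, c i * c j * (e k ω i * e k ω j) := by
      intro ω
      simp only [dotProduct, sq, Finset.sum_mul_sum]
      exact Finset.sum_congr rfl fun i _ => Finset.sum_congr rfl fun j _ => by ring
    have hint : ∀ i j, Integrable (fun ω => c i * c j * (e k ω i * e k ω j)) μ := fun i j =>
      (integrable_mul_of_memLp_two (hmem k i) (hmem k j)).const_mul _
    simp only [h1]
    rw [integral_finsetSum _ fun i _ => integrable_finsetSum _ fun j _ => hint i j]
    refine Finset.sum_congr rfl fun i _ => ?_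
    rw [integral_finsetSum _ fun j _ => hint i j]
    refine Finset.sum_congr rfl fun j _ => ?_
    rw [integral_const_mul, ← hcov k]
    rfl
  have hident : ∀ k (c : b → ℝ),
      IdentDistrib (fun ω => c ⬝ᵥ e k ω) (fun ω => c ⬝ᵥ e 0 ω) μ μ := by
    intro k c
    refine ⟨(hgauss k c).aemeasurable, (hgauss 0 c).aemeasurable, ?_⟩
    rw [(hgauss k c).map_eq_gaussianReal, (hgauss 0 c).map_eq_gaussianReal,
      variance_eq_integral (hgauss k c).aemeasurable,
      variance_eq_integral (hgauss 0 c).aemeasurable]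
    simp only [hmean', sub_zero, hsq]
  have hdot : ∀ c : b → ℝ, Measurable fun x : b → ℝ => c ⬝ᵥ x := fun c =>
    (continuous_const.dotProduct continuous_id).measurable
  have hslln : ∀ c : b → ℝ, ∀ᵐ ω ∂μ, Tendsto (avg fun k => (c ⬝ᵥ e k ω) ^ 2) atTop
      (𝓝 (∑ i, ∑ j, c i * c j * N i j)) := by
    intro c
    have hmeas2 : Measurable fun x : b → ℝ => (c ⬝ᵥ x) ^ 2 := (hdot c).pow_const 2
    have h1 := strong_law_ae_real (fun k ω => (c ⬝ᵥ e k ω) ^ 2)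
      (hgauss 0 c).memLp_two.integrable_sq
      (fun i j hij => (hind.indepFun hij).comp hmeas2 hmeas2)
      (fun k => (hident k c).comp (u := fun r => r ^ 2) (by fun_prop))
    filter_upwards [h1] with ω hω
    rw [hsq] at hω
    refine hω.congr fun K => ?_
    rw [avg, div_eq_inv_mul]
  refine ⟨hind, hmean, hcov, fun i j => ⟨fun k => hmem k i, fun k => hmem k j, ?_, ?_⟩⟩
  · refine tendsto_const_nhds.congr fun k => ?_
    rw [← hcov k]; rfl
  · have hNsym : N j i = N i j := by
      have := congrFun (congrFun (secondMoment_transpose (μ := μ) (e 0) (e 0)) i) j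
      rwa [hcov] at this
    filter_upwards [hslln (Pi.single i 1 + Pi.single j 1), hslln (Pi.single i 1),
      hslln (Pi.single j 1)] with ω h1 h2 h3
    have h4 := ((h1.sub h2).sub h3).const_mul (1 / 2)
    have h5 : (1 / 2 : ℝ) * (∑ p, ∑ q, (Pi.single i 1 + Pi.single j 1 : b → ℝ) p
        * (Pi.single i 1 + Pi.single j 1 : b → ℝ) q * N p q
        - ∑ p, ∑ q, (Pi.single i 1 : b → ℝ) p * (Pi.single i 1 : b → ℝ) q * N p q
        - ∑ p, ∑ q, (Pi.single j 1 : b → ℝ) p * (Pi.single j 1 : b → ℝ) q * N p q) = N i j := by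
      simp [add_mul, mul_add, Finset.sum_add_distrib, Pi.single_apply, hNsym]
      ring
    rw [h5] at h4
    refine h4.congr fun K => ?_
    simp only [avg, ← mul_sub, ← Finset.sum_sub_distrib]
    rw [mul_left_comm, Finset.mul_sum]
    congr 1
    refine Finset.sum_congr rfl fun k _ => ?_
    simp only [add_dotProduct, single_one_dotProduct]
    ring

end Gaussian

/-! ### The filter of a model on data of the true model -/

namespace Model.SVD

variable {n m l : ℕ} {S : Model n m l} (τ : S.SVD)

/-- The time update as a linear function of estimate, input and output. -/
theorem predict_eq (xhat : Fin n → ℝ) (u : Fin m → ℝ) (y : Fin l → ℝ) :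
    τ.predict xhat u y = τ.Ahat *ᵥ xhat + (S.B - τ.G₁ * τ.M₁ * τ.D₁) *ᵥ u
      + (τ.G₁ * τ.M₁ * τ.T₁) *ᵥ y := by
  simp only [predict, dhat₁, Ahat, sub_mulVec, mulVec_sub, ← mulVec_mulVec]
  abel

/-- The residual is the projected innovation. -/
theorem residual_eq (P : Matrix (Fin n) (Fin n) ℝ) (xp : Fin n → ℝ) (u : Fin m → ℝ)
    (y : Fin l → ℝ) :
    τ.residual P xp u y = τ.proj P *ᵥ (τ.T₂ *ᵥ y - τ.C₂ *ᵥ xp - τ.D₂ *ᵥ u) := by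
  simp only [residual, xstar, dhat₂, proj, sub_mulVec, one_mulVec, mulVec_sub, mulVec_add,
    ← mulVec_mulVec]
  abel

theorem correct_eq (P : Matrix (Fin n) (Fin n) ℝ) (xp : Fin n → ℝ) (u : Fin m → ℝ)
    (y : Fin l → ℝ) :
    τ.correct P xp u y
      = ((1 - τ.Ltilde P * τ.C₂) * (1 - τ.G₂ * τ.M₂ P * τ.C₂)) *ᵥ xp
        + τ.gain P *ᵥ (τ.T₂ *ᵥ y - τ.D₂ *ᵥ u) := by
  rw [correct, residual_eq]
  simp only [xstar, dhat₂, gain, proj, Matrix.sub_mul, Matrix.mul_sub, Matrix.one_mul,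
    Matrix.mul_one, sub_mulVec, one_mulVec, mulVec_sub, add_mulVec, ← mulVec_mulVec,
    Matrix.mul_assoc]
  abel

/-- The matrix through which the known input of the model enters the prediction `x̂_{k+1|k}`. -/
noncomputable def inputGain (P : Matrix (Fin n) (Fin n) ℝ) : Matrix (Fin n) (Fin m) ℝ :=
  S.B - τ.G₁ * τ.M₁ * τ.D₁ - τ.Ahat * τ.gain P * τ.D₂

/-- The steady-state input matrix of the output in terms of the total gain. -/
theorem dataGain_eq (P : Matrix (Fin n) (Fin n) ℝ) : τ.dataGain (τ.Ltilde P) (τ.M₂ P)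
    = τ.Ahat * τ.gain P * τ.T₂ + τ.G₁ * τ.M₁ * τ.T₁ := by
  rw [dataGain, gain, proj, add_comm (τ.Ltilde P * _)]

theorem pred_succ (P₀ : Matrix (Fin n) (Fin n) ℝ) (xhat₀ : Fin n → ℝ) (u : ℕ → Fin m → ℝ)
    (y : ℕ → Fin l → ℝ) (k : ℕ) :
    τ.pred P₀ xhat₀ u y (k + 1)
      = (τ.Ahat * (1 - τ.Ltilde (τ.cov P₀ k) * τ.C₂) * (1 - τ.G₂ * τ.M₂ (τ.cov P₀ k) * τ.C₂))
          *ᵥ τ.pred P₀ xhat₀ u y k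
        + τ.dataGain (τ.Ltilde (τ.cov P₀ k)) (τ.M₂ (τ.cov P₀ k)) *ᵥ y (k + 1)
        + τ.inputGain (τ.cov P₀ k) *ᵥ u (k + 1) := by
  have h : τ.est P₀ xhat₀ u y (k + 1)
      = τ.correct (τ.cov P₀ k) (τ.pred P₀ xhat₀ u y k) (u (k + 1)) (y (k + 1)) := rfl
  rw [pred, h, predict_eq, correct_eq, dataGain_eq, inputGain]
  simp only [mulVec_add, mulVec_sub, add_mulVec, sub_mulVec, ← mulVec_mulVec, Matrix.mul_assoc]
  abel

/-- For the true model itself the joint matrix is stable: its lower right block is the error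
transition matrix with the factors in the other order. -/
theorem isStable_jointA_self {P : Matrix (Fin n) (Fin n) ℝ} (hA : IsStable S.A)
    (hK : IsStable (τ.errorMap (τ.gain P))) :
    IsStable (τ.jointA S (τ.Ltilde P) (τ.M₂ P)) := by
  refine isStable_fromBlocks_iff.2 ⟨hA, ?_⟩
  have h := hK.mul_comm
  have h1 : (1 - τ.Ltilde P * τ.C₂) * (1 - τ.G₂ * τ.M₂ P * τ.C₂) = 1 - τ.gain P * τ.C₂ := by
    simp only [gain, proj, Matrix.sub_mul, Matrix.mul_sub, Matrix.one_mul, Matrix.mul_one,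
      Matrix.add_mul, Matrix.mul_assoc]
    abel
  rwa [Matrix.mul_assoc, h1]

theorem likelihood_pos (hτ : τ.DelayFree) {P₀ : Matrix (Fin n) (Fin n) ℝ} (hP₀ : P₀.PosSemidef)
    (xhat₀ : Fin n → ℝ) (u : ℕ → Fin m → ℝ) (y : ℕ → Fin l → ℝ) (k : ℕ) :
    0 < τ.likelihood P₀ xhat₀ u y k :=
  div_pos (Real.exp_pos _) (mul_pos (Real.rpow_pos_of_pos (by positivity) _)
    (Real.sqrt_pos.2 (pdet_pos (τ.Rstar_posSemidef hτ (τ.cov_posSemidef hP₀ k)))))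

theorem log_likelihood (hτ : τ.DelayFree) {P₀ : Matrix (Fin n) (Fin n) ℝ} (hP₀ : P₀.PosSemidef)
    (xhat₀ : Fin n → ℝ) (u : ℕ → Fin m → ℝ) (y : ℕ → Fin l → ℝ) (k : ℕ) :
    Real.log (τ.likelihood P₀ xhat₀ u y k)
      = -(1 / 2) * (τ.nuBar P₀ xhat₀ u y k ⬝ᵥ
          (pinv (τ.Rstar (τ.cov P₀ k)) *ᵥ τ.nuBar P₀ xhat₀ u y k))
        + -(((τ.Rstar (τ.cov P₀ k)).rank : ℝ) / 2 * Real.log (2 * Real.pi)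
          + Real.log (pdet (τ.Rstar (τ.cov P₀ k))) / 2) := by
  have h1 := pdet_pos (τ.Rstar_posSemidef hτ (τ.cov_posSemidef hP₀ k))
  have h2 : (0 : ℝ) < 2 * Real.pi := by positivity
  rw [likelihood, Real.log_div (Real.exp_pos _).ne'
      (mul_pos (Real.rpow_pos_of_pos h2 _) (Real.sqrt_pos.2 h1)).ne', Real.log_exp,
    Real.log_mul (Real.rpow_pos_of_pos h2 _).ne' (Real.sqrt_pos.2 h1).ne', Real.log_rpow h2,
    Real.log_sqrt h1.le]
  ring

end Model.SVD

section Recursion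

variable {Ω' : Type*} {n m l : ℕ} {S Strue : Model n m l} (τ : S.SVD)
  {P₀ : Matrix (Fin n) (Fin n) ℝ} (xhat₀ : Fin n → ℝ)
  {ustar u : ℕ → Ω' → Fin m → ℝ} {d : ℕ → Ω' → Fin Strue.p → ℝ} {w : ℕ → Ω' → Fin n → ℝ}
  {v : ℕ → Ω' → Fin l → ℝ} {x : ℕ → Ω' → Fin n → ℝ} {y : ℕ → Ω' → Fin l → ℝ}

/-- The joint process of true state and prediction is a linear system driven by the noise, up to the
contribution of the inputs. -/
theorem joint_succ (h : IsTrajectory Strue ustar d w v x y) (k : ℕ) (ω : Ω') :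
    joint τ P₀ xhat₀ u x y (k + 1) ω
      = τ.jointA Strue (τ.Ltilde (τ.cov P₀ k)) (τ.M₂ (τ.cov P₀ k)) *ᵥ joint τ P₀ xhat₀ u x y k ω
        + τ.jointW (τ.Ltilde (τ.cov P₀ k)) (τ.M₂ (τ.cov P₀ k))
            *ᵥ Sum.elim (w (k + 1) ω) (v (k + 1) ω)
        + Sum.elim (Strue.B *ᵥ ustar (k + 1) ω + Strue.G *ᵥ d (k + 1) ω)
            (τ.dataGain (τ.Ltilde (τ.cov P₀ k)) (τ.M₂ (τ.cov P₀ k))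
                *ᵥ (Strue.D *ᵥ ustar (k + 1) ω + Strue.H *ᵥ d (k + 1) ω)
              + τ.inputGain (τ.cov P₀ k) *ᵥ u (k + 1) ω) := by
  rw [joint, joint, τ.pred_succ, h.1 (k + 1), h.2 (k + 1), Model.SVD.jointA, Model.SVD.jointW,
    fromBlocks_mulVec, fromBlocks_mulVec]
  simp only [Sum.elim_comp_inl, Sum.elim_comp_inr, ← Sum.elim_add_add, zero_mulVec, add_zero,
    zero_add, one_mulVec, mulVec_add, ← mulVec_mulVec]
  congr 1 <;> abel

/-- The residual is a linear function of the joint process and the current noise, up to the contribution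
of the inputs. -/
theorem res_eq (h : IsTrajectory Strue ustar d w v x y) (k : ℕ) (ω : Ω') :
    res τ P₀ xhat₀ u y k ω = τ.proj (τ.cov P₀ k) *ᵥ
      (fromCols (τ.jointC Strue) (fromCols 0 τ.T₂) *ᵥ
          Sum.elim (joint τ P₀ xhat₀ u x y k ω) (Sum.elim (w (k + 1) ω) (v (k + 1) ω))
        + (τ.T₂ *ᵥ (Strue.D *ᵥ ustar (k + 1) ω + Strue.H *ᵥ d (k + 1) ω)
          - τ.D₂ *ᵥ u (k + 1) ω)) := by
  rw [res, Model.SVD.nuBar, τ.residual_eq, h.2 (k + 1), joint, Model.SVD.jointC,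
    fromCols_mulVec_sumElim, fromCols_mulVec_sumElim, fromCols_mulVec_sumElim]
  congr 1
  simp only [mulVec_add, ← mulVec_mulVec, neg_mulVec, zero_mulVec, zero_add]
  abel

end Recursion

variable {Ω : Type*} [MeasurableSpace Ω] {μ : Measure Ω}

/-! ### The response to white noise of a system with convergent matrices -/

/-- Along a linear recursion whose matrices converge to a stable system, transients and negligible
inputs are forgotten: the state differs by a negligible process from the stationary response to the
noise. -/
theorem IsWhiteNoise.hasLimitCov_of_recursion [IsProbabilityMeasure μ] {a b : Type*} [Fintype a]
    [DecidableEq a] [Fintype b] {e : ℕ → Ω → b → ℝ} {N : Matrix b b ℝ} (he : IsWhiteNoise μ e N)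
    {A : ℕ → Matrix a a ℝ} {A' : Matrix a a ℝ} {W : ℕ → Matrix a b ℝ} {W' : Matrix a b ℝ}
    (hA : Tendsto A atTop (𝓝 A')) (hW : Tendsto W atTop (𝓝 W')) (hA' : PowerStable A')
    {Ψ : Matrix a a ℝ} (hΨ : A' * Ψ * A'ᵀ + W' * N * W'ᵀ = Ψ) {ξ g : ℕ → Ω → a → ℝ}
    (hξ₀ : ∀ i, MemLp (fun ω => ξ 0 ω i) 2 μ) (hg : Negligible μ g)
    (hrec : ∀ k ω, ξ (k + 1) ω = A k *ᵥ ξ k ω + W k *ᵥ e k ω + g k ω) :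
    HasLimitCov μ (fun k ω => Sum.elim (ξ k ω) (e k ω)) (fromBlocks Ψ 0 0 N) := by
  set η : ℕ → Ω → a → ℝ := fun k ω => linResponse A' W' (fun j => e j ω) k with hη
  have hηe : HasLimitCov μ (fun k ω => Sum.elim (η k ω) (e k ω)) (fromBlocks Ψ 0 0 N) :=
    he.hasLimitCov_response hA' hΨ
  set δ : ℕ → Ω → a → ℝ := fun k ω => ξ k ω - η k ω with hδ
  have hperturb : Negligible μ fun k ω =>
      fromCols (A k - A') (W k - W') *ᵥ Sum.elim (η k ω) (e k ω) := by
    refine hηe.vanishing_mulVec (tendsto_matrix_iff.2 ?_)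
    have hA0 : Tendsto (fun k => A k - A') atTop (𝓝 0) := by simpa using hA.sub_const A'
    have hW0 : Tendsto (fun k => W k - W') atTop (𝓝 0) := by simpa using hW.sub_const W'
    rintro i (j | j)
    · exact tendsto_matrix_iff.1 hA0 i j
    · exact tendsto_matrix_iff.1 hW0 i j
  have hδ0 : ∀ i, MemLp (fun ω => δ 0 ω i) 2 μ := by
    have hη0 : ∀ ω, η 0 ω = 0 := fun ω => rfl
    simpa only [hδ, hη0, sub_zero] using hξ₀
  have hδrec : ∀ k ω, δ (k + 1) ω = A k *ᵥ δ k ω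
      + (fromCols (A k - A') (W k - W') *ᵥ Sum.elim (η k ω) (e k ω) + g k ω) := by
    intro k ω
    have hη1 : η (k + 1) ω = A' *ᵥ η k ω + W' *ᵥ e k ω := rfl
    simp only [hδ]
    rw [hη1, hrec, fromCols_mulVec_sumElim, sub_mulVec, sub_mulVec, mulVec_sub]
    abel
  have hδN : Negligible μ δ := negligible_of_recursion hA hA' hδ0 (hperturb.add hg) hδrec
  have hN : Negligible μ fun k ω => (Sum.elim (δ k ω) 0 : a ⊕ b → ℝ) := by
    rintro (i | i)
    · exact hδN i
    · exact negligible_of_eventually_zero (g := fun _ _ => (0 : b → ℝ)) (T := 0)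
        (fun k i => MemLp.zero') (fun _ _ _ => rfl) i
  have h1 := hηe.add_negligible hN
  simp only [← Sum.elim_add_add, hδ, add_sub_cancel, add_zero] at h1
  exact h1

/-! ### The joint process of true state and prediction -/

section Joint

variable {n m l : ℕ}

/-- The noises are paired at the same time `k + 1`: they drive the step of `(x_{k+1}, x̂_{k+1|k})` to
`(x_{k+2}, x̂_{k+2|k+1})`, which uses the output `y_{k+1}`. -/
theorem IsGaussianNoise.isWhiteNoise [IsProbabilityMeasure μ] {S : Model n m l}
    {x₀ : Ω → Fin n → ℝ} {w : ℕ → Ω → Fin n → ℝ} {v : ℕ → Ω → Fin l → ℝ}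
    (h : IsGaussianNoise μ S x₀ w v) :
    IsWhiteNoise μ (fun k ω => Sum.elim (w (k + 1) ω) (v (k + 1) ω))
      (fromBlocks S.Q 0 0 S.R) := by
  have hw : ∀ k i, MemLp (fun ω => w k ω i) 2 μ := fun k =>
    memLp_pi_iff.1 (h.gaussian_w k).memLp_two
  have hv : ∀ k i, MemLp (fun ω => v k ω i) 2 μ := fun k =>
    memLp_pi_iff.1 (h.gaussian_v k).memLp_two
  have hcross : ∀ k i j, ∫ ω, w k ω i * v k ω j ∂μ = 0 := by
    intro k i j
    have h1 := (h.indep_w_v k).comp (measurable_pi_apply i) (measurable_pi_apply j)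
    have h2 : ∫ ω, w k ω i * v k ω j ∂μ = (∫ ω, w k ω i ∂μ) * ∫ ω, v k ω j ∂μ :=
      h1.integral_fun_mul_eq_mul_integral (hw k i).aestronglyMeasurable
        (hv k j).aestronglyMeasurable
    rw [h2, h.mean_w, zero_mul]
  refine isWhiteNoise_of_gaussian ?_ ?_ ?_ ?_
  · have h1 := h.indep_time.precomp (g := fun k => k + 1) (add_left_injective 1)
    refine h1.comp (fun _ p => Sum.elim p.1 p.2) fun _ => measurable_pi_lambda _ ?_
    rintro (i | i)
    · exact (measurable_pi_apply i).comp measurable_fst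
    · exact (measurable_pi_apply i).comp measurable_snd
  · intro k c
    have h1 := (h.indep_w_v (k + 1)).hasGaussianLaw (h.gaussian_w _) (h.gaussian_v _)
    let L : ((Fin n → ℝ) × (Fin l → ℝ)) →ₗ[ℝ] ℝ :=
      { toFun := fun p => c ⬝ᵥ Sum.elim p.1 p.2
        map_add' := fun p q => by
          simp only [dotProduct, Fintype.sum_sum_type, Sum.elim_inl, Sum.elim_inr, Prod.fst_add,
            Prod.snd_add, Pi.add_apply, mul_add, Finset.sum_add_distrib]
          ring
        map_smul' := fun r p => by
          simp only [dotProduct, Fintype.sum_sum_type, Sum.elim_inl, Sum.elim_inr, Prod.smul_fst,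
            Prod.smul_snd, Pi.smul_apply, smul_eq_mul, Finset.mul_sum, RingHom.id_apply, mul_add]
          congr 1 <;> exact Finset.sum_congr rfl fun _ _ => by ring }
    exact h1.map_fun (LinearMap.toContinuousLinearMap L)
  · rintro k (i | i)
    · exact h.mean_w _ i
    · exact h.mean_v _ i
  · intro k
    ext i j
    rcases i with i | i <;> rcases j with j | j
    · rw [fromBlocks_apply₁₁, ← h.cov_w (k + 1)]; rfl
    · exact hcross _ i j
    · simp only [secondMoment, of_apply, Sum.elim_inl, Sum.elim_inr, mul_comm, hcross,
        fromBlocks_apply₂₁, Matrix.zero_apply]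
    · rw [fromBlocks_apply₂₂, ← h.cov_v (k + 1)]; rfl

/-- The standing assumptions on the data: noises and state of the true model `S`, and inputs with
finite second moments that vanish from time `T` on. -/
structure IsData (μ : Measure Ω) (S : Model n m l) (ustar : ℕ → Ω → Fin m → ℝ)
    (d : ℕ → Ω → Fin S.p → ℝ) (w : ℕ → Ω → Fin n → ℝ) (v : ℕ → Ω → Fin l → ℝ)
    (x : ℕ → Ω → Fin n → ℝ) (y : ℕ → Ω → Fin l → ℝ) (T : ℕ) : Prop where
  noise : IsGaussianNoise μ S (x 0) w v
  trajectory : IsTrajectory S ustar d w v x y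
  memLp_u : ∀ k i, MemLp (fun ω => ustar k ω i) 2 μ
  memLp_d : ∀ k i, MemLp (fun ω => d k ω i) 2 μ
  u_eq_zero : ∀ k ≥ T, ustar k = 0
  d_eq_zero : ∀ k ≥ T, d k = 0

variable {S Strue : Model n m l} (τ : S.SVD) {P₀ : Matrix (Fin n) (Fin n) ℝ} (xhat₀ : Fin n → ℝ)
  {ustar u : ℕ → Ω → Fin m → ℝ} {d : ℕ → Ω → Fin Strue.p → ℝ} {w : ℕ → Ω → Fin n → ℝ}
  {v : ℕ → Ω → Fin l → ℝ} {x : ℕ → Ω → Fin n → ℝ} {y : ℕ → Ω → Fin l → ℝ} {T : ℕ}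

theorem memLp_joint_zero [IsProbabilityMeasure μ] (h : IsData μ Strue ustar d w v x y T)
    (hu : ∀ k i, MemLp (fun ω => u k ω i) 2 μ) (i : Fin n ⊕ Fin n) :
    MemLp (fun ω => joint τ P₀ xhat₀ u x y 0 ω i) 2 μ := by
  have hx : ∀ i, MemLp (fun ω => x 0 ω i) 2 μ := memLp_pi_iff.1 h.noise.gaussian_x₀.memLp_two
  have hx1 : ∀ i, MemLp (fun ω => x (0 + 1) ω i) 2 μ := by
    intro i
    simp only [h.trajectory.1 0, Pi.add_apply]
    exact (((memLp_mulVec hx _ i).add (memLp_mulVec (h.memLp_u 0) _ i)).add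
      (memLp_mulVec (h.memLp_d 0) _ i)).add (memLp_pi_iff.1 (h.noise.gaussian_w 0).memLp_two i)
  have hy : ∀ i, MemLp (fun ω => y 0 ω i) 2 μ := by
    intro i
    simp only [h.trajectory.2 0, Pi.add_apply]
    exact (((memLp_mulVec hx _ i).add (memLp_mulVec (h.memLp_u 0) _ i)).add
      (memLp_mulVec (h.memLp_d 0) _ i)).add (memLp_pi_iff.1 (h.noise.gaussian_v 0).memLp_two i)
  rcases i with i | i
  · exact hx1 i
  · have hpred : ∀ ω, joint τ P₀ xhat₀ u x y 0 ω (Sum.inr i) = (τ.Ahat *ᵥ xhat₀) i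
        + ((S.B - τ.G₁ * τ.M₁ * τ.D₁) *ᵥ u 0 ω) i + ((τ.G₁ * τ.M₁ * τ.T₁) *ᵥ y 0 ω) i :=
      fun ω => congrFun (τ.predict_eq xhat₀ (u 0 ω) (y 0 ω)) i
    simp only [hpred]
    have h1 : MemLp (fun _ : Ω => (τ.Ahat *ᵥ xhat₀) i) 2 μ := memLp_const _
    exact (h1.add (memLp_mulVec (hu 0) (S.B - τ.G₁ * τ.M₁ * τ.D₁) i)).add
      (memLp_mulVec hy (τ.G₁ * τ.M₁ * τ.T₁) i)

/-- The filter forgets its transient: the joint process differs from the stationary response to the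
noise by a negligible process, whence the limit covariance `Ψ` of the joint process and that of the
residual. -/
theorem exists_hasLimitCov [IsProbabilityMeasure μ] (hτ : τ.DelayFree) (hP₀ : P₀.PosSemidef)
    (h : IsData μ Strue ustar d w v x y T) (hu : ∀ k i, MemLp (fun ω => u k ω i) 2 μ)
    (huT : ∀ k ≥ T, u k = 0) {P : Matrix (Fin n) (Fin n) ℝ} (hP : P.PosSemidef)
    (hcov : Tendsto (τ.cov P₀) atTop (𝓝 P))
    (hst : IsStable (τ.jointA Strue (τ.Ltilde P) (τ.M₂ P))) :
    ∃ Ψ, τ.lyapunovStep Strue (τ.Ltilde P) (τ.M₂ P) Ψ = Ψ ∧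
      HasLimitCov μ (joint τ P₀ xhat₀ u x y) Ψ ∧
      HasLimitCov μ (res τ P₀ xhat₀ u y) (τ.mismatchedCov Strue (τ.M₂ P) Ψ) := by
  have hXP := fun k => τ.cov_posSemidef hP₀ k
  have hL := τ.tendsto_Ltilde hτ hP hXP hcov
  have hM := τ.tendsto_M₂ hτ hP hcov
  have hgain := τ.tendsto_gain hτ hP hXP hcov
  have hpow := hst.powerStable
  set A' := τ.jointA Strue (τ.Ltilde P) (τ.M₂ P) with hA'
  set W' := τ.jointW (τ.Ltilde P) (τ.M₂ P) with hW'
  set A := fun k => τ.jointA Strue (τ.Ltilde (τ.cov P₀ k)) (τ.M₂ (τ.cov P₀ k)) with hA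
  set W := fun k => τ.jointW (τ.Ltilde (τ.cov P₀ k)) (τ.M₂ (τ.cov P₀ k)) with hW
  have hdata : Tendsto (fun k => τ.dataGain (τ.Ltilde (τ.cov P₀ k)) (τ.M₂ (τ.cov P₀ k))) atTop
      (𝓝 (τ.dataGain (τ.Ltilde P) (τ.M₂ P))) := by
    simp only [τ.dataGain_eq]
    exact (tendsto_matrix_mul (tendsto_matrix_mul tendsto_const_nhds hgain)
      tendsto_const_nhds).add tendsto_const_nhds
  have hAlim : Tendsto A atTop (𝓝 A') := by
    have h1 := tendsto_matrix_mul hdata (tendsto_const_nhds (x := Strue.C))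
    have h2 : Tendsto (fun k => τ.Ahat * (1 - τ.Ltilde (τ.cov P₀ k) * τ.C₂)
        * (1 - τ.G₂ * τ.M₂ (τ.cov P₀ k) * τ.C₂)) atTop
        (𝓝 (τ.Ahat * (1 - τ.Ltilde P * τ.C₂) * (1 - τ.G₂ * τ.M₂ P * τ.C₂))) :=
      tendsto_matrix_mul (tendsto_matrix_mul tendsto_const_nhds
        (tendsto_const_nhds.sub (tendsto_matrix_mul hL tendsto_const_nhds)))
        (tendsto_const_nhds.sub (tendsto_matrix_mul (tendsto_matrix_mul tendsto_const_nhds hM)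
          tendsto_const_nhds))
    refine tendsto_matrix_iff.2 ?_
    rintro (i | i) (j | j)
    · exact tendsto_const_nhds
    · exact tendsto_const_nhds
    · exact tendsto_matrix_iff.1 h1 i j
    · exact tendsto_matrix_iff.1 h2 i j
  have hWlim : Tendsto W atTop (𝓝 W') := by
    refine tendsto_matrix_iff.2 ?_
    rintro (i | i) (j | j)
    · exact tendsto_const_nhds
    · exact tendsto_const_nhds
    · exact tendsto_const_nhds
    · exact tendsto_matrix_iff.1 hdata i j
  obtain ⟨Ψ, hΨ⟩ := hpow.exists_lyapunov (W' * fromBlocks Strue.Q 0 0 Strue.R * W'ᵀ)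
  have hwhite := h.noise.isWhiteNoise
  set e : ℕ → Ω → Fin n ⊕ Fin l → ℝ := fun k ω => Sum.elim (w (k + 1) ω) (v (k + 1) ω) with he
  -- the terms from the inputs
  set g : ℕ → Ω → Fin n ⊕ Fin n → ℝ := fun k ω =>
    Sum.elim (Strue.B *ᵥ ustar (k + 1) ω + Strue.G *ᵥ d (k + 1) ω)
      (τ.dataGain (τ.Ltilde (τ.cov P₀ k)) (τ.M₂ (τ.cov P₀ k))
          *ᵥ (Strue.D *ᵥ ustar (k + 1) ω + Strue.H *ᵥ d (k + 1) ω)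
        + τ.inputGain (τ.cov P₀ k) *ᵥ u (k + 1) ω) with hg
  have hy : ∀ k i, MemLp (fun ω => (Strue.D *ᵥ ustar k ω + Strue.H *ᵥ d k ω) i) 2 μ :=
    fun k i => (memLp_mulVec (h.memLp_u k) _ i).add (memLp_mulVec (h.memLp_d k) _ i)
  have hgN : Negligible μ g := by
    refine negligible_of_eventually_zero (T := T) ?_ ?_
    · rintro k (i | i)
      · exact (memLp_mulVec (h.memLp_u _) _ i).add (memLp_mulVec (h.memLp_d _) _ i)
      · exact (memLp_mulVec (hy _) _ i).add (memLp_mulVec (hu _) _ i)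
    · intro k hk ω
      have hk' : k + 1 ≥ T := by omega
      simp only [hg, h.u_eq_zero _ hk', h.d_eq_zero _ hk', huT _ hk', Pi.zero_apply, mulVec_zero,
        add_zero]
      ext (i | i) <;> rfl
  set innov : ℕ → Ω → Fin τ.t → ℝ := fun k ω =>
    τ.T₂ *ᵥ (Strue.D *ᵥ ustar (k + 1) ω + Strue.H *ᵥ d (k + 1) ω) - τ.D₂ *ᵥ u (k + 1) ω
    with hinnov
  have hinnovN : Negligible μ innov := by
    refine negligible_of_eventually_zero (T := T) ?_ ?_
    · exact fun k i => (memLp_mulVec (hy _) _ i).sub (memLp_mulVec (hu _) _ i)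
    · intro k hk ω
      have hk' : k + 1 ≥ T := by omega
      simp only [hinnov, h.u_eq_zero _ hk', h.d_eq_zero _ hk', huT _ hk', Pi.zero_apply,
        mulVec_zero, add_zero, sub_zero]
  have hjoint : HasLimitCov μ
      (fun k ω => Sum.elim (joint τ P₀ xhat₀ u x y k ω) (e k ω))
      (fromBlocks Ψ 0 0 (fromBlocks Strue.Q 0 0 Strue.R)) :=
    hwhite.hasLimitCov_of_recursion hAlim hWlim hpow hΨ
      (memLp_joint_zero τ xhat₀ h hu) hgN fun k ω => joint_succ τ xhat₀ h.trajectory k ω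
  refine ⟨Ψ, hΨ, fun i j => hjoint (Sum.inl i) (Sum.inl j), ?_⟩
  set F : Matrix (Fin τ.t) ((Fin n ⊕ Fin n) ⊕ (Fin n ⊕ Fin l)) ℝ :=
    fromCols (τ.jointC Strue) (fromCols 0 τ.T₂) with hF
  have h1 := ((hjoint.const_mulVec F).add_negligible hinnovN).mulVec (τ.tendsto_proj hτ hP hcov)
  have h2 : F * fromBlocks Ψ 0 0 (fromBlocks Strue.Q 0 0 Strue.R) * Fᵀ
      = τ.jointC Strue * Ψ * (τ.jointC Strue)ᵀ + τ.T₂ * Strue.R * τ.T₂ᵀ := by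
    simp [hF, fromCols_mul_fromBlocks, transpose_fromCols, fromCols_mul_fromRows]
  rw [h2] at h1
  have h3 : res τ P₀ xhat₀ u y = fun k ω => τ.proj (τ.cov P₀ k) *ᵥ
      (F *ᵥ Sum.elim (joint τ P₀ xhat₀ u x y k ω) (e k ω) + innov k ω) := by
    funext k ω
    exact res_eq τ xhat₀ h.trajectory k ω
  rw [h3]
  exact h1

end Joint

/-! ### Log-likelihoods -/

/-- A sequence of integrable random variables whose expectations converge and whose time averages
converge almost surely to the same limit. -/
def MeanErgodic (μ : Measure Ω) (X : ℕ → Ω → ℝ) : Prop :=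
  (∀ k, Integrable (X k) μ) ∧ ∃ c, Tendsto (fun k => ∫ ω, X k ω ∂μ) atTop (𝓝 c) ∧
    ∀ᵐ ω ∂μ, Tendsto (avg fun k => X k ω) atTop (𝓝 c)

/-- The log-likelihood is a quadratic form of the residual with a convergent weight, plus a convergent
deterministic sequence. -/
theorem meanErgodic_log_lik [IsProbabilityMeasure μ] {n m l : ℕ} {S : Model n m l} (τ : S.SVD)
    (hτ : τ.DelayFree) {P₀ P : Matrix (Fin n) (Fin n) ℝ} (hP₀ : P₀.PosSemidef)
    (hP : P.PosSemidef) (hcov : Tendsto (τ.cov P₀) atTop (𝓝 P)) (xhat₀ : Fin n → ℝ)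
    {u : ℕ → Ω → Fin m → ℝ} {y : ℕ → Ω → Fin l → ℝ} {Ξ : Matrix (Fin τ.t) (Fin τ.t) ℝ}
    (h : HasLimitCov μ (res τ P₀ xhat₀ u y) Ξ) :
    MeanErgodic μ fun k ω => Real.log (lik τ P₀ xhat₀ u y k ω) := by
  have hXP := fun k => τ.cov_posSemidef hP₀ k
  obtain ⟨hint, c, hc, hae⟩ := h.exists_tendsto_quad (τ.tendsto_pinv_Rstar hτ hP hXP hcov)
  have hdet := ((Real.continuousAt_log (pdet_pos (τ.Rstar_posSemidef hτ hP)).ne').tendsto.comp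
    (τ.tendsto_pdet_Rstar hτ hP hXP hcov)).div_const 2
  have hconst := ((((τ.tendsto_rank_Rstar hτ hP hXP hcov).div_const 2).mul_const
    (Real.log (2 * Real.pi))).add hdet).neg
  simp only [Function.comp_def] at hconst
  have hlog : (fun k ω => Real.log (lik τ P₀ xhat₀ u y k ω)) = fun k ω =>
      -(1 / 2) * (res τ P₀ xhat₀ u y k ω ⬝ᵥ
          (pinv (τ.Rstar (τ.cov P₀ k)) *ᵥ res τ P₀ xhat₀ u y k ω))
        + -(((τ.Rstar (τ.cov P₀ k)).rank : ℝ) / 2 * Real.log (2 * Real.pi)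
          + Real.log (pdet (τ.Rstar (τ.cov P₀ k))) / 2) := by
    funext k ω
    exact τ.log_likelihood hτ hP₀ xhat₀ _ _ k
  rw [hlog]
  refine ⟨fun k => ((hint k).const_mul _).add (integrable_const _), _,
    ((hc.const_mul (-(1 / 2))).add hconst).congr fun k => ?_, ?_⟩
  · rw [integral_add ((hint k).const_mul _) (integrable_const _), integral_const_mul,
      integral_const]
    simp
  · filter_upwards [hae] with ω hω
    refine ((hω.const_mul (-(1 / 2))).add (tendsto_avg_of_tendsto hconst)).congr fun K => ?_
    rw [avg_add, avg_const_mul]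

theorem logRatioErgodic_of_meanErgodic {fs fj fi : ℕ → Ω → ℝ} (hs0 : ∀ k ω, 0 < fs k ω)
    (hj0 : ∀ k ω, 0 < fj k ω) (hi0 : ∀ k ω, 0 < fi k ω)
    (hs : MeanErgodic μ fun k ω => Real.log (fs k ω))
    (hj : MeanErgodic μ fun k ω => Real.log (fj k ω))
    (hi : MeanErgodic μ fun k ω => Real.log (fi k ω)) : LogRatioErgodic μ fs fj fi := by
  obtain ⟨is, cs, es, -⟩ := hs
  obtain ⟨ij, cj, ej, aj⟩ := hj
  obtain ⟨ii, ci, ei, ai⟩ := hi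
  have h1 : ∀ k ω, Real.log (fs k ω / fi k ω) = Real.log (fs k ω) - Real.log (fi k ω) :=
    fun k ω => Real.log_div (hs0 k ω).ne' (hi0 k ω).ne'
  have h2 : ∀ k ω, Real.log (fs k ω / fj k ω) = Real.log (fs k ω) - Real.log (fj k ω) :=
    fun k ω => Real.log_div (hs0 k ω).ne' (hj0 k ω).ne'
  have h3 : ∀ k ω, Real.log (fj k ω / fi k ω) = Real.log (fj k ω) - Real.log (fi k ω) :=
    fun k ω => Real.log_div (hj0 k ω).ne' (hi0 k ω).ne'
  have hD : cs - ci - (cs - cj) = cj - ci := by ring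
  simp only [LogRatioErgodic, h1, h2, h3]
  refine ⟨fun k => (is k).sub (ii k), fun k => (is k).sub (ij k), fun k => (ij k).sub (ii k),
    cs - ci, cs - cj, ?_, ?_, ?_, ?_⟩
  · exact (es.sub ei).congr fun k => (integral_sub (is k) (ii k)).symm
  · exact (es.sub ej).congr fun k => (integral_sub (is k) (ij k)).symm
  · rw [hD]
    exact (ej.sub ei).congr fun k => (integral_sub (ij k) (ii k)).symm
  · rw [hD]
    filter_upwards [aj, ai] with ω hωj hωi
    refine (hωj.sub hωi).congr fun K => ?_
    simp only [avg]
    rw [← mul_sub, ← Finset.sum_sub_distrib, div_eq_inv_mul]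

/-- The log-likelihood ratio of a model with itself is `0`, also where the likelihood has the value `0`. -/
theorem logRatioErgodic_self (f : ℕ → Ω → ℝ) : LogRatioErgodic μ f f f := by
  have h : ∀ k ω, Real.log (f k ω / f k ω) = 0 := fun k ω => by
    rcases eq_or_ne (f k ω) 0 with h0 | h0 <;> simp [h0]
  simp only [LogRatioErgodic, h]
  refine ⟨fun _ => integrable_zero _ _ _, fun _ => integrable_zero _ _ _,
    fun _ => integrable_zero _ _ _, 0, 0, ?_⟩
  simp

end MultiModel

theorem mainTheorem10 {Ω : Type*} [MeasurableSpace Ω] (μ : Measure Ω) [IsProbabilityMeasure μ]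
    {n m l : ℕ} {ι : Type*} (𝒬 : Finset ι) (star : ι)
    (S : ι → MultiModel.Model n m l) (τ : ∀ q, (S q).SVD)
    (P₀ : ι → Matrix (Fin n) (Fin n) ℝ) (xhat₀ : ι → Fin n → ℝ)
    (w : ℕ → Ω → Fin n → ℝ) (v : ℕ → Ω → Fin l → ℝ)
    (u : ι → ℕ → Ω → Fin m → ℝ) (d : ℕ → Ω → Fin (S star).p → ℝ)
    (x : ℕ → Ω → Fin n → ℝ) (y : ℕ → Ω → Fin l → ℝ) (T : ℕ)
    -- the data come from the true model `star`
    (hnoise : MultiModel.IsGaussianNoise μ (S star) (x 0) w v)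
    (hxy : MultiModel.IsTrajectory (S star) (u star) d w v x y)
    -- known and unknown inputs have finite second moments and vanish from time `T` on
    (hu : ∀ q k, MemLp (u q k) 2 μ) (hd : ∀ k, MemLp (d k) 2 μ)
    (huT : ∀ q, ∀ k ≥ T, u q k = 0) (hdT : ∀ k ≥ T, d k = 0)
    (hP₀ : ∀ q, (P₀ q).PosSemidef)
    (hstar : (S star).StronglyDetectable ∧ (τ star).DelayFree)
    (hmodels : ∀ q ∈ 𝒬, q ≠ star →
      (S q).StronglyDetectable ∧ (S q).Stabilizable ∧ (τ q).DelayFree) :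
    -- the filters of the mismatched models have steady-state gains
    (∀ q ∈ 𝒬, q ≠ star →
      (∃ L, Tendsto (fun k => (τ q).Ltilde ((τ q).cov (P₀ q) k)) atTop (𝓝 L)) ∧
      (∃ M, Tendsto (fun k => (τ q).M₂ ((τ q).cov (P₀ q) k)) atTop (𝓝 M))) ∧
    -- and if the joint matrices formed with these gains are stable, then
    ∀ (L : ∀ q, Matrix (Fin n) (Fin (τ q).t) ℝ) (M : ∀ q, Matrix (Fin (τ q).s) (Fin (τ q).t) ℝ),
      (∀ q ∈ 𝒬, q ≠ star →
        Tendsto (fun k => (τ q).Ltilde ((τ q).cov (P₀ q) k)) atTop (𝓝 (L q)) ∧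
        Tendsto (fun k => (τ q).M₂ ((τ q).cov (P₀ q) k)) atTop (𝓝 (M q)) ∧
        MultiModel.IsStable ((τ q).jointA (S star) (L q) (M q))) →
      -- the log-likelihood ratios are ergodic,
      (∀ i ∈ 𝒬, ∀ j ∈ 𝒬, MultiModel.LogRatioErgodic μ
        (MultiModel.lik (τ star) (P₀ star) (xhat₀ star) (u star) y)
        (MultiModel.lik (τ j) (P₀ j) (xhat₀ j) (u j) y)
        (MultiModel.lik (τ i) (P₀ i) (xhat₀ i) (u i) y)) ∧
      -- and the Lyapunov recursion has a limit that gives the mismatched residual covariance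
      (∀ q ∈ 𝒬, q ≠ star →
        ∃ Ψ : Matrix (Fin n ⊕ Fin n) (Fin n ⊕ Fin n) ℝ,
          (∀ Ψ₀ : Matrix (Fin n ⊕ Fin n) (Fin n ⊕ Fin n) ℝ,
            Tendsto (fun k => ((τ q).lyapunovStep (S star) (L q) (M q))^[k] Ψ₀)
              atTop (𝓝 Ψ)) ∧
          Tendsto (fun k => MultiModel.secondMoment μ
              (MultiModel.joint (τ q) (P₀ q) (xhat₀ q) (u q) x y k)
              (MultiModel.joint (τ q) (P₀ q) (xhat₀ q) (u q) x y k)) atTop (𝓝 Ψ) ∧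
          Tendsto (fun k => MultiModel.secondMoment μ
              (MultiModel.res (τ q) (P₀ q) (xhat₀ q) (u q) y k)
              (MultiModel.res (τ q) (P₀ q) (xhat₀ q) (u q) y k)) atTop
            (𝓝 ((τ q).mismatchedCov (S star) (M q) Ψ))) := by
  have hgains : ∀ q ∈ 𝒬, q ≠ star → ∃ P, P.PosSemidef ∧
      Tendsto ((τ q).cov (P₀ q)) atTop (𝓝 P) ∧
      MultiModel.IsStable ((τ q).errorMap ((τ q).gain P)) := fun q hq hne =>
    (τ q).exists_tendsto_cov (hmodels q hq hne).1 (hmodels q hq hne).2.1 (hmodels q hq hne).2.2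
      (hP₀ q)
  have hcovs := fun q k => (τ q).cov_posSemidef (hP₀ q) k
  refine ⟨fun q hq hne => ?_, fun L M hLM => ?_⟩
  · obtain ⟨P, hP, hlim, -⟩ := hgains q hq hne
    have hτ := (hmodels q hq hne).2.2
    exact ⟨⟨_, (τ q).tendsto_Ltilde hτ hP (hcovs q) hlim⟩, ⟨_, (τ q).tendsto_M₂ hτ hP hlim⟩⟩
  have hu' : ∀ q k i, MemLp (fun ω => u q k ω i) 2 μ := fun q k => memLp_pi_iff.1 (hu q k)
  have hdata : MultiModel.IsData μ (S star) (u star) d w v x y T :=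
    ⟨hnoise, hxy, hu' star, fun k => memLp_pi_iff.1 (hd k), huT star, hdT⟩
  have hmis : ∀ q ∈ 𝒬, q ≠ star → ∃ P, P.PosSemidef ∧ Tendsto ((τ q).cov (P₀ q)) atTop (𝓝 P) ∧
      L q = (τ q).Ltilde P ∧ M q = (τ q).M₂ P := by
    intro q hq hne
    obtain ⟨P, hP, hlim, -⟩ := hgains q hq hne
    have hτ := (hmodels q hq hne).2.2
    obtain ⟨hL, hM, -⟩ := hLM q hq hne
    exact ⟨P, hP, hlim, tendsto_nhds_unique hL ((τ q).tendsto_Ltilde hτ hP (hcovs q) hlim),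
      tendsto_nhds_unique hM ((τ q).tendsto_M₂ hτ hP hlim)⟩
  have hlimit : ∀ q ∈ 𝒬, q ≠ star →
      ∃ Ψ, (τ q).lyapunovStep (S star) (L q) (M q) Ψ = Ψ ∧
        MultiModel.HasLimitCov μ (MultiModel.joint (τ q) (P₀ q) (xhat₀ q) (u q) x y) Ψ ∧
        MultiModel.HasLimitCov μ (MultiModel.res (τ q) (P₀ q) (xhat₀ q) (u q) y)
          ((τ q).mismatchedCov (S star) (M q) Ψ) := by
    intro q hq hne
    obtain ⟨P, hP, hlim, hLP, hMP⟩ := hmis q hq hne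
    have hst := (hLM q hq hne).2.2
    rw [hLP, hMP] at hst ⊢
    exact MultiModel.exists_hasLimitCov (τ q) (xhat₀ q) (hmodels q hq hne).2.2 (hP₀ q)
      hdata (hu' q) (huT q) hP hlim hst
  refine ⟨fun i hi j hj => ?_, fun q hq hne => ?_⟩
  · by_cases hex : ∃ q ∈ 𝒬, q ≠ star
    · obtain ⟨q₀, hq₀, hne₀⟩ := hex
      -- the upper left block of any of the stable joint matrices is the matrix of the true model
      have hA : MultiModel.IsStable (S star).A :=
        (MultiModel.isStable_fromBlocks_iff.1 (hLM q₀ hq₀ hne₀).2.2).1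
      have hmean_star : MultiModel.MeanErgodic μ fun k ω =>
          Real.log (MultiModel.lik (τ star) (P₀ star) (xhat₀ star) (u star) y k ω) := by
        obtain ⟨P, hP, hlim, hst⟩ := (τ star).exists_tendsto_cov hstar.1
          ⟨0, 0, by simpa using hA⟩ hstar.2 (hP₀ star)
        obtain ⟨Ψ, -, -, hres⟩ := MultiModel.exists_hasLimitCov (τ star) (xhat₀ star) hstar.2
          (hP₀ star) hdata (hu' star) (huT star) hP hlim ((τ star).isStable_jointA_self hA hst)
        exact MultiModel.meanErgodic_log_lik (τ star) hstar.2 (hP₀ star) hP hlim _ hres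
      have hmean : ∀ q ∈ 𝒬, MultiModel.MeanErgodic μ fun k ω =>
          Real.log (MultiModel.lik (τ q) (P₀ q) (xhat₀ q) (u q) y k ω) := by
        intro q hq
        by_cases hne : q = star
        · rw [hne]; exact hmean_star
        · obtain ⟨P, hP, hlim, -, -⟩ := hmis q hq hne
          obtain ⟨Ψ, -, -, hres⟩ := hlimit q hq hne
          exact MultiModel.meanErgodic_log_lik (τ q) (hmodels q hq hne).2.2 (hP₀ q) hP hlim _ hres
      have hpos : ∀ q, (τ q).DelayFree →
          ∀ k ω, 0 < MultiModel.lik (τ q) (P₀ q) (xhat₀ q) (u q) y k ω := fun q hτ k ω =>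
        (τ q).likelihood_pos hτ (hP₀ q) _ _ _ k
      have hdelay : ∀ q ∈ 𝒬, (τ q).DelayFree := by
        intro q hq
        by_cases hne : q = star
        · rw [hne]; exact hstar.2
        · exact (hmodels q hq hne).2.2
      exact MultiModel.logRatioErgodic_of_meanErgodic (hpos star hstar.2) (hpos j (hdelay j hj))
        (hpos i (hdelay i hi)) hmean_star (hmean j hj) (hmean i hi)
    · have hall : ∀ q ∈ 𝒬, q = star := fun q hq => by
        by_contra hne; exact hex ⟨q, hq, hne⟩
      rw [hall i hi, hall j hj]
      exact MultiModel.logRatioErgodic_self _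
  · obtain ⟨Ψ, hfix, hjoint, hres⟩ := hlimit q hq hne
    exact ⟨Ψ, (hLM q hq hne).2.2.powerStable.tendsto_lyapunov hfix, hjoint.tendsto_secondMoment,
      hres.tendsto_secondMoment⟩
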